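/- Let $R$ be an associative ring with unit, let $\mathbf{t}=(\mathcal{T},\mathcal{F})$ be a torsion pair in the category $R\text{-Mod}$ of left $R$-modules, and write $t(M)$ for the torsion submodule of a module $M$. Let $\mathcal{H}_{\mathbf{t}}$ be the heart of the associated Happel–Reiten–Smalø t-structure, i.e. the full subcategory of the derived category $\mathcal{D}(R)$ consisting of the complexes $M$ with $H^{k}(M)=0$ for $k\neq -1,0$, $H^{-1}(M)\in\mathcal{F}$ and $H^{0}(M)\in\mathcal{T}$. Then $\mathcal{H}_{\mathbf{t}}$ is a module category (i.e. it is equivalent to $S\text{-Mod}$ for some ring $S$ with unit) if, and only if, there is a complex of $R$-modules $$G:\quad \cdots\to 0\to X\xrightarrow{\;j\;}Q\xrightarrow{\;d\;}P\to 0\to\cdots$$ with $P$ in degree $0$ satisfying the following properties, where $V:=H^{0}(G)=\operatorname{Coker}(d)$: 1. $\mathcal{T}=\operatorname{Pres}(V)\subseteq\operatorname{Ker}(\operatorname{Ext}^{1}_{R}(V,-))$; 2. $Q$ and $P$ are finitely generated projective $R$-modules, and $j$ is a monomorphism such that $H^{-1}(G)\in\mathcal{F}$; 3. $H^{-1}(G)\subseteq\operatorname{Rej}_{\mathcal{T}}(Q/X)$,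 where $X$ is viewed as a submodule of $Q$ via $j$ and $H^{-1}(G)=\operatorname{Ker}(d)/X\subseteq Q/X$; 4. $\operatorname{Ext}^{1}_{R}(\operatorname{Coker}(j),-)$ vanishes on $\mathcal{F}$; 5. there are a set $I$ and a homomorphism $h:(Q/X)^{(I)}\to R/t(R)$ such that the cokernel of the restriction of $h$ to $H^{-1}(G)^{(I)}$ belongs to $\overline{\operatorname{Gen}}(V)$. Here $\operatorname{Pres}(V)$ is the class of modules $M$ that admit an exact sequence $V^{(J)}\to V^{(I)}\to M\to 0$ for some sets $I,J$; $\overline{\operatorname{Gen}}(V)$ is the class of $V$-subgenerated modules, i.e. those isomorphic to a submodule of an epimorphic image of some coproduct $V^{(I)}$; and $\operatorname{Rej}_{\mathcal{T}}(M)$ is the intersection of the kernels of all homomorphisms $M\to T$ with $T\in\mathcal{T}$. -/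

import Mathlib

open CategoryTheory

universe w u

/-- A torsion pair in an abelian category. The two classes are full subcategories, given as
isomorphism-closed properties of objects. -/
structure TorsionPair (C : Type*) [Category* C] [Abelian C] where
  /-- the torsion class -/
  T : ObjectProperty C
  /-- the torsion-free class -/
  F : ObjectProperty C
  T_iso : T.IsClosedUnderIsomorphisms
  F_iso : F.IsClosedUnderIsomorphisms
  hom_eq_zero : ∀ (A B : C) (f : A ⟶ B), T A → F B → f = 0
  exists_shortExact : ∀ M : C, ∃ (A B : C) (i : A ⟶ M) (p : M ⟶ B) (hip : i ≫ p = 0),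
    T A ∧ F B ∧ (ShortComplex.mk i p hip).ShortExact

namespace TorsionPair

section Heart

variable {C : Type*} [Category* C] [Abelian C] [HasDerivedCategory.{w} C] (t : TorsionPair C)

/-- The aisle of the Happel–Reiten–Smalø t-structure: the objects of `D^{≤ 0}` whose
zeroth homology is torsion. -/
def aisle : ObjectProperty (DerivedCategory C) := fun K =>
  K.IsLE 0 ∧ t.T ((DerivedCategory.homologyFunctor C 0).obj K)

/-- The co-aisle of the Happel–Reiten–Smalø t-structure: the objects of `D^{≥ -1}` whose
homology in degree `-1` is torsion-free. -/
def coaisle : ObjectProperty (DerivedCategory C) := fun K =>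
  K.IsGE (-1) ∧ t.F ((DerivedCategory.homologyFunctor C (-1)).obj K)

/-- The objects of the heart of the Happel–Reiten–Smalø t-structure. -/
def heart : ObjectProperty (DerivedCategory C) := t.aisle ⊓ t.coaisle

/-- The heart, as a full subcategory of the derived category. -/
abbrev Heart := t.heart.FullSubcategory

end Heart

section Modules

variable {R : Type u} [Ring R] (t : TorsionPair (ModuleCat.{u} R))

/-- The torsion submodule `t(M)`: the largest submodule of `M` that lies in the torsion class
(see `torsion_mem` and `quotient_torsion_mem`). -/
def torsion (M : Type u) [AddCommGroup M] [Module R M] : Submodule R M :=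
  sSup {N | t.T (ModuleCat.of R N)}

theorem torsion_eq_range {M A B : ModuleCat.{u} R} (i : A ⟶ M) (p : M ⟶ B) (hip : i ≫ p = 0)
    (hA : t.T A) (hB : t.F B) (h : (ShortComplex.mk i p hip).ShortExact) :
    t.torsion M = LinearMap.range i.hom := by
  have := t.T_iso
  have hmono : Function.Injective i.hom := (ModuleCat.mono_iff_injective i).1 h.mono_f
  apply le_antisymm
  · refine sSup_le fun N hN x hx => ?_
    have h0 := t.hom_eq_zero _ _ (ModuleCat.ofHom N.subtype ≫ p) hN hB
    have hx0 : p.hom x = 0 := congrArg (fun f => f.hom ⟨x, hx⟩) h0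
    exact (ShortComplex.moduleCat_exact_iff _).1 h.exact x hx0
  · refine le_sSup ?_
    exact t.T.prop_of_iso (LinearEquiv.toModuleIso (LinearEquiv.ofInjective i.hom hmono)) hA

theorem torsion_mem (M : ModuleCat.{u} R) : t.T (ModuleCat.of R (t.torsion M)) := by
  have := t.T_iso
  obtain ⟨A, B, i, p, hip, hA, hB, h⟩ := t.exists_shortExact M
  have hmono : Function.Injective i.hom := (ModuleCat.mono_iff_injective i).1 h.mono_f
  rw [t.torsion_eq_range i p hip hA hB h]
  exact t.T.prop_of_iso (LinearEquiv.toModuleIso (LinearEquiv.ofInjective i.hom hmono)) hA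

theorem quotient_torsion_mem (M : ModuleCat.{u} R) :
    t.F (ModuleCat.of R (M ⧸ t.torsion M)) := by
  have := t.F_iso
  obtain ⟨A, B, i, p, hip, hA, hB, h⟩ := t.exists_shortExact M
  have hepi : Function.Surjective p.hom := (ModuleCat.epi_iff_surjective p).1 h.epi_g
  have hex : LinearMap.range i.hom = LinearMap.ker p.hom :=
    (ShortComplex.moduleCat_exact_iff_range_eq_ker _).1 h.exact
  rw [t.torsion_eq_range i p hip hA hB h, hex]
  exact t.F.prop_of_iso
    (LinearEquiv.toModuleIso (p.hom.quotKerEquivOfSurjective hepi)).symm hB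

end Modules

end TorsionPair

/-- A category is a module category if it is equivalent to the category of left modules over
some (unital, associative) ring. -/
def IsModuleCategory (H : Type*) [Category* H] : Prop :=
  ∃ (S : Type u) (_ : Ring S), Nonempty (H ≌ ModuleCat.{u} S)

section ModuleClasses

variable {R : Type u} [Ring R]

/-- `V`-generated modules: there is an epimorphism `V^(I) → M`. -/
def Gen (V : ModuleCat.{u} R) : ObjectProperty (ModuleCat.{u} R) := fun M =>
  ∃ (I : Type u) (p : (I →₀ V) →ₗ[R] M), Function.Surjective p

/-- `V`-presented modules: there is an exact sequence `V^(J) → V^(I) → M → 0`. -/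
def Pres (V : ModuleCat.{u} R) : ObjectProperty (ModuleCat.{u} R) := fun M =>
  ∃ (I J : Type u) (f : (J →₀ V) →ₗ[R] (I →₀ V)) (p : (I →₀ V) →ₗ[R] M),
    Function.Exact f p ∧ Function.Surjective p

/-- `V`-subgenerated modules: those isomorphic to a submodule of a `V`-generated module. -/
def SubGen (V : ModuleCat.{u} R) : ObjectProperty (ModuleCat.{u} R) := fun M =>
  ∃ (N : ModuleCat.{u} R) (i : M →ₗ[R] N), Gen V N ∧ Function.Injective i

/-- The kernel of `Ext¹(V, ?)`. -/
def KerExtOne (V : ModuleCat.{u} R) : ObjectProperty (ModuleCat.{u} R) := fun M =>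
  Subsingleton (Abelian.Ext V M 1)

/-- The reject of a class of modules in `M`: the intersection of the kernels of all
homomorphisms from `M` to a module of the class. -/
def reject (S : ObjectProperty (ModuleCat.{u} R)) (M : Type u) [AddCommGroup M] [Module R M] :
    Submodule R M :=
  ⨅ (N : ModuleCat.{u} R) (_ : S N) (f : M →ₗ[R] N), LinearMap.ker f

end ModuleClasses

/-- A complex `⋯ → 0 → X → Q → P → 0 → ⋯` of modules, with `P` in degree `0`, so that `Q` is in
degree `-1` and `X` in degree `-2`. -/
structure ThreeTermComplex (R : Type u) [Ring R] where
  X : ModuleCat.{u} R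
  Q : ModuleCat.{u} R
  P : ModuleCat.{u} R
  j : X →ₗ[R] Q
  d : Q →ₗ[R] P
  d_comp_j : d ∘ₗ j = 0

namespace ThreeTermComplex

variable {R : Type u} [Ring R] (G : ThreeTermComplex R)

/-- `H⁰(G) = P / Im d`. -/
abbrev H0 : ModuleCat.{u} R := ModuleCat.of R (G.P ⧸ LinearMap.range G.d)

/-- `Coker j`, which is `Q / X` when `X` is viewed as a submodule of `Q`. -/
abbrev cokerJ : ModuleCat.{u} R := ModuleCat.of R (G.Q ⧸ LinearMap.range G.j)

/-- `H⁻¹(G) = Ker d / Im j`, as a submodule of `Q / X`. -/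
def HNegOne : Submodule R (G.Q ⧸ LinearMap.range G.j) :=
  (LinearMap.ker G.d).map (LinearMap.range G.j).mkQ

/-- The inclusion of `H⁻¹(G)^(I)` in `(Q / X)^(I)`. -/
noncomputable def HNegOneIncl (I : Type u) :
    (I →₀ G.HNegOne) →ₗ[R] (I →₀ G.Q ⧸ LinearMap.range G.j) :=
  Finsupp.mapRange.linearMap G.HNegOne.subtype

end ThreeTermComplex

/-!
Every object of the heart is represented by a complex `A → P` with `P` projective in degree `0`,
torsion-free kernel and torsion cokernel, and morphisms of the heart are the chain maps between
such complexes up to homotopy. Morphisms into a sum of copies of such a complex, taken termwise, can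
then be studied by linear algebra.

By Morita theory the heart is a module category exactly when it has a small projective generator
`G = (A → P)`. Projectivity of `G` says that `Hom(G, M[1]) = 0` for `M` in the heart; it is
equivalent to two extension properties, one against torsion modules (maps `A → T` extend to `P`,
which is condition 3 together with the vanishing of `Ext¹` in condition 1) and one against
torsion-free modules (condition 4). Generation of the torsion modules is `𝒯 = Pres(V)`, and then
condition 5 is what it takes to generate the torsion-free module `R / t(R)`, hence every object.
A small `G` has finitely generated cokernel `V`: the colimit of the quotients of `V` by its finitely
generated submodules vanishes, and smallness makes one of these quotients vanish already. So `P` can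
be chosen finitely generated, and the same argument, modulo torsion, shows that `A` is finitely
generated. A finitely generated free cover `Q` of `A` with kernel `X` gives the required complex.
-/

section LinearAlgebra

variable {R M N L : Type*} [Ring R] [AddCommGroup M] [Module R M] [AddCommGroup N] [Module R N]
  [AddCommGroup L] [Module R L]

theorem exists_linearMap_comp_eq_of_ker_le {p : M →ₗ[R] N} (hp : Function.Surjective p)
    {f : M →ₗ[R] L} (h : LinearMap.ker p ≤ LinearMap.ker f) :
    ∃ g : N →ₗ[R] L, ∀ x, g (p x) = f x := by
  refine ⟨(LinearMap.ker p).liftQ f h ∘ₗ (p.quotKerEquivOfSurjective hp).symm.toLinearMap,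
    fun x => ?_⟩
  have hx : (p.quotKerEquivOfSurjective hp).symm (p x) = Submodule.Quotient.mk x := by
    rw [LinearEquiv.symm_apply_eq]; rfl
  simp [hx]

theorem exists_linearMap_comp_eq_of_range_le {i : M →ₗ[R] N} (hi : Function.Injective i)
    {f : L →ₗ[R] N} (h : LinearMap.range f ≤ LinearMap.range i) :
    ∃ g : L →ₗ[R] M, ∀ x, i (g x) = f x :=
  ⟨(LinearEquiv.ofInjective i hi).symm.toLinearMap ∘ₗ f.codRestrict _ fun x => h ⟨x, rfl⟩,
    fun x => congrArg Subtype.val ((LinearEquiv.ofInjective i hi).apply_symm_apply ⟨f x, _⟩)⟩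

theorem exists_projective_lift [Module.Projective R L] {p : M →ₗ[R] N}
    {f : L →ₗ[R] N} (h : LinearMap.range f ≤ LinearMap.range p) :
    ∃ g : L →ₗ[R] M, ∀ x, p (g x) = f x := by
  obtain ⟨g, hg⟩ := Module.projective_lifting_property p.rangeRestrict
    (f.codRestrict (LinearMap.range p) fun x => h ⟨x, rfl⟩) p.surjective_rangeRestrict
  exact ⟨g, fun x => congrArg Subtype.val (LinearMap.congr_fun hg x)⟩

theorem exists_extension_of_projective [Module.Projective R N] {p : M →ₗ[R] N}
    (hp : Function.Surjective p) (f : LinearMap.ker p →ₗ[R] L) :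
    ∃ g : M →ₗ[R] L, ∀ x : LinearMap.ker p, g x = f x := by
  obtain ⟨σ, hσ⟩ := p.exists_rightInverse_of_surjective (LinearMap.range_eq_top.2 hp)
  replace hσ : ∀ y, p (σ y) = y := LinearMap.congr_fun hσ
  exact ⟨f ∘ₗ (LinearMap.id - σ ∘ₗ p).codRestrict (LinearMap.ker p) fun x => by simp [hσ],
    fun x => congrArg f (Subtype.ext (by simp))⟩

theorem exact_mapRange {f : M →ₗ[R] N} {g : N →ₗ[R] L} (h : Function.Exact f g) (I : Type*) :
    Function.Exact (Finsupp.mapRange.linearMap (α := I) f)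
      (Finsupp.mapRange.linearMap (α := I) g) := fun y => by
  change _ ↔ y ∈ Set.range (Finsupp.mapRange f (map_zero f))
  rw [Finsupp.range_mapRange, Finsupp.ext_iff]
  exact forall_congr' fun i => h (y i)

end LinearAlgebra

section ExtOne

variable {R : Type u} [Ring R] {V M K E : Type u} [AddCommGroup V] [Module R V]
  [AddCommGroup M] [Module R M] [AddCommGroup K] [Module R K] [AddCommGroup E] [Module R E]

theorem KerExtOne.exists_extension (h : KerExtOne (ModuleCat.of R V) (ModuleCat.of R M))
    {i : K →ₗ[R] E} {p : E →ₗ[R] V} (hi : Function.Injective i)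
    (hip : Function.Exact i p) (hp : Function.Surjective p) (f : K →ₗ[R] M) :
    ∃ g : E →ₗ[R] M, ∀ x, g (i x) = f x := by
  have hS := ModuleCat.shortComplex_shortExact
    (ModuleCat.shortComplexOfCompEqZero i p hip.linearMap_comp_eq_zero) hip hi hp
  have : Subsingleton (Abelian.Ext (ModuleCat.of R V) (ModuleCat.of R M) 1) := h
  obtain ⟨x, hx⟩ := Abelian.Ext.contravariant_sequence_exact₁ hS _
    (Abelian.Ext.mk₀ (ModuleCat.ofHom f)) (add_zero 1) (Subsingleton.elim _ _)
  obtain ⟨g, rfl⟩ := (Abelian.Ext.mk₀_bijective _ _).2 x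
  rw [Abelian.Ext.mk₀_comp_mk₀] at hx
  exact ⟨g.hom, fun x => ConcreteCategory.congr_hom ((Abelian.Ext.mk₀_bijective _ _).1 hx) x⟩

theorem KerExtOne.exists_lift (h : KerExtOne (ModuleCat.of R V) (ModuleCat.of R M))
    {i : M →ₗ[R] E} {p : E →ₗ[R] K} (hi : Function.Injective i)
    (hip : Function.Exact i p) (hp : Function.Surjective p) (f : V →ₗ[R] K) :
    ∃ g : V →ₗ[R] E, ∀ x, p (g x) = f x := by
  have hS := ModuleCat.shortComplex_shortExact
    (ModuleCat.shortComplexOfCompEqZero i p hip.linearMap_comp_eq_zero) hip hi hp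
  have : Subsingleton (Abelian.Ext (ModuleCat.of R V) (ModuleCat.of R M) 1) := h
  obtain ⟨x, hx⟩ := Abelian.Ext.covariant_sequence_exact₃ (ModuleCat.of R V) hS
    (Abelian.Ext.mk₀ (ModuleCat.ofHom f)) (zero_add 1) (Subsingleton.elim _ _)
  obtain ⟨g, rfl⟩ := (Abelian.Ext.mk₀_bijective _ _).2 x
  rw [Abelian.Ext.mk₀_comp_mk₀] at hx
  exact ⟨g.hom, fun x => ConcreteCategory.congr_hom ((Abelian.Ext.mk₀_bijective _ _).1 hx) x⟩

theorem kerExtOne_of_projective [Module.Projective R E]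
    {i : K →ₗ[R] E} {p : E →ₗ[R] V} (hi : Function.Injective i)
    (hip : Function.Exact i p) (hp : Function.Surjective p)
    (H : ∀ f : K →ₗ[R] M, ∃ g : E →ₗ[R] M, ∀ x, g (i x) = f x) :
    KerExtOne (ModuleCat.of R V) (ModuleCat.of R M) := by
  have hS := ModuleCat.shortComplex_shortExact
    (ModuleCat.shortComplexOfCompEqZero i p hip.linearMap_comp_eq_zero) hip hi hp
  have : Projective (ModuleCat.of R E) := (IsProjective.iff_projective E).1 inferInstance
  refine subsingleton_of_forall_eq 0 fun x => ?_
  obtain ⟨y, rfl⟩ := Abelian.Ext.contravariant_sequence_exact₃ hS _ x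
    (Abelian.Ext.eq_zero_of_projective _) (add_zero 1)
  obtain ⟨f, rfl⟩ := (Abelian.Ext.mk₀_bijective _ _).2 y
  obtain ⟨g, hg⟩ := H f.hom
  have hfg : f = ModuleCat.ofHom i ≫ ModuleCat.ofHom g := by
    ext x
    exact (hg x).symm
  rw [hfg, ← Abelian.Ext.mk₀_comp_mk₀]
  exact hS.extClass_comp_assoc _

theorem kerExtOne_of_injective {i : M →ₗ[R] E} {p : E →ₗ[R] K} [Injective (ModuleCat.of R E)]
    (hi : Function.Injective i) (hip : Function.Exact i p) (hp : Function.Surjective p)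
    (H : ∀ f : V →ₗ[R] K, ∃ g : V →ₗ[R] E, ∀ x, p (g x) = f x) :
    KerExtOne (ModuleCat.of R V) (ModuleCat.of R M) := by
  have hS := ModuleCat.shortComplex_shortExact
    (ModuleCat.shortComplexOfCompEqZero i p hip.linearMap_comp_eq_zero) hip hi hp
  refine subsingleton_of_forall_eq 0 fun x => ?_
  have : Injective (ModuleCat.shortComplexOfCompEqZero i p hip.linearMap_comp_eq_zero).X₂ :=
    inferInstanceAs (Injective (ModuleCat.of R E))
  obtain ⟨y, rfl⟩ := Abelian.Ext.covariant_sequence_exact₁ _ hS x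
    (Abelian.Ext.eq_zero_of_injective _) (zero_add 1)
  obtain ⟨f, rfl⟩ := (Abelian.Ext.mk₀_bijective _ _).2 y
  obtain ⟨g, hg⟩ := H f.hom
  have hfg : f = ModuleCat.ofHom g ≫ ModuleCat.ofHom p := by
    ext x
    exact (hg x).symm
  rw [hfg, ← Abelian.Ext.mk₀_comp_mk₀, Abelian.Ext.comp_assoc_of_second_deg_zero]
  exact (congrArg (fun z => (Abelian.Ext.mk₀ (ModuleCat.ofHom g)).comp z (zero_add 1))
    hS.comp_extClass).trans (Abelian.Ext.comp_zero _ _ _ _ _)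

theorem kerExtOne_of_forall_split
    (H : ∀ (E : Type u) [AddCommGroup E] [Module R E] (i : M →ₗ[R] E) (p : E →ₗ[R] V),
      Function.Injective i → Function.Exact i p → Function.Surjective p →
        ∃ s : V →ₗ[R] E, ∀ v, p (s v) = v) :
    KerExtOne (ModuleCat.of R V) (ModuleCat.of R M) := by
  let J : ModuleCat.{u} R := Injective.under (ModuleCat.of R M)
  let i : M →ₗ[R] J := (Injective.ι (ModuleCat.of R M)).hom
  have hi : Function.Injective i := (ModuleCat.mono_iff_injective _).1 inferInstance
  have : Injective (ModuleCat.of R J) := inferInstanceAs (Injective (Injective.under _))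
  refine kerExtOne_of_injective hi (LinearMap.exact_map_mkQ_range i)
    (Submodule.mkQ_surjective _) fun f => ?_
  let q := (LinearMap.range i).mkQ
  let E := LinearMap.ker (f.coprod (-q))
  have hE : ∀ x : V × J, x ∈ E ↔ f x.1 = q x.2 := fun x => by
    simp [E, ← sub_eq_add_neg, sub_eq_zero]
  obtain ⟨s, hs⟩ := H E ((LinearMap.inr R V J ∘ₗ i).codRestrict E fun m => by
      rw [hE]
      exact (map_zero f).trans
        ((Submodule.Quotient.mk_eq_zero (LinearMap.range i)).2 ⟨m, rfl⟩).symm)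
    (LinearMap.fst R V J ∘ₗ E.subtype)
    (fun m m' h => hi (congrArg (fun x : E => x.1.2) h))
    (fun x => by
      constructor
      · intro hx
        have hx2 : q x.1.2 = 0 := by rw [← (hE _).1 x.2, show x.1.1 = 0 from hx, map_zero]
        obtain ⟨m, hm⟩ := (Submodule.Quotient.mk_eq_zero _).1 hx2
        exact ⟨m, Subtype.ext (Prod.ext (Eq.symm hx) hm)⟩
      · rintro ⟨m, rfl⟩
        rfl)
    fun v => by
      obtain ⟨y, hy⟩ := Submodule.mkQ_surjective _ (f v)
      exact ⟨⟨(v, y), (hE _).2 hy.symm⟩, rfl⟩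
  exact ⟨LinearMap.snd R V J ∘ₗ E.subtype ∘ₗ s, fun v =>
    ((hE _).1 (s v).2).symm.trans (congrArg f (hs v))⟩

end ExtOne

namespace TorsionPair

variable {R : Type u} [Ring R] (t : TorsionPair (ModuleCat.{u} R))

/-- Membership in the torsion class for an unbundled module. -/
def IsT (M : Type u) [AddCommGroup M] [Module R M] : Prop := t.T (ModuleCat.of R M)

/-- Membership in the torsion-free class for an unbundled module. -/
def IsF (M : Type u) [AddCommGroup M] [Module R M] : Prop := t.F (ModuleCat.of R M)

variable {t} {M N L : Type u} [AddCommGroup M] [Module R M] [AddCommGroup N] [Module R N]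
  [AddCommGroup L] [Module R L]

theorem IsT.of_equiv (h : t.IsT M) (e : M ≃ₗ[R] N) : t.IsT N :=
  have := t.T_iso
  t.T.prop_of_iso e.toModuleIso h

theorem IsF.of_equiv (h : t.IsF M) (e : M ≃ₗ[R] N) : t.IsF N :=
  have := t.F_iso
  t.F.prop_of_iso e.toModuleIso h

theorem IsT.hom_eq_zero (h : t.IsT M) (h' : t.IsF N) (f : M →ₗ[R] N) : f = 0 :=
  congrArg ModuleCat.Hom.hom (t.hom_eq_zero _ _ (ModuleCat.ofHom f) h h')

theorem IsT.apply_eq_zero (h : t.IsT M) (h' : t.IsF N) (f : M →ₗ[R] N) (x : M) : f x = 0 := by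
  rw [h.hom_eq_zero h' f, LinearMap.zero_apply]

theorem isT_torsion : t.IsT (t.torsion M) := t.torsion_mem (ModuleCat.of R M)

theorem isF_quotient_torsion : t.IsF (M ⧸ t.torsion M) :=
  t.quotient_torsion_mem (ModuleCat.of R M)

theorem isT_of_torsion_eq_top (h : t.torsion M = ⊤) : t.IsT M :=
  isT_torsion.of_equiv (LinearEquiv.ofTop _ h)

theorem isT_iff : t.IsT M ↔ ∀ (N : Type u) [AddCommGroup N] [Module R N], t.IsF N →
    ∀ f : M →ₗ[R] N, f = 0 := by
  refine ⟨fun h N _ _ hN f => h.hom_eq_zero hN f, fun h => isT_of_torsion_eq_top ?_⟩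
  rw [← Submodule.ker_mkQ (t.torsion M), h _ isF_quotient_torsion (t.torsion M).mkQ,
    LinearMap.ker_zero]

theorem isF_iff : t.IsF M ↔ ∀ (N : Type u) [AddCommGroup N] [Module R N], t.IsT N →
    ∀ f : N →ₗ[R] M, f = 0 := by
  refine ⟨fun h N _ _ hN f => hN.hom_eq_zero h f, fun h => ?_⟩
  have : t.torsion M = ⊥ := by
    rw [← Submodule.range_subtype (t.torsion M), h _ isT_torsion (t.torsion M).subtype,
      LinearMap.range_zero]
  exact isF_quotient_torsion.of_equiv (Submodule.quotEquivOfEqBot _ this)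

theorem isT_of_iSup_range_eq_top {ι : Sort*} {X : ι → Type u} [∀ i, AddCommGroup (X i)]
    [∀ i, Module R (X i)] (hX : ∀ i, t.IsT (X i)) (f : ∀ i, X i →ₗ[R] M)
    (hf : ⨆ i, LinearMap.range (f i) = ⊤) : t.IsT M := by
  rw [isT_iff]
  intro K _ _ hK g
  rw [← LinearMap.ker_eq_top, eq_top_iff, ← hf, iSup_le_iff]
  rintro i _ ⟨x, rfl⟩
  exact (hX i).apply_eq_zero hK (g ∘ₗ f i) x

theorem isF_of_forall_apply_eq_zero {ι : Sort*} {X : ι → Type u} [∀ i, AddCommGroup (X i)]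
    [∀ i, Module R (X i)] (hX : ∀ i, t.IsF (X i)) (f : ∀ i, M →ₗ[R] X i)
    (hf : ∀ x, (∀ i, f i x = 0) → x = 0) : t.IsF M := by
  rw [isF_iff]
  intro K _ _ hK g
  ext y
  exact hf _ fun i => hK.apply_eq_zero (hX i) (f i ∘ₗ g) y

theorem IsT.of_surjective (h : t.IsT M) (f : M →ₗ[R] N) (hf : Function.Surjective f) :
    t.IsT N :=
  isT_of_iSup_range_eq_top (ι := Unit) (fun _ => h) (fun _ => f)
    (by simpa using LinearMap.range_eq_top.2 hf)

theorem IsF.of_injective (h : t.IsF N) (f : M →ₗ[R] N) (hf : Function.Injective f) :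
    t.IsF M :=
  isF_of_forall_apply_eq_zero (ι := Unit) (fun _ => h) (fun _ => f)
    fun _ hx => (map_eq_zero_iff f hf).1 (hx ())

theorem IsT.of_exact (hM : t.IsT M) (hL : t.IsT L) (f : M →ₗ[R] N) (g : N →ₗ[R] L)
    (hfg : Function.Exact f g) (hg : Function.Surjective g) : t.IsT N := by
  rw [isT_iff]
  intro K _ _ hK h
  have hker : LinearMap.ker g ≤ LinearMap.ker h := fun x hx => by
    obtain ⟨y, rfl⟩ := (hfg x).1 hx
    exact hM.apply_eq_zero hK (h ∘ₗ f) y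
  obtain ⟨k, hk⟩ := exists_linearMap_comp_eq_of_ker_le hg hker
  ext x
  rw [← hk, hL.apply_eq_zero hK k, LinearMap.zero_apply]

theorem IsF.of_exact (hM : t.IsF M) (hL : t.IsF L) (f : M →ₗ[R] N) (g : N →ₗ[R] L)
    (hf : Function.Injective f) (hfg : Function.Exact f g) : t.IsF N := by
  rw [isF_iff]
  intro K _ _ hK h
  have hr : LinearMap.range h ≤ LinearMap.range f := by
    rintro _ ⟨x, rfl⟩
    exact (hfg _).1 (hK.apply_eq_zero hL (g ∘ₗ h) x)
  obtain ⟨k, hk⟩ := exists_linearMap_comp_eq_of_range_le hf hr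
  ext x
  rw [← hk, hK.apply_eq_zero hM k, map_zero, LinearMap.zero_apply]

theorem IsF.of_ker_eq (hL : t.IsF L) {p : N →ₗ[R] M} (hp : Function.Surjective p)
    (q : N →ₗ[R] L) (h : LinearMap.ker p = LinearMap.ker q) : t.IsF M := by
  obtain ⟨g, hg⟩ := exists_linearMap_comp_eq_of_ker_le hp h.le
  refine hL.of_injective g ((injective_iff_map_eq_zero g).2 fun y hy => ?_)
  obtain ⟨x, rfl⟩ := hp y
  rw [hg] at hy
  exact h.ge hy

theorem isT_of_subsingleton [Subsingleton M] : t.IsT M :=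
  isT_iff.2 fun N _ _ _ f => by ext x; rw [Subsingleton.elim x 0, map_zero, map_zero]

theorem isF_of_subsingleton [Subsingleton M] : t.IsF M :=
  isF_iff.2 fun N _ _ _ f => by ext x; exact Subsingleton.elim _ _

theorem IsT.finsupp (h : t.IsT M) (I : Type u) : t.IsT (I →₀ M) :=
  isT_of_iSup_range_eq_top (fun _ : I => h) (fun i => Finsupp.lsingle i)
    Finsupp.iSup_lsingle_range

theorem IsT.directSum {I : Type u} {M : I → Type u} [∀ i, AddCommGroup (M i)]
    [∀ i, Module R (M i)] (h : ∀ i, t.IsT (M i)) : t.IsT (DirectSum I M) := by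
  classical
  exact isT_of_iSup_range_eq_top h (DirectSum.lof R I M) DFinsupp.iSup_range_lsingle

theorem IsF.directSum {I : Type u} {M : I → Type u} [∀ i, AddCommGroup (M i)]
    [∀ i, Module R (M i)] (h : ∀ i, t.IsF (M i)) : t.IsF (DirectSum I M) :=
  isF_of_forall_apply_eq_zero h (DirectSum.component R I M) fun _ hx => DFinsupp.ext hx

theorem map_mem_torsion (f : M →ₗ[R] N) {x : M} (hx : x ∈ t.torsion M) : f x ∈ t.torsion N := by
  rw [← Submodule.Quotient.mk_eq_zero]
  exact isT_torsion.apply_eq_zero isF_quotient_torsion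
    ((t.torsion N).mkQ ∘ₗ f ∘ₗ (t.torsion M).subtype) ⟨x, hx⟩

/-- A map with torsion cokernel is left orthogonal to a map with torsion-free kernel. This is the
uniqueness of diagonal fillers. -/
theorem apply_eq_zero_of_isT_coker_of_isF_ker {K : Type u} [AddCommGroup K] [Module R K]
    {g : K →ₗ[R] M} (hg : t.IsT (M ⧸ LinearMap.range g)) {d : N →ₗ[R] L}
    (hd : t.IsF (LinearMap.ker d)) {f : M →ₗ[R] N} (hfg : ∀ x, f (g x) = 0)
    (hdf : ∀ y, d (f y) = 0) (y : M) : f y = 0 := by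
  have h : LinearMap.range g ≤ LinearMap.ker (f.codRestrict (LinearMap.ker d) hdf) := by
    rintro _ ⟨x, rfl⟩
    exact Subtype.ext (hfg x)
  exact congrArg Subtype.val
    (hg.apply_eq_zero hd ((LinearMap.range g).liftQ _ h) (Submodule.Quotient.mk y))

end TorsionPair

namespace TorsionPair

variable {R : Type u} [Ring R] (t : TorsionPair (ModuleCat.{u} R))

/-- A complex `A → P` with `P` projective in degree `0`, with torsion-free kernel and torsion
cokernel. These complexes, with chain maps up to homotopy, form a model of the heart. -/
structure TwoTerm where
  /-- the term in degree `-1` -/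
  A : Type u
  /-- the term in degree `0` -/
  P : Type u
  [addCommGroupA : AddCommGroup A]
  [addCommGroupP : AddCommGroup P]
  [moduleA : Module R A]
  [moduleP : Module R P]
  /-- the differential -/
  d : A →ₗ[R] P
  [projective : Module.Projective R P]
  isF : t.IsF (LinearMap.ker d)
  isT : t.IsT (P ⧸ LinearMap.range d)

namespace TwoTerm

attribute [instance] addCommGroupA addCommGroupP moduleA moduleP projective

variable {t}

/-- The group of chain maps. -/
def chain (M N : t.TwoTerm) : AddSubgroup ((M.A →ₗ[R] N.A) × (M.P →ₗ[R] N.P)) where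
  carrier := {f | N.d ∘ₗ f.1 = f.2 ∘ₗ M.d}
  add_mem' hf hg := by
    simp only [Set.mem_ofPred_eq] at hf hg ⊢
    simp [LinearMap.comp_add, LinearMap.add_comp, hf, hg]
  zero_mem' := by simp
  neg_mem' hf := by
    simp only [Set.mem_ofPred_eq] at hf ⊢
    simp [LinearMap.comp_neg, LinearMap.neg_comp, hf]

theorem chain_comm {M N : t.TwoTerm} (f : chain M N) (a : M.A) :
    N.d (f.1.1 a) = f.1.2 (M.d a) := LinearMap.congr_fun f.2 a

/-- The null-homotopic chain map attached to a homotopy. -/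
def null (M N : t.TwoTerm) : (M.P →ₗ[R] N.A) →+ chain M N where
  toFun k := ⟨(k ∘ₗ M.d, N.d ∘ₗ k), (LinearMap.comp_assoc _ _ _).symm⟩
  map_zero' := by ext <;> simp
  map_add' k l := by ext <;> simp

/-- Composition of chain maps. -/
def chainComp {M N L : t.TwoTerm} (f : chain M N) (g : chain N L) : chain M L :=
  ⟨(g.1.1 ∘ₗ f.1.1, g.1.2 ∘ₗ f.1.2), LinearMap.ext fun a => by simp [chain_comm]⟩

section Ideal

variable {M N L : t.TwoTerm}

theorem chainComp_add (f : chain M N) (g g' : chain N L) :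
    chainComp f (g + g') = chainComp f g + chainComp f g' := rfl

theorem add_chainComp (f f' : chain M N) (g : chain N L) :
    chainComp (f + f') g = chainComp f g + chainComp f' g :=
  Subtype.ext (Prod.ext (LinearMap.comp_add _ _ _) (LinearMap.comp_add _ _ _))

theorem null_chainComp (k : M.P →ₗ[R] N.A) (g : chain N L) :
    chainComp (null M N k) g = null M L (g.1.1 ∘ₗ k) :=
  Subtype.ext (Prod.ext rfl (LinearMap.ext fun p => (chain_comm g (k p)).symm))

theorem chainComp_null (f : chain M N) (l : N.P →ₗ[R] L.A) :
    chainComp f (null N L l) = null M L (l ∘ₗ f.1.2) :=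
  Subtype.ext (Prod.ext (LinearMap.ext fun a => congrArg l (chain_comm f a)) rfl)

theorem neg_chainComp_add_mem_null_range {f f' : chain M N} {g g' : chain N L}
    (hf : -f + f' ∈ (null M N).range) (hg : -g + g' ∈ (null N L).range) :
    -chainComp f g + chainComp f' g' ∈ (null M L).range := by
  obtain ⟨k, hk⟩ := hf
  obtain ⟨l, hl⟩ := hg
  obtain rfl : f' = f + null M N k := by rw [hk, add_neg_cancel_left]
  obtain rfl : g' = g + null N L l := by rw [hl, add_neg_cancel_left]
  rw [chainComp_add, add_chainComp, null_chainComp, chainComp_null, add_assoc,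
    neg_add_cancel_left, ← map_add]
  exact ⟨_, rfl⟩

end Ideal

/-- Homotopy classes of chain maps. -/
def HomClass (M N : t.TwoTerm) : Type u := chain M N ⧸ (null M N).range

instance (M N : t.TwoTerm) : AddCommGroup (HomClass M N) :=
  inferInstanceAs (AddCommGroup (chain M N ⧸ (null M N).range))

instance : Category.{u} t.TwoTerm where
  Hom := HomClass
  id M := QuotientAddGroup.mk (s := (null M M).range) ⟨(LinearMap.id, LinearMap.id), rfl⟩
  comp {M N L} f g := Quotient.map₂ (sc := QuotientAddGroup.leftRel (null M L).range) chainComp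
    (fun _ _ hf _ _ hg => QuotientAddGroup.leftRel_apply.2 (neg_chainComp_add_mem_null_range
      (QuotientAddGroup.leftRel_apply.1 hf) (QuotientAddGroup.leftRel_apply.1 hg))) f g
  id_comp := by rintro M N ⟨f⟩; rfl
  comp_id := by rintro M N ⟨f⟩; rfl
  assoc := by rintro M N L K ⟨f⟩ ⟨g⟩ ⟨h⟩; rfl

instance (M N : t.TwoTerm) : AddCommGroup (M ⟶ N) := inferInstanceAs (AddCommGroup (HomClass M N))

/-- The morphism represented by a chain map. -/
def homMk {M N : t.TwoTerm} (f₁ : M.A →ₗ[R] N.A) (f₀ : M.P →ₗ[R] N.P)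
    (h : ∀ a, N.d (f₁ a) = f₀ (M.d a)) : M ⟶ N :=
  QuotientAddGroup.mk (s := (null M N).range) ⟨(f₁, f₀), LinearMap.ext h⟩

theorem exists_homMk {M N : t.TwoTerm} (f : M ⟶ N) : ∃ (f₁ : M.A →ₗ[R] N.A)
    (f₀ : M.P →ₗ[R] N.P) (h : ∀ a, N.d (f₁ a) = f₀ (M.d a)), f = homMk f₁ f₀ h := by
  obtain ⟨f, rfl⟩ := QuotientAddGroup.mk_surjective f
  exact ⟨f.1.1, f.1.2, chain_comm f, rfl⟩

theorem id_eq_homMk (M : t.TwoTerm) : 𝟙 M = homMk LinearMap.id LinearMap.id (fun _ => rfl) := rfl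

section HomMk

variable {M N L : t.TwoTerm} {f₁ f₁' : M.A →ₗ[R] N.A} {f₀ f₀' : M.P →ₗ[R] N.P}
  {g₁ : N.A →ₗ[R] L.A} {g₀ : N.P →ₗ[R] L.P}

theorem homMk_add_homMk (hf : ∀ a, N.d (f₁ a) = f₀ (M.d a))
    (hf' : ∀ a, N.d (f₁' a) = f₀' (M.d a)) :
    homMk f₁ f₀ hf + homMk f₁' f₀' hf' =
      homMk (f₁ + f₁') (f₀ + f₀') (fun a => by simp [hf, hf']) := rfl

theorem homMk_sub_homMk (hf : ∀ a, N.d (f₁ a) = f₀ (M.d a))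
    (hf' : ∀ a, N.d (f₁' a) = f₀' (M.d a)) :
    homMk f₁ f₀ hf - homMk f₁' f₀' hf' =
      homMk (f₁ - f₁') (f₀ - f₀') (fun a => by simp [hf, hf']) := rfl

theorem homMk_eq_zero_iff (hf : ∀ a, N.d (f₁ a) = f₀ (M.d a)) :
    homMk f₁ f₀ hf = 0 ↔
      ∃ k : M.P →ₗ[R] N.A, (∀ a, f₁ a = k (M.d a)) ∧ ∀ p, f₀ p = N.d (k p) := by
  refine (QuotientAddGroup.eq_zero_iff _).trans (exists_congr fun k => ?_)
  rw [Subtype.ext_iff, Prod.ext_iff, LinearMap.ext_iff, LinearMap.ext_iff]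
  exact and_congr (forall_congr' fun _ => eq_comm) (forall_congr' fun _ => eq_comm)

theorem homMk_eq_homMk_iff (hf : ∀ a, N.d (f₁ a) = f₀ (M.d a))
    (hf' : ∀ a, N.d (f₁' a) = f₀' (M.d a)) :
    homMk f₁ f₀ hf = homMk f₁' f₀' hf' ↔
      ∃ k : M.P →ₗ[R] N.A, (∀ a, f₁ a = f₁' a + k (M.d a)) ∧ ∀ p, f₀ p = f₀' p + N.d (k p) := by
  rw [← sub_eq_zero, homMk_sub_homMk, homMk_eq_zero_iff]
  simp [sub_eq_iff_eq_add']

theorem homMk_comp_eq_zero_iff {hf : ∀ a, N.d (f₁ a) = f₀ (M.d a)}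
    {hg : ∀ a, L.d (g₁ a) = g₀ (N.d a)} :
    homMk f₁ f₀ hf ≫ homMk g₁ g₀ hg = 0 ↔ ∃ k : M.P →ₗ[R] L.A,
      (∀ a, g₁ (f₁ a) = k (M.d a)) ∧ ∀ p, g₀ (f₀ p) = L.d (k p) :=
  homMk_eq_zero_iff (f₁ := g₁ ∘ₗ f₁) (f₀ := g₀ ∘ₗ f₀) fun a => by simp [hf, hg]

theorem homMk_comp_eq_homMk_iff {h₁ : M.A →ₗ[R] L.A} {h₀ : M.P →ₗ[R] L.P}
    {hf : ∀ a, N.d (f₁ a) = f₀ (M.d a)} {hg : ∀ a, L.d (g₁ a) = g₀ (N.d a)}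
    {hh : ∀ a, L.d (h₁ a) = h₀ (M.d a)} :
    homMk f₁ f₀ hf ≫ homMk g₁ g₀ hg = homMk h₁ h₀ hh ↔ ∃ k : M.P →ₗ[R] L.A,
      (∀ a, g₁ (f₁ a) = h₁ a + k (M.d a)) ∧ ∀ p, g₀ (f₀ p) = h₀ p + L.d (k p) :=
  homMk_eq_homMk_iff (f₁ := g₁ ∘ₗ f₁) (f₀ := g₀ ∘ₗ f₀) (fun a => by simp [hf, hg]) hh

end HomMk

instance : Preadditive t.TwoTerm where
  add_comp := by
    rintro M N L ⟨f⟩ ⟨f'⟩ ⟨g⟩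
    exact congrArg (QuotientAddGroup.mk (s := (null M L).range)) (add_chainComp f f' g)
  comp_add := by rintro M N L ⟨f⟩ ⟨g⟩ ⟨g'⟩; rfl

/-! ### Powers -/

/-- The coproduct `M^(I)` of copies of `M`. -/
noncomputable abbrev pow (M : t.TwoTerm) (I : Type u) : t.TwoTerm where
  A := I →₀ M.A
  P := I →₀ M.P
  d := Finsupp.mapRange.linearMap M.d
  projective := by
    classical
    exact Module.Projective.of_equiv (finsuppLequivDFinsupp R (M := M.P) (ι := I)).symm
  isF := by
    refine isF_of_forall_apply_eq_zero (fun _ : I => M.isF)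
      (fun i => (Finsupp.lapply i).restrict fun x hx => ?_)
      fun x hx => Subtype.ext (Finsupp.ext fun i => congrArg Subtype.val (hx i))
    exact DFunLike.congr_fun (LinearMap.mem_ker.1 hx) i
  isT := by
    have hd : LinearMap.range (Finsupp.mapRange.linearMap (α := I) M.d) =
        LinearMap.ker (Finsupp.mapRange.linearMap (α := I) (LinearMap.range M.d).mkQ) :=
      (exact_mapRange (LinearMap.exact_map_mkQ_range M.d) I).linearMap_ker_eq.symm
    rw [hd]
    refine (M.isT.finsupp I).of_equiv (LinearMap.quotKerEquivOfSurjective _ ?_).symm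
    exact Finsupp.mapRange_surjective _ (map_zero _) (Submodule.mkQ_surjective _)

/-- The coprojections of a power. -/
noncomputable def ι (M : t.TwoTerm) {I : Type u} (i : I) : M ⟶ M.pow I :=
  homMk (N := M.pow I) (Finsupp.lsingle i) (Finsupp.lsingle i)
    fun _ => Finsupp.mapRange_single (hf := map_zero M.d)

theorem pow_hom_ext {M N : t.TwoTerm} {I : Type u} {f g : M.pow I ⟶ N}
    (h : ∀ i, M.ι i ≫ f = M.ι i ≫ g) : f = g := by
  rw [← sub_eq_zero]
  replace h : ∀ i, M.ι i ≫ (f - g) = 0 := fun i => by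
    rw [Preadditive.comp_sub, h, sub_self]
  obtain ⟨f₁, f₀, hf, hfg⟩ := exists_homMk (f - g)
  rw [hfg] at h ⊢
  choose k hk₁ hk₀ using fun i => homMk_comp_eq_zero_iff.1 (h i)
  have h₁ : f₁ = Finsupp.lsum ℕ k ∘ₗ (M.pow I).d :=
    Finsupp.lhom_ext fun i a => by simpa [pow] using hk₁ i a
  have h₀ : f₀ = N.d ∘ₗ Finsupp.lsum ℕ k :=
    Finsupp.lhom_ext fun i p => by simpa using hk₀ i p
  exact (homMk_eq_zero_iff _).2 ⟨Finsupp.lsum ℕ k, LinearMap.congr_fun h₁, LinearMap.congr_fun h₀⟩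

theorem exists_pow_desc {M N : t.TwoTerm} {I : Type u} (f : I → (M ⟶ N)) :
    ∃ g : M.pow I ⟶ N, ∀ i, M.ι i ≫ g = f i := by
  choose f₁ f₀ hf hff using fun i => exists_homMk (f i)
  have hd : N.d ∘ₗ Finsupp.lsum ℕ f₁ = Finsupp.lsum ℕ f₀ ∘ₗ (M.pow I).d :=
    Finsupp.lhom_ext fun i a => by simp [hf]
  refine ⟨homMk (M := M.pow I) (Finsupp.lsum ℕ f₁) (Finsupp.lsum ℕ f₀) (LinearMap.congr_fun hd),
    fun i => ?_⟩
  rw [hff]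
  exact homMk_comp_eq_homMk_iff.2 ⟨0, by simp, by simp⟩

end TwoTerm

end TorsionPair

namespace TorsionPair

variable {R : Type u} [Ring R] {t : TorsionPair (ModuleCat.{u} R)}

namespace TwoTerm

/-! ### The cone and the cokernel of a chain map -/

section Cone

variable {M N : t.TwoTerm} (f₁ : M.A →ₗ[R] N.A) (f₀ : M.P →ₗ[R] N.P)

/-- The differential `N.A × M.P → N.P` of the cone ending in degree `0`. -/
def coneD (N : t.TwoTerm) (f₀ : M.P →ₗ[R] N.P) : N.A × M.P →ₗ[R] N.P :=
  N.d.coprod (-f₀)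

theorem coneD_apply (x : N.A × M.P) : coneD N f₀ x = N.d x.1 - f₀ x.2 := by
  simp [coneD, sub_eq_add_neg]

variable {f₁ f₀} (hf : ∀ a, N.d (f₁ a) = f₀ (M.d a))

/-- The differential of the cone from degree `-2`, with values in the cycles. -/
def toConeZ : M.A →ₗ[R] LinearMap.ker (coneD N f₀) :=
  (f₁.prod M.d).codRestrict _ fun a => by simp [coneD_apply, hf]

@[simp]
theorem toConeZ_coe (a : M.A) : (toConeZ hf a : N.A × M.P) = (f₁ a, M.d a) := rfl

/-- The homology of the cone in degree `-1`. -/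
abbrev coneH : Type u := LinearMap.ker (coneD N f₀) ⧸ LinearMap.range (toConeZ hf)

/-- The submodule of cycles of the cone whose homology class is torsion. -/
def torsionCycles : Submodule R (N.A × M.P) :=
  ((t.torsion (coneH hf)).comap (Submodule.mkQ _)).map (Submodule.subtype _)

theorem mem_torsionCycles {x : N.A × M.P} : x ∈ torsionCycles hf ↔
    ∃ h : x ∈ LinearMap.ker (coneD N f₀), (Submodule.Quotient.mk ⟨x, h⟩ : coneH hf) ∈
      t.torsion (coneH hf) := by
  simp [torsionCycles]

theorem torsionCycles_le : torsionCycles hf ≤ LinearMap.ker (coneD N f₀) := fun _ hx =>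
  ((mem_torsionCycles hf).1 hx).1

theorem toConeZ_mem_torsionCycles (a : M.A) : (f₁ a, M.d a) ∈ torsionCycles hf := by
  refine (mem_torsionCycles hf).2 ⟨(toConeZ hf a).2, ?_⟩
  have h0 : (Submodule.Quotient.mk (toConeZ hf a) : coneH hf) = 0 :=
    (Submodule.Quotient.mk_eq_zero _).2 ⟨a, rfl⟩
  exact h0 ▸ zero_mem _

/-- The cokernel of a chain map in the heart: the cone, truncated by killing the torsion part of its
homology in degree `-1`. -/
abbrev coker : t.TwoTerm where
  A := (N.A × M.P) ⧸ torsionCycles hf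
  P := N.P
  d := (torsionCycles hf).liftQ (coneD N f₀) (torsionCycles_le hf)
  isF := by
    let p : LinearMap.ker (coneD N f₀) →ₗ[R]
        LinearMap.ker ((torsionCycles hf).liftQ (coneD N f₀) (torsionCycles_le hf)) :=
      (torsionCycles hf).mkQ.restrict fun _ hx => hx
    have hp : Function.Surjective p := by
      rintro ⟨x, hx⟩
      obtain ⟨x, rfl⟩ := Submodule.mkQ_surjective _ x
      exact ⟨⟨x, hx⟩, rfl⟩
    refine isF_quotient_torsion.of_ker_eq hp ((t.torsion (coneH hf)).mkQ ∘ₗ Submodule.mkQ _) ?_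
    ext z
    have hz : z ∈ LinearMap.ker p ↔ (z : N.A × M.P) ∈ torsionCycles hf :=
      Subtype.ext_iff.trans (Submodule.Quotient.mk_eq_zero _)
    rw [hz, mem_torsionCycles]
    exact (exists_prop_of_true z.2).trans (Submodule.Quotient.mk_eq_zero _).symm
  isT := by
    refine N.isT.of_surjective (Submodule.factor ?_) (Submodule.factor_surjective _)
    rintro _ ⟨b, rfl⟩
    exact ⟨Submodule.Quotient.mk (b, 0), by simp [coneD_apply]⟩

theorem coker_d_mkQ (x : N.A × M.P) :
    (coker hf).d ((torsionCycles hf).mkQ x) = coneD N f₀ x := rfl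

/-- The component `N.A → (coker hf).A` of the projection to the cokernel. -/
def cokerInl : N.A →ₗ[R] (coker hf).A := (torsionCycles hf).mkQ ∘ₗ LinearMap.inl R _ _

/-- The component `M.P → (coker hf).A` of the quotient map from the cone. Its negative is a
null-homotopy of the composite of a chain map with the projection to its cokernel. -/
def cokerInr : M.P →ₗ[R] (coker hf).A := (torsionCycles hf).mkQ ∘ₗ LinearMap.inr R _ _

theorem coker_d_cokerInl (a : N.A) : (coker hf).d (cokerInl hf a) = N.d a :=
  (coker_d_mkQ hf (a, 0)).trans (by simp [coneD_apply])

theorem coker_d_cokerInr (p : M.P) : (coker hf).d (cokerInr hf p) = -f₀ p :=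
  (coker_d_mkQ hf (0, p)).trans (by simp [coneD_apply])

theorem cokerInl_add_cokerInr (x : N.A × M.P) :
    cokerInl hf x.1 + cokerInr hf x.2 = (torsionCycles hf).mkQ x := by
  change (torsionCycles hf).mkQ (x.1, 0) + (torsionCycles hf).mkQ (0, x.2) = _
  rw [← map_add, Prod.mk_add_mk, add_zero, zero_add]

theorem cokerInl_add_cokerInr_eq_zero_iff {x : N.A × M.P} :
    cokerInl hf x.1 + cokerInr hf x.2 = 0 ↔ x ∈ torsionCycles hf := by
  rw [cokerInl_add_cokerInr]
  exact Submodule.Quotient.mk_eq_zero _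

theorem cokerInl_apply_add_cokerInr_d (a : M.A) :
    cokerInl hf (f₁ a) + cokerInr hf (M.d a) = 0 :=
  (cokerInl_add_cokerInr_eq_zero_iff hf).2 (toConeZ_mem_torsionCycles hf a)

/-- The projection to the cokernel. -/
def toCoker : N ⟶ coker hf :=
  homMk (N := coker hf) (cokerInl hf) LinearMap.id (coker_d_cokerInl hf)

theorem homMk_comp_toCoker : homMk f₁ f₀ hf ≫ toCoker hf = 0 :=
  homMk_comp_eq_zero_iff.2 ⟨-cokerInr hf,
    fun a => eq_neg_of_add_eq_zero_left (cokerInl_apply_add_cokerInr_d hf a),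
    fun p => by
      rw [LinearMap.neg_apply]
      exact (neg_eq_iff_eq_neg.2 (coker_d_cokerInr hf p)).symm.trans (map_neg _ _).symm⟩

/-- The condition on the cone of a chain map which characterizes epimorphisms of the heart. -/
structure IsConeEpi : Prop where
  surjective : Function.Surjective (coneD N f₀)
  isT : t.IsT (coneH hf)

variable {hf}

theorem IsConeEpi.epi (h : IsConeEpi hf) : Epi (homMk f₁ f₀ hf) := by
  refine Preadditive.epi_of_cancel_zero _ fun {L} u hu => ?_
  obtain ⟨u₁, u₀, hu', rfl⟩ := exists_homMk u
  obtain ⟨w, hw₁, hw₀⟩ := homMk_comp_eq_zero_iff.1 hu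
  let v : N.A × M.P →ₗ[R] L.A := u₁.coprod (-w)
  have hv : ∀ x, L.d (v x) = u₀ (coneD N f₀ x) := fun x => by
    simp [v, coneD_apply, hu', hw₀, sub_eq_add_neg]
  have hv_cycles : LinearMap.ker (coneD N f₀) ≤ LinearMap.ker v := fun x hx =>
    apply_eq_zero_of_isT_coker_of_isF_ker h.isT L.isF
      (f := v ∘ₗ (LinearMap.ker (coneD N f₀)).subtype) (fun a => by simp [v, hw₁])
      (fun y => (hv y).trans (by rw [LinearMap.mem_ker.1 y.2, map_zero])) ⟨x, hx⟩
  obtain ⟨k, hk⟩ := exists_linearMap_comp_eq_of_ker_le h.surjective hv_cycles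
  refine (homMk_eq_zero_iff _).2 ⟨k, fun b => ?_, fun p => ?_⟩
  · simpa [coneD_apply, v] using (hk (b, 0)).symm
  · obtain ⟨x, rfl⟩ := h.surjective p
    rw [hk, hv]

theorem isConeEpi_of_toCoker_eq_zero (h : toCoker hf = 0) : IsConeEpi hf := by
  obtain ⟨k, hk₁, hk₀⟩ := (homMk_eq_zero_iff _).1 h
  have hinr : ∀ p, cokerInr hf p = -k (f₀ p) := fun p => by
    rw [← add_eq_zero_iff_eq_neg]
    refine apply_eq_zero_of_isT_coker_of_isF_ker M.isT (coker hf).isF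
      (f := cokerInr hf + k ∘ₗ f₀) (fun a => ?_) (fun p => ?_) p
    · rw [LinearMap.add_apply, LinearMap.comp_apply, ← hf, ← hk₁, add_comm]
      exact cokerInl_apply_add_cokerInr_d hf a
    · exact (map_add (coker hf).d _ _).trans (by
        rw [coker_d_cokerInr, LinearMap.comp_apply, ← hk₀, LinearMap.id_apply, neg_add_cancel])
  have hmk : ∀ x, (torsionCycles hf).mkQ x = k (coneD N f₀ x) := fun x => by
    rw [← cokerInl_add_cokerInr, hk₁, hinr, coneD_apply, map_sub, sub_eq_add_neg]
  refine ⟨fun p => ?_, isT_of_torsion_eq_top (eq_top_iff.2 fun z _ => ?_)⟩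
  · obtain ⟨x, hx⟩ := Submodule.mkQ_surjective (torsionCycles hf) (k p)
    exact ⟨x, (congrArg (coker hf).d hx).trans (hk₀ p).symm⟩
  · obtain ⟨⟨x, hx⟩, rfl⟩ := Submodule.mkQ_surjective _ z
    have hx0 : (torsionCycles hf).mkQ x = 0 := by rw [hmk, LinearMap.mem_ker.1 hx, map_zero]
    exact ((mem_torsionCycles hf).1 ((Submodule.Quotient.mk_eq_zero _).1 hx0)).2

theorem isConeEpi_of_epi [Epi (homMk f₁ f₀ hf)] : IsConeEpi hf :=
  isConeEpi_of_toCoker_eq_zero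
    ((cancel_epi (homMk f₁ f₀ hf)).1 ((homMk_comp_toCoker hf).trans Limits.comp_zero.symm))

end Cone

end TwoTerm

end TorsionPair

/-! ### Two-term complexes in the derived category -/

section Elementwise

variable {R : Type u} [Ring R] {K L : CochainComplex (ModuleCat.{u} R) ℤ} (φ : K ⟶ L)

theorem exists_d_eq_of_mono_homologyMap (i j k : ℤ) (hij : i + 1 = j) (hjk : j + 1 = k)
    [Mono (HomologicalComplex.homologyMap φ j)] (x : K.X j) (hx : (K.d j k).hom x = 0)
    (y : L.X i) (h : (φ.f j).hom x = (L.d i j).hom y) : ∃ z : K.X i, (K.d i j).hom z = x := by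
  obtain ⟨A, π, hπ, z, hz⟩ := (HomologicalComplex.mono_homologyMap_iff_up_to_refinements φ i j k
    (by simp [← hij]) (by simp [← hjk])).1 inferInstance
    (ModuleCat.ofHom (LinearMap.toSpanSingleton R (K.X j) x))
    (by ext; simp [hx]) (ModuleCat.ofHom (LinearMap.toSpanSingleton R (L.X i) y))
    (by ext; simp [h])
  obtain ⟨a, ha⟩ := (ModuleCat.epi_iff_surjective π).1 hπ (1 : R)
  refine ⟨z.hom a, ?_⟩
  have := congrArg (fun f => f.hom a) hz
  simpa [ha] using this.symm

theorem exists_eq_add_d_of_epi_homologyMap (i j k : ℤ) (hij : i + 1 = j) (hjk : j + 1 = k)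
    [Epi (HomologicalComplex.homologyMap φ j)] (y : L.X j) (hy : (L.d j k).hom y = 0) :
    ∃ (x : K.X j) (z : L.X i), (K.d j k).hom x = 0 ∧
      y = (φ.f j).hom x + (L.d i j).hom z := by
  obtain ⟨A, π, hπ, x, hx, z, hz⟩ :=
    (HomologicalComplex.epi_homologyMap_iff_up_to_refinements φ i j k
    (by simp [← hij]) (by simp [← hjk])).1 inferInstance
    (ModuleCat.ofHom (LinearMap.toSpanSingleton R (L.X j) y)) (by ext; simp [hy])
  obtain ⟨a, ha⟩ := (ModuleCat.epi_iff_surjective π).1 hπ (1 : R)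
  refine ⟨x.hom a, z.hom a, ?_, ?_⟩
  · exact congrArg (fun f => f.hom a) hx
  · have := congrArg (fun f => f.hom a) hz
    simpa [ha] using this

end Elementwise

section TwoTermComplex

open Limits CochainComplex HomologicalComplex

variable {C : Type*} [Category* C] [Abelian C]

/-- The complex `A → B` with `B` in degree `0`. -/
noncomputable abbrev twoTermComplex {A B : C} (f : A ⟶ B) : CochainComplex C ℤ :=
  double f (c := ComplexShape.up ℤ) (i₀ := -1) (i₁ := 0) (by simp)

namespace twoTermComplex

section

variable {A B : C} (f : A ⟶ B)

/-- The term of `twoTermComplex f` in degree `-1`. -/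
noncomputable abbrev xNegOneIso : (twoTermComplex f).X (-1) ≅ A := doubleXIso₀ f _

/-- The term of `twoTermComplex f` in degree `0`. -/
noncomputable abbrev xZeroIso : (twoTermComplex f).X 0 ≅ B := doubleXIso₁ f _ (by simp)

theorem d_eq : (twoTermComplex f).d (-1) 0 = (xNegOneIso f).hom ≫ f ≫ (xZeroIso f).inv :=
  double_d f _ (by simp)

instance : (twoTermComplex f).IsStrictlyGE (-1) := by
  rw [isStrictlyGE_iff]
  intro i hi
  exact isZero_double_X f _ i (by lia) (by lia)

instance : (twoTermComplex f).IsStrictlyLE 0 := by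
  rw [isStrictlyLE_iff]
  intro i hi
  exact isZero_double_X f _ i (by lia) (by lia)

variable {f} {K : CochainComplex C ℤ} (φ₁ : A ⟶ K.X (-1)) (φ₀ : B ⟶ K.X 0)
  (comm : φ₁ ≫ K.d (-1) 0 = f ≫ φ₀) (hφ : φ₀ ≫ K.d 0 1 = 0)

/-- The morphism from a two-term complex given by its two components. -/
noncomputable def desc : twoTermComplex f ⟶ K :=
  mkHomFromDouble _ (by simp) φ₁ φ₀ comm (by
    intro k hk
    obtain rfl : k = 1 := by simpa using hk.symm
    exact hφ)

@[simp]
theorem desc_f_negOne :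
    (desc φ₁ φ₀ comm hφ).f (-1) = (xNegOneIso f).hom ≫ φ₁ :=
  mkHomFromDouble_f₀ ..

@[simp]
theorem desc_f_zero :
    (desc φ₁ φ₀ comm hφ).f 0 = (xZeroIso f).hom ≫ φ₀ :=
  mkHomFromDouble_f₁ ..

end

theorem hom_ext {A B : C} {f : A ⟶ B} {K : CochainComplex C ℤ} {φ ψ : twoTermComplex f ⟶ K}
    (h₁ : φ.f (-1) = ψ.f (-1)) (h₀ : φ.f 0 = ψ.f 0) : φ = ψ :=
  from_double_hom_ext h₁ h₀

section

variable {A B A' B' A'' B'' : C} {f : A ⟶ B} {f' : A' ⟶ B'} {f'' : A'' ⟶ B''}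

/-- The morphism between two-term complexes attached to a commutative square. -/
protected noncomputable def map (φ₁ : A ⟶ A') (φ₀ : B ⟶ B') (comm : φ₁ ≫ f' = f ≫ φ₀) :
    twoTermComplex f ⟶ twoTermComplex f' :=
  desc (φ₁ ≫ (xNegOneIso f').inv) (φ₀ ≫ (xZeroIso f').inv)
    (by
      simp only [d_eq, Category.assoc, Iso.inv_hom_id_assoc]
      rw [← Category.assoc, comm, Category.assoc])
    ((isZero_double_X f' _ 1 (by lia) (by lia)).eq_of_tgt _ _)

theorem map_f_negOne (φ₁ : A ⟶ A') (φ₀ : B ⟶ B') (comm : φ₁ ≫ f' = f ≫ φ₀) :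
    (twoTermComplex.map φ₁ φ₀ comm).f (-1) =
      (xNegOneIso f).hom ≫ φ₁ ≫ (xNegOneIso f').inv := by
  simp [twoTermComplex.map]

theorem map_f_zero (φ₁ : A ⟶ A') (φ₀ : B ⟶ B') (comm : φ₁ ≫ f' = f ≫ φ₀) :
    (twoTermComplex.map φ₁ φ₀ comm).f 0 = (xZeroIso f).hom ≫ φ₀ ≫ (xZeroIso f').inv := by
  simp [twoTermComplex.map]

protected theorem map_id : twoTermComplex.map (f := f) (𝟙 A) (𝟙 B) (by simp) = 𝟙 _ :=
  hom_ext (by simp [map_f_negOne]) (by simp [map_f_zero])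

protected theorem map_comp (φ₁ : A ⟶ A') (φ₀ : B ⟶ B') (comm : φ₁ ≫ f' = f ≫ φ₀)
    (ψ₁ : A' ⟶ A'') (ψ₀ : B' ⟶ B'') (comm' : ψ₁ ≫ f'' = f' ≫ ψ₀) :
    twoTermComplex.map φ₁ φ₀ comm ≫ twoTermComplex.map ψ₁ ψ₀ comm' =
      twoTermComplex.map (φ₁ ≫ ψ₁) (φ₀ ≫ ψ₀) (by
        rw [Category.assoc, comm', ← Category.assoc, comm, Category.assoc]) :=
  hom_ext (by simp [map_f_negOne]) (by simp [map_f_zero])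

protected theorem map_add (φ₁ ψ₁ : A ⟶ A') (φ₀ ψ₀ : B ⟶ B') (comm : φ₁ ≫ f' = f ≫ φ₀)
    (comm' : ψ₁ ≫ f' = f ≫ ψ₀) :
    twoTermComplex.map φ₁ φ₀ comm + twoTermComplex.map ψ₁ ψ₀ comm' =
      twoTermComplex.map (φ₁ + ψ₁) (φ₀ + ψ₀)
        (by rw [Preadditive.add_comp, Preadditive.comp_add, comm, comm']) :=
  hom_ext (by simp [map_f_negOne]) (by simp [map_f_zero])

end

/-- The homology of a two-term complex in degree `0`. -/
noncomputable def homologyZeroIso {A B : C} (f : A ⟶ B) :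
    (twoTermComplex f).homology 0 ≅ cokernel f :=
  (twoTermComplex f).isoHomologyι 0 1 (by simp)
    ((isZero_double_X f _ 1 (by lia) (by lia)).eq_of_tgt _ _) ≪≫
  ((twoTermComplex f).opcyclesIsCokernel (-1) 0 (by simp)).coconePointUniqueUpToIso
    (cokernelIsCokernel _) ≪≫
  cokernel.mapIso _ _ (xNegOneIso f) (xZeroIso f) (by simp [d_eq])

/-- The homology of a two-term complex in degree `-1`. -/
noncomputable def homologyNegOneIso {A B : C} (f : A ⟶ B) :
    (twoTermComplex f).homology (-1) ≅ kernel f :=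
  ((twoTermComplex f).isoHomologyπ (-2) (-1) (by simp)
    ((isZero_double_X f _ (-2) (by lia) (by lia)).eq_of_src _ _)).symm ≪≫
  ((twoTermComplex f).cyclesIsKernel (-1) 0 (by simp)).conePointUniqueUpToIso
    (kernelIsKernel _) ≪≫
  kernel.mapIso _ _ (xNegOneIso f) (xZeroIso f) (by simp [d_eq])

theorem acyclic_id (B : C) : (twoTermComplex (𝟙 B)).Acyclic := by
  intro i
  by_cases h₁ : i = -1
  · subst h₁
    rw [exactAt_iff_isZero_homology]
    exact IsZero.of_iso (isZero_kernel_of_mono _) (homologyNegOneIso (𝟙 B))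
  by_cases h₀ : i = 0
  · subst h₀
    rw [exactAt_iff_isZero_homology]
    exact IsZero.of_iso (isZero_cokernel_of_epi _) (homologyZeroIso (𝟙 B))
  by_cases h : i < -1
  · exact exactAt_of_isGE _ (-1) i h
  · exact exactAt_of_isLE _ 0 i (by lia)

theorem isZero_X_one {A B : C} (f : A ⟶ B) : IsZero ((twoTermComplex f).X 1) :=
  (twoTermComplex f).isZero_of_isStrictlyLE 0 1

theorem isZero_X_neg_two {A B : C} (f : A ⟶ B) : IsZero ((twoTermComplex f).X (-2)) :=
  (twoTermComplex f).isZero_of_isStrictlyGE (-1) (-2)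

section Pullback

variable {A P : C} {K : CochainComplex C ℤ} [K.IsStrictlyLE 0]
  {d : A ⟶ P} {q : A ⟶ K.X (-1)} {p : P ⟶ K.X 0} (sq : IsPullback q d (K.d (-1) 0) p)

/-- The comparison morphism to a complex in degrees `-1` and `0` from the two-term complex
obtained by pulling back its differential. -/
noncomputable def ofPullback : twoTermComplex d ⟶ K :=
  desc q p sq.w ((K.isZero_of_isStrictlyLE 0 1).eq_of_tgt _ _)

theorem isIso_homologyMap_ofPullback_zero [Epi p] : IsIso (homologyMap (ofPullback sq) 0) := by
  have : Mono (homologyMap (ofPullback sq) 0) := by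
    rw [mono_homologyMap_iff_up_to_refinements _ (-1) 0 1 (by simp) (by simp)]
    exact fun W x _ y hy => ⟨W, 𝟙 W, inferInstance, sq.lift y (x ≫ (xZeroIso d).hom)
      (by simpa [ofPullback] using hy.symm) ≫ (xNegOneIso d).inv, by simp [d_eq]⟩
  have : Epi (homologyMap (ofPullback sq) 0) := by
    rw [epi_homologyMap_iff_up_to_refinements _ (-1) 0 1 (by simp) (by simp)]
    intro W y _
    obtain ⟨W', π, hπ, x, hx⟩ := surjective_up_to_refinements_of_epi p y
    exact ⟨W', π, hπ, x ≫ (xZeroIso d).inv, (isZero_X_one d).eq_of_tgt _ _, 0,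
      by simp [ofPullback, hx]⟩
  exact isIso_of_mono_of_epi _

variable [K.IsStrictlyGE (-1)]

theorem isIso_homologyMap_ofPullback_neg_one : IsIso (homologyMap (ofPullback sq) (-1)) := by
  have : Mono (homologyMap (ofPullback sq) (-1)) := by
    rw [mono_homologyMap_iff_up_to_refinements _ (-2) (-1) 0 (by simp) (by simp)]
    intro W x hx y hy
    refine ⟨W, 𝟙 W, inferInstance, 0, ?_⟩
    rw [(K.isZero_of_isStrictlyGE (-1) (-2)).eq_of_tgt y 0, zero_comp] at hy
    rw [Category.id_comp, zero_comp, ← cancel_mono (xNegOneIso d).hom]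
    refine sq.hom_ext (by simpa [ofPullback] using hy) ?_
    rw [d_eq] at hx
    simpa using hx =≫ (xZeroIso d).hom
  have : Epi (homologyMap (ofPullback sq) (-1)) := by
    rw [epi_homologyMap_iff_up_to_refinements _ (-2) (-1) 0 (by simp) (by simp)]
    exact fun W y hy => ⟨W, 𝟙 W, inferInstance,
      sq.lift y 0 (by simpa using hy) ≫ (xNegOneIso d).inv, by simp [d_eq], 0,
      by simp [ofPullback]⟩
  exact isIso_of_mono_of_epi _

theorem quasiIso_ofPullback [Epi p] : QuasiIso (ofPullback sq) := by
  refine ⟨fun i => ?_⟩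
  by_cases h₁ : i = -1
  · subst h₁
    exact (quasiIsoAt_iff_isIso_homologyMap _ _).2 (isIso_homologyMap_ofPullback_neg_one sq)
  by_cases h₀ : i = 0
  · subst h₀
    exact (quasiIsoAt_iff_isIso_homologyMap _ _).2 (isIso_homologyMap_ofPullback_zero sq)
  have exactAt (L : CochainComplex C ℤ) [L.IsStrictlyGE (-1)] [L.IsStrictlyLE 0] :
      L.ExactAt i := by
    by_cases h : i < -1
    · exact exactAt_of_isGE _ (-1) i h
    · exact exactAt_of_isLE _ 0 i (by lia)
  exact (quasiIsoAt_iff_exactAt' _ _ (exactAt K)).2 (exactAt _)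

end Pullback

end twoTermComplex

section Localization

variable [HasDerivedCategory.{w} C] {K L : CochainComplex C ℤ}

theorem derivedCategory_Q_map_eq_zero_of_acyclic (hL : L.Acyclic) (f : K ⟶ L) :
    DerivedCategory.Q.map f = 0 := by
  have : QuasiIso (0 : L ⟶ L) := ⟨fun i => (quasiIsoAt_iff_exactAt _ i (hL i)).2 (hL i)⟩
  have : IsIso (DerivedCategory.Q.map (0 : L ⟶ L)) :=
    (DerivedCategory.isIso_Q_map_iff_quasiIso _ _).2 this
  rw [← cancel_mono (DerivedCategory.Q.map (0 : L ⟶ L))]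
  simp

theorem exists_homotopy_zero_of_derivedCategory_Q_map_eq_zero (f : K ⟶ L)
    (hf : DerivedCategory.Q.map f = 0) :
    ∃ (K' : CochainComplex C ℤ) (s : K' ⟶ K), QuasiIso s ∧ Nonempty (Homotopy (s ≫ f) 0) := by
  have hQh : DerivedCategory.Qh.map ((HomotopyCategory.quotient _ _).map f) =
      DerivedCategory.Qh.map 0 := by
    rw [Functor.map_zero, ← cancel_mono ((DerivedCategory.quotientCompQhIso C).hom.app L),
      DerivedCategory.quotientCompQhIso_hom_naturality, hf, comp_zero, zero_comp]
  obtain ⟨K', s, hs, hsf⟩ := (MorphismProperty.map_eq_iff_precomp DerivedCategory.Qh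
    (HomotopyCategory.quasiIso _ _) _ _).1 hQh
  obtain ⟨K', rfl⟩ := HomotopyCategory.quotient_obj_surjective K'
  obtain ⟨s, rfl⟩ := (HomotopyCategory.quotient _ _).map_surjective s
  rw [comp_zero, ← Functor.map_comp, HomotopyCategory.quotient_map_eq_zero_iff] at hsf
  rw [← DerivedCategory.isIso_Qh_map_iff] at hs
  refine ⟨K', s, ?_, hsf⟩
  rw [← DerivedCategory.isIso_Q_map_iff_quasiIso]
  exact (NatIso.isIso_map_iff (DerivedCategory.quotientCompQhIso C) s).1 hs

end Localization

end TwoTermComplex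

namespace TorsionPair.TwoTerm

open CochainComplex HomologicalComplex twoTermComplex

variable {R : Type u} [Ring R] {t : TorsionPair (ModuleCat.{u} R)}

/-- The cochain complex underlying an object of the model. -/
noncomputable abbrev toComplex (M : t.TwoTerm) : CochainComplex (ModuleCat.{u} R) ℤ :=
  twoTermComplex (ModuleCat.ofHom M.d)

/-- The morphism of cochain complexes attached to a chain map. -/
noncomputable def toComplexMap {M N : t.TwoTerm} (f : chain M N) : M.toComplex ⟶ N.toComplex :=
  twoTermComplex.map (ModuleCat.ofHom f.1.1) (ModuleCat.ofHom f.1.2) (by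
    ext a
    exact chain_comm f a)

theorem toComplexMap_f_negOne {M N : t.TwoTerm} (f : chain M N) :
    (toComplexMap f).f (-1) = (xNegOneIso (ModuleCat.ofHom M.d)).hom ≫ ModuleCat.ofHom f.1.1 ≫
      (xNegOneIso (ModuleCat.ofHom N.d)).inv :=
  map_f_negOne ..

theorem toComplexMap_f_zero {M N : t.TwoTerm} (f : chain M N) :
    (toComplexMap f).f 0 = (xZeroIso (ModuleCat.ofHom M.d)).hom ≫ ModuleCat.ofHom f.1.2 ≫
      (xZeroIso (ModuleCat.ofHom N.d)).inv :=
  map_f_zero ..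

theorem toComplexMap_add {M N : t.TwoTerm} (f g : chain M N) :
    toComplexMap (f + g) = toComplexMap f + toComplexMap g := by
  simp only [toComplexMap, twoTermComplex.map_add]
  rfl

theorem toComplexMap_comp {M N L : t.TwoTerm} (f : chain M N) (g : chain N L) :
    toComplexMap (chainComp f g) = toComplexMap f ≫ toComplexMap g := by
  simp only [toComplexMap, twoTermComplex.map_comp]
  rfl

section Components

variable {M : t.TwoTerm} {K : CochainComplex (ModuleCat.{u} R) ℤ} (s : K ⟶ M.toComplex)

/-- The component in degree `-1` of a morphism to the complex of an object of the model. -/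
noncomputable def compNegOne : K.X (-1) →ₗ[R] M.A :=
  (s.f (-1) ≫ (xNegOneIso (ModuleCat.ofHom M.d)).hom).hom

/-- The component in degree `0` of a morphism to the complex of an object of the model. -/
noncomputable def compZero : K.X 0 →ₗ[R] M.P :=
  (s.f 0 ≫ (xZeroIso (ModuleCat.ofHom M.d)).hom).hom

theorem d_compNegOne (x : K.X (-1)) :
    M.d (compNegOne s x) = compZero s ((K.d (-1) 0).hom x) := by
  have h : (s.f (-1) ≫ (xNegOneIso (ModuleCat.ofHom M.d)).hom) ≫ ModuleCat.ofHom M.d =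
      K.d (-1) 0 ≫ s.f 0 ≫ (xZeroIso (ModuleCat.ofHom M.d)).hom := by
    rw [← s.comm_assoc, d_eq]
    simp
  exact congrArg (fun f => f.hom x) h

end Components

theorem toComplexMap_surjective {M N : t.TwoTerm} (f : M.toComplex ⟶ N.toComplex) :
    ∃ g : chain M N, toComplexMap g = f := by
  let e := ModuleCat.ofHom M.d
  refine ⟨⟨(compNegOne f ∘ₗ (xNegOneIso e).inv.hom, compZero f ∘ₗ (xZeroIso e).inv.hom),
    LinearMap.ext fun a => ?_⟩, hom_ext ?_ ?_⟩
  · have h : (xNegOneIso e).inv ≫ M.toComplex.d (-1) 0 = e ≫ (xZeroIso e).inv := by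
      simp [d_eq, e]
    have ha := congrArg (fun g => g.hom a) h
    exact (d_compNegOne f _).trans (congrArg (compZero f) ha)
  · rw [toComplexMap_f_negOne]
    ext
    simp [compNegOne, e]
  · rw [toComplexMap_f_zero]
    ext
    simp [compZero, e]

section Localization

variable [HasDerivedCategory.{w} (ModuleCat.{u} R)]

theorem Q_map_toComplexMap_null {M N : t.TwoTerm} (k : M.P →ₗ[R] N.A) :
    DerivedCategory.Q.map (toComplexMap (null M N k)) = 0 := by
  let a : M.toComplex ⟶ twoTermComplex (𝟙 (ModuleCat.of R M.P)) :=
    twoTermComplex.map (ModuleCat.ofHom M.d) (𝟙 _) (by simp)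
  let b : twoTermComplex (𝟙 (ModuleCat.of R M.P)) ⟶ N.toComplex :=
    twoTermComplex.map (ModuleCat.ofHom k) (ModuleCat.ofHom (N.d ∘ₗ k)) (by ext; simp)
  have hab : toComplexMap (null M N k) = a ≫ b := by
    simp only [a, b, twoTermComplex.map_comp, toComplexMap]
    congr 1
  rw [hab, Functor.map_comp, derivedCategory_Q_map_eq_zero_of_acyclic (acyclic_id _) a,
    Limits.zero_comp]

/-- The additive map on chain maps given by the localization functor. -/
noncomputable def chainToDerived (M N : t.TwoTerm) :
    chain M N →+ (DerivedCategory.Q.obj M.toComplex ⟶ DerivedCategory.Q.obj N.toComplex) :=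
  AddMonoidHom.mk' (fun f => DerivedCategory.Q.map (toComplexMap f)) fun f g => by
    rw [toComplexMap_add, Functor.map_add]

/-- The functor from the model to the derived category. -/
noncomputable def toDerived : t.TwoTerm ⥤ DerivedCategory (ModuleCat.{u} R) where
  obj M := DerivedCategory.Q.obj M.toComplex
  map {M N} f := QuotientAddGroup.lift (null M N).range (chainToDerived M N) (by
    rintro _ ⟨k, rfl⟩
    exact Q_map_toComplexMap_null k) f
  map_id M := (congrArg DerivedCategory.Q.map twoTermComplex.map_id).trans
    (DerivedCategory.Q.map_id M.toComplex)
  map_comp {M N L} f g := by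
    obtain ⟨f, rfl⟩ := QuotientAddGroup.mk_surjective f
    obtain ⟨g, rfl⟩ := QuotientAddGroup.mk_surjective g
    exact (congrArg DerivedCategory.Q.map (toComplexMap_comp f g)).trans
      (DerivedCategory.Q.map_comp _ _)

theorem toDerived_map_mk {M N : t.TwoTerm} (f : chain M N) :
    toDerived.map (X := M) (Y := N) (QuotientAddGroup.mk (s := (null M N).range) f) =
      DerivedCategory.Q.map (toComplexMap f) := rfl

end Localization

end TorsionPair.TwoTerm

namespace TorsionPair.TwoTerm

open CochainComplex HomologicalComplex twoTermComplex

variable {R : Type u} [Ring R] {t : TorsionPair (ModuleCat.{u} R)}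

section QuasiIso

variable {M : t.TwoTerm} {K : CochainComplex (ModuleCat.{u} R) ℤ} (s : K ⟶ M.toComplex)
  [QuasiIso s]

theorem exists_eq_compZero_add_d (p : M.P) :
    ∃ (z : LinearMap.ker (K.d 0 1).hom) (a : M.A), p = compZero s z + M.d a := by
  have : Epi (homologyMap s 0) := inferInstance
  obtain ⟨z, y, hz, hzy⟩ := exists_eq_add_d_of_epi_homologyMap s (-1) 0 1 (by simp) (by simp)
    ((xZeroIso (ModuleCat.ofHom M.d)).inv.hom p)
    ((ModuleCat.subsingleton_of_isZero (isZero_X_one _)).elim _ _)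
  refine ⟨⟨z, hz⟩, (xNegOneIso (ModuleCat.ofHom M.d)).hom.hom y, ?_⟩
  have h := congrArg (xZeroIso (ModuleCat.ofHom M.d)).hom.hom hzy
  rw [d_eq] at h
  simpa [compZero] using h

theorem exists_compNegOne_eq_of_ker (a : M.A) (ha : M.d a = 0) :
    ∃ x : K.X (-1), (K.d (-1) 0).hom x = 0 ∧ compNegOne s x = a := by
  have : Epi (homologyMap s (-1)) := inferInstance
  have hinj := (ModuleCat.mono_iff_injective (xZeroIso (ModuleCat.ofHom M.d)).hom).1 inferInstance
  obtain ⟨x, w, hx, hxw⟩ := exists_eq_add_d_of_epi_homologyMap s (-2) (-1) 0 (by simp) (by simp)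
    ((xNegOneIso (ModuleCat.ofHom M.d)).inv.hom a) (hinj (by
      rw [d_eq]
      simpa using ha))
  obtain rfl : w = 0 := (ModuleCat.subsingleton_of_isZero (isZero_X_neg_two _)).elim _ _
  have h := congrArg (xNegOneIso (ModuleCat.ofHom M.d)).hom.hom hxw
  exact ⟨x, hx, Eq.symm (by simpa [compNegOne] using h)⟩

theorem exists_d_eq_and_compNegOne_eq (z : K.X 0) (hz : (K.d 0 1).hom z = 0) (a : M.A)
    (h : compZero s z = M.d a) : ∃ x : K.X (-1), (K.d (-1) 0).hom x = z ∧ compNegOne s x = a := by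
  have : Mono (homologyMap s 0) := inferInstance
  have hinj := (ModuleCat.mono_iff_injective (xZeroIso (ModuleCat.ofHom M.d)).hom).1 inferInstance
  obtain ⟨x, hx⟩ := exists_d_eq_of_mono_homologyMap s (-1) 0 1 (by simp) (by simp) z hz
    ((xNegOneIso (ModuleCat.ofHom M.d)).inv.hom a) (hinj (by
      rw [d_eq]
      simpa [compZero] using h))
  obtain ⟨y, hy, hya⟩ := exists_compNegOne_eq_of_ker s (a - compNegOne s x) (by
    rw [map_sub, d_compNegOne, hx, h, sub_self])
  exact ⟨x + y, by rw [map_add, hx, hy, add_zero], by rw [map_add, hya, add_sub_cancel]⟩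

theorem eq_zero_of_d_eq_zero_of_compNegOne_eq_zero [K.IsStrictlyGE (-1)] (x : K.X (-1))
    (h₀ : (K.d (-1) 0).hom x = 0) (h₁ : compNegOne s x = 0) : x = 0 := by
  have : Mono (homologyMap s (-1)) := inferInstance
  have hinj := (ModuleCat.mono_iff_injective (xNegOneIso (ModuleCat.ofHom M.d)).hom).1
    inferInstance
  obtain ⟨y, rfl⟩ := exists_d_eq_of_mono_homologyMap s (-2) (-1) 0 (by simp) (by simp)
    x h₀ 0 (hinj (by simpa [compNegOne] using h₁))
  obtain rfl : y = 0 := (ModuleCat.subsingleton_of_isZero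
    (K.isZero_of_isStrictlyGE (-1) (-2) (by lia))).elim _ _
  rw [map_zero]

/-- Up to a homotopy `k`, a quasi-isomorphism has a section in degree `0` because `M.P` is
projective. -/
theorem exists_section : ∃ (σ : M.P →ₗ[R] LinearMap.ker (K.d 0 1).hom) (k : M.P →ₗ[R] M.A),
    ∀ p, p = compZero s (σ p) + M.d (k p) := by
  let e : LinearMap.ker (K.d 0 1).hom × M.A →ₗ[R] M.P :=
    (compZero s ∘ₗ Submodule.subtype _).coprod M.d
  have he : Function.Surjective e := fun p => by
    obtain ⟨z, a, h⟩ := exists_eq_compZero_add_d s p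
    exact ⟨(z, a), h.symm⟩
  obtain ⟨l, hl⟩ := Module.projective_lifting_property e LinearMap.id he
  exact ⟨LinearMap.fst _ _ _ ∘ₗ l, LinearMap.snd _ _ _ ∘ₗ l,
    fun p => (LinearMap.congr_fun hl p).symm⟩

theorem exists_section_negOne {σ : M.P →ₗ[R] LinearMap.ker (K.d 0 1).hom} {k : M.P →ₗ[R] M.A}
    (hσ : ∀ p, p = compZero s (σ p) + M.d (k p)) (a : M.A) :
    ∃ x, (K.d (-1) 0).hom x = σ (M.d a) ∧ compNegOne s x = a - k (M.d a) :=
  exists_d_eq_and_compNegOne_eq s _ (σ (M.d a)).2 _ (by rw [map_sub, eq_sub_iff_add_eq, ← hσ])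

theorem exists_linear_section_negOne [K.IsStrictlyGE (-1)]
    {σ : M.P →ₗ[R] LinearMap.ker (K.d 0 1).hom} {k : M.P →ₗ[R] M.A}
    (hσ : ∀ p, p = compZero s (σ p) + M.d (k p)) : ∃ σ₁ : M.A →ₗ[R] K.X (-1), ∀ a,
      (K.d (-1) 0).hom (σ₁ a) = σ (M.d a) ∧ compNegOne s (σ₁ a) = a - k (M.d a) := by
  let j : K.X (-1) →ₗ[R] K.X 0 × M.A := (K.d (-1) 0).hom.prod (compNegOne s)
  have hj : Function.Injective j := by
    rw [← LinearMap.ker_eq_bot, LinearMap.ker_eq_bot']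
    exact fun x hx => eq_zero_of_d_eq_zero_of_compNegOne_eq_zero s x (congrArg Prod.fst hx)
      (congrArg Prod.snd hx)
  let τ : M.A →ₗ[R] K.X 0 × M.A :=
    (Submodule.subtype _ ∘ₗ σ ∘ₗ M.d).prod (LinearMap.id - k ∘ₗ M.d)
  have hτ : LinearMap.range τ ≤ LinearMap.range j := by
    rintro _ ⟨a, rfl⟩
    obtain ⟨x, hx₀, hx₁⟩ := exists_section_negOne s hσ a
    exact ⟨x, Prod.ext hx₀ hx₁⟩
  obtain ⟨σ₁, hσ₁⟩ := exists_linearMap_comp_eq_of_range_le hj hτ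
  exact ⟨σ₁, fun a => ⟨congrArg Prod.fst (hσ₁ a), congrArg Prod.snd (hσ₁ a)⟩⟩

end QuasiIso

section Homotopy

variable {M N : t.TwoTerm} {K : CochainComplex (ModuleCat.{u} R) ℤ} {s : K ⟶ M.toComplex}
  {f : chain M N}

theorem exists_linearMap_of_homotopy_zero (H : Homotopy (s ≫ toComplexMap f) 0) :
    ∃ h : K.X 0 →ₗ[R] N.A, (∀ x, f.1.1 (compNegOne s x) = h ((K.d (-1) 0).hom x)) ∧
      ∀ z, (K.d 0 1).hom z = 0 → f.1.2 (compZero s z) = N.d (h z) := by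
  refine ⟨(H.hom 0 (-1) ≫ (xNegOneIso (ModuleCat.ofHom N.d)).hom).hom, fun x => ?_,
    fun z hz => ?_⟩
  · have h := H.comm (-1)
    rw [dNext_eq _ (show (ComplexShape.up ℤ).Rel (-1) 0 by simp),
      prevD_eq _ (show (ComplexShape.up ℤ).Rel (-2) (-1) by simp),
      (isZero_X_neg_two _).eq_of_tgt (H.hom (-1) (-2)) 0,
      Limits.zero_comp, add_zero, zero_f, add_zero, comp_f, toComplexMap_f_negOne] at h
    have hx := congrArg (fun f => (f ≫ (xNegOneIso (ModuleCat.ofHom N.d)).hom).hom x) h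
    simpa [compNegOne] using hx
  · have h := H.comm 0
    rw [dNext_eq _ (show (ComplexShape.up ℤ).Rel 0 1 by simp),
      prevD_eq _ (show (ComplexShape.up ℤ).Rel (-1) 0 by simp),
      zero_f, add_zero, comp_f, toComplexMap_f_zero, d_eq] at h
    have hx := congrArg (fun f => (f ≫ (xZeroIso (ModuleCat.ofHom N.d)).hom).hom z) h
    simpa [compZero, hz] using hx

theorem mem_null_range_of_homotopy_zero [QuasiIso s] (H : Homotopy (s ≫ toComplexMap f) 0) :
    f ∈ (null M N).range := by
  obtain ⟨h, h₁, h₀⟩ := exists_linearMap_of_homotopy_zero H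
  obtain ⟨σ, k, hσ⟩ := exists_section s
  refine ⟨h ∘ₗ Submodule.subtype _ ∘ₗ σ + f.1.1 ∘ₗ k,
    Subtype.ext (Prod.ext (LinearMap.ext fun a => ?_) (LinearMap.ext fun p => ?_))⟩
  · obtain ⟨x, hx₀, hx₁⟩ := exists_section_negOne s hσ a
    have hx := h₁ x
    rw [hx₀, hx₁] at hx
    simp [null, ← hx]
  · conv_rhs => rw [hσ p]
    simp [null, h₀ _ (σ p).2, chain_comm]

end Homotopy

/-! ### The equivalence between the model and the heart -/

variable [HasDerivedCategory.{w} (ModuleCat.{u} R)]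

theorem exists_Q_map_comp_Q_map_eq_id {M : t.TwoTerm} {K : CochainComplex (ModuleCat.{u} R) ℤ}
    [K.IsStrictlyGE (-1)] (s : K ⟶ M.toComplex) [QuasiIso s] :
    ∃ r : M.toComplex ⟶ K, DerivedCategory.Q.map r ≫ DerivedCategory.Q.map s = 𝟙 _ := by
  obtain ⟨σ, k, hσ⟩ := exists_section s
  obtain ⟨σ₁, hσ₁⟩ := exists_linear_section_negOne s hσ
  let σ₀ : M.P →ₗ[R] K.X 0 := Submodule.subtype _ ∘ₗ σ
  let r : M.toComplex ⟶ K := desc (ModuleCat.ofHom σ₁) (ModuleCat.ofHom σ₀)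
    (by ext a; exact (hσ₁ a).1) (by ext p; exact (σ p).2)
  refine ⟨r, ?_⟩
  have hrs : r ≫ s + toComplexMap (null M M k) = 𝟙 _ := by
    refine hom_ext ?_ ?_
    · rw [← cancel_epi (xNegOneIso _).inv, ← cancel_mono (xNegOneIso _).hom]
      ext a
      have ha := (hσ₁ a).2
      rw [eq_sub_iff_add_eq] at ha
      simpa [r, toComplexMap_f_negOne, null, compNegOne] using ha
    · rw [← cancel_epi (xZeroIso _).inv, ← cancel_mono (xZeroIso _).hom]
      ext p
      simpa [r, σ₀, toComplexMap_f_zero, null, compZero] using (hσ p).symm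
  rw [← Functor.map_comp, eq_sub_of_add_eq hrs, Functor.map_sub, Q_map_toComplexMap_null,
    sub_zero, CategoryTheory.Functor.map_id]

instance : (toDerived (t := t)).Faithful where
  map_injective {M N} f g hfg := by
    obtain ⟨f, rfl⟩ := QuotientAddGroup.mk_surjective f
    obtain ⟨g, rfl⟩ := QuotientAddGroup.mk_surjective g
    have hQ : DerivedCategory.Q.map (toComplexMap (-f + g)) = 0 :=
      (map_add (chainToDerived M N) _ _).trans
        ((congrArg₂ _ (map_neg (chainToDerived M N) f) hfg.symm).trans (neg_add_cancel _))
    obtain ⟨K, s, _, ⟨H⟩⟩ := exists_homotopy_zero_of_derivedCategory_Q_map_eq_zero _ hQ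
    exact QuotientAddGroup.eq.2 (mem_null_range_of_homotopy_zero H)

instance : (toDerived (t := t)).Full where
  map_surjective {M N} φ := by
    obtain ⟨K, _, _, s, hs, g, hφ⟩ :=
      DerivedCategory.right_fac_of_isStrictlyLE_of_isStrictlyGE (-1) 0
        (X := M.toComplex) (Y := N.toComplex) φ
    have := (DerivedCategory.isIso_Q_map_iff_quasiIso _ s).1 hs
    obtain ⟨r, hr⟩ := exists_Q_map_comp_Q_map_eq_id s
    obtain ⟨f, hf⟩ := toComplexMap_surjective (r ≫ g)
    refine ⟨QuotientAddGroup.mk (s := (null M N).range) f, ?_⟩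
    rw [toDerived_map_mk, hf, Functor.map_comp, hφ, IsIso.eq_inv_of_inv_hom_id hr]

/-- The cohomology in degree `0` of a two-term complex of modules. -/
noncomputable def homologyZeroIsoQuotientRange {A P : ModuleCat.{u} R} (d : A ⟶ P) :
    (DerivedCategory.homologyFunctor (ModuleCat.{u} R) 0).obj
      (DerivedCategory.Q.obj (twoTermComplex d)) ≅
      ModuleCat.of R (P ⧸ LinearMap.range d.hom) :=
  (DerivedCategory.homologyFunctorFactors _ 0).app _ ≪≫ twoTermComplex.homologyZeroIso _ ≪≫
    ModuleCat.cokernelIsoRangeQuotient _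

/-- The cohomology in degree `-1` of a two-term complex of modules. -/
noncomputable def homologyNegOneIsoKer {A P : ModuleCat.{u} R} (d : A ⟶ P) :
    (DerivedCategory.homologyFunctor (ModuleCat.{u} R) (-1)).obj
      (DerivedCategory.Q.obj (twoTermComplex d)) ≅ ModuleCat.of R (LinearMap.ker d.hom) :=
  (DerivedCategory.homologyFunctorFactors _ (-1)).app _ ≪≫
    twoTermComplex.homologyNegOneIso _ ≪≫ ModuleCat.kernelIsoKer _

theorem heart_toDerived (M : t.TwoTerm) : t.heart (toDerived.obj M) := by
  have := t.T_iso
  have := t.F_iso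
  refine ⟨⟨?_, ?_⟩, ⟨?_, ?_⟩⟩
  · exact inferInstanceAs ((DerivedCategory.Q.obj M.toComplex).IsLE 0)
  · exact t.T.prop_of_iso (homologyZeroIsoQuotientRange (ModuleCat.ofHom M.d)).symm M.isT
  · exact inferInstanceAs ((DerivedCategory.Q.obj M.toComplex).IsGE (-1))
  · exact t.F.prop_of_iso (homologyNegOneIsoKer (ModuleCat.ofHom M.d)).symm M.isF

theorem exists_iso_toDerived {X : DerivedCategory (ModuleCat.{u} R)} (hX : t.heart X) :
    ∃ M : t.TwoTerm, Nonempty (toDerived.obj M ≅ X) := by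
  obtain ⟨⟨hX₁, hX₂⟩, ⟨hX₃, hX₄⟩⟩ := hX
  obtain ⟨K, _, _, ⟨e⟩⟩ := DerivedCategory.exists_iso_Q_obj_of_isGE_of_isLE X (-1) 0
  obtain ⟨P, p, _, _⟩ : ∃ (P : ModuleCat.{u} R) (p : P ⟶ K.X 0), Epi p ∧ Projective P :=
    ⟨_, Projective.π (K.X 0), inferInstance, inferInstance⟩
  obtain ⟨A, q, d, sq⟩ : ∃ (A : ModuleCat.{u} R) (q : A ⟶ K.X (-1)) (d : A ⟶ P),
      IsPullback q d (K.d (-1) 0) p := ⟨_, _, _, IsPullback.of_hasPullback _ _⟩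
  have := (DerivedCategory.isIso_Q_map_iff_quasiIso _ _).2 (quasiIso_ofPullback sq)
  let e' : DerivedCategory.Q.obj (twoTermComplex d) ≅ X :=
    asIso (DerivedCategory.Q.map (ofPullback sq)) ≪≫ e.symm
  have := t.T_iso
  have := t.F_iso
  exact ⟨{  A := A
            P := P
            d := d.hom
            projective := (IsProjective.iff_projective P).2 ‹_›
            isF := t.F.prop_of_iso (((DerivedCategory.homologyFunctor _ (-1)).mapIso e').symm ≪≫
              homologyNegOneIsoKer d) hX₄
            isT := t.T.prop_of_iso (((DerivedCategory.homologyFunctor _ 0).mapIso e').symm ≪≫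
              homologyZeroIsoQuotientRange d) hX₂ }, ⟨e'⟩⟩

variable (t) in
/-- The functor from the model to the heart. -/
noncomputable def toHeart : t.TwoTerm ⥤ t.Heart := t.heart.lift toDerived heart_toDerived

instance : (toHeart t).Faithful := inferInstanceAs (t.heart.lift toDerived heart_toDerived).Faithful

instance : (toHeart t).Full := inferInstanceAs (t.heart.lift toDerived heart_toDerived).Full

instance : (toHeart t).EssSurj where
  mem_essImage X := by
    obtain ⟨M, ⟨e⟩⟩ := exists_iso_toDerived X.property
    exact ⟨M, ⟨t.heart.isoMk e⟩⟩

instance : (toHeart t).IsEquivalence where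

theorem isModuleCategory_heart_iff :
    IsModuleCategory.{u} t.Heart ↔ IsModuleCategory.{u} t.TwoTerm :=
  ⟨fun ⟨S, _, ⟨e⟩⟩ => ⟨S, _, ⟨(toHeart t).asEquivalence.trans e⟩⟩,
    fun ⟨S, _, ⟨e⟩⟩ => ⟨S, _, ⟨(toHeart t).asEquivalence.symm.trans e⟩⟩⟩

end TorsionPair.TwoTerm

/-! ### Progenerators of preadditive categories -/

section Progenerator

variable {C : Type*} [Category.{u} C] [Preadditive C] (G : C)

/-- An object `G` of a preadditive category, with chosen powers, which behaves like a small
projective generator: homomorphisms out of `G` are generated by the coprojections, detect zero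
morphisms and lift to cokernels, and every object `M` is the cokernel of its kernel, in the sense
that maps on `G^(Hom(G, M))` which vanish on that kernel factor through `M`. -/
structure IsProgenerator (pow : Type u → C) (ι : ∀ {I : Type u}, I → (G ⟶ pow I)) : Prop where
  exists_desc {I : Type u} {M : C} (f : I → (G ⟶ M)) : ∃ g : pow I ⟶ M, ∀ i, ι i ≫ g = f i
  span_eq_top (I : Type u) :
    Submodule.span (End G)ᵐᵒᵖ (Set.range (ι : I → (G ⟶ pow I))) = ⊤
  separates {M N : C} (f : M ⟶ N) (hf : ∀ s : G ⟶ M, s ≫ f = 0) : f = 0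
  exists_factor {M N : C} (p : pow (G ⟶ M) ⟶ M) (hp : ∀ s, ι s ≫ p = s)
    (q : pow (G ⟶ M) ⟶ N) (hq : ∀ s : G ⟶ pow (G ⟶ M), s ≫ p = 0 → s ≫ q = 0) :
    ∃ r : M ⟶ N, p ≫ r = q
  exists_coker {I J : Type u} (f : pow J ⟶ pow I) : ∃ (D : C) (c : pow I ⟶ D),
    (∀ s : G ⟶ D, ∃ s' : G ⟶ pow I, s' ≫ c = s) ∧
      ∀ s : G ⟶ pow I, s ≫ c = 0 ↔ ∃ s' : G ⟶ pow J, s' ≫ f = s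

namespace IsProgenerator

variable {G} {pow : Type u → C} {ι : ∀ {I : Type u}, I → (G ⟶ pow I)}

/-- Postcomposition as a linear map over the endomorphism ring. -/
def postcomp (G : C) {M N : C} (f : M ⟶ N) : (G ⟶ M) →ₗ[(End G)ᵐᵒᵖ] (G ⟶ N) :=
  ((preadditiveCoyonedaObj G).map f).hom

theorem linearIndependent (h : IsProgenerator G pow ι) (I : Type u) :
    LinearIndependent (End G)ᵐᵒᵖ (ι : I → (G ⟶ pow I)) := by
  classical
  refine linearIndependent_iff.2 fun l hl => Finsupp.ext fun i => ?_
  obtain ⟨π, hπ⟩ := h.exists_desc (fun j : I => if j = i then 𝟙 G else 0)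
  have hsum := congrArg (postcomp G π) hl
  rw [map_zero, Finsupp.apply_linearCombination, Finsupp.linearCombination_apply,
    Finsupp.sum_eq_single i] at hsum
  · have hi : (postcomp G π ∘ ι) i = 𝟙 G := (hπ i).trans (if_pos rfl)
    rw [hi] at hsum
    exact MulOpposite.unop_injective ((Category.comp_id (l i).unop).symm.trans hsum)
  · intro j _ hj
    have hij : (postcomp G π ∘ ι) j = 0 := (hπ j).trans (if_neg hj)
    rw [hij, smul_zero]
  · simp

/-- The coprojections as a basis of `Hom(G, G^(I))`. -/
noncomputable def basis (h : IsProgenerator G pow ι) (I : Type u) :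
    Module.Basis I (End G)ᵐᵒᵖ (G ⟶ pow I) :=
  Module.Basis.mk (h.linearIndependent I) (h.span_eq_top I).ge

@[simp]
theorem basis_apply (h : IsProgenerator G pow ι) {I : Type u} (i : I) : h.basis I i = ι i := by
  simp [basis]

theorem faithful (h : IsProgenerator G pow ι) : (preadditiveCoyonedaObj G).Faithful where
  map_injective {M N} f g hfg := by
    refine sub_eq_zero.1 (h.separates _ fun s => ?_)
    rw [Preadditive.comp_sub, sub_eq_zero]
    exact congrArg (fun φ => φ.hom s) hfg

theorem full (h : IsProgenerator G pow ι) : (preadditiveCoyonedaObj G).Full where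
  map_surjective {M N} φ := by
    obtain ⟨p, hp⟩ := h.exists_desc (fun s : G ⟶ M => s)
    obtain ⟨q, hq⟩ := h.exists_desc (fun s : G ⟶ M => φ.hom s)
    have hpq : postcomp G q = φ.hom ∘ₗ postcomp G p :=
      (h.basis _).ext fun s => by
        rw [basis_apply]
        exact (hq s).trans (congrArg φ.hom (hp s)).symm
    obtain ⟨r, hr⟩ := h.exists_factor p hp q fun s hs =>
      (LinearMap.congr_fun hpq s).trans ((congrArg φ.hom hs).trans (map_zero φ.hom))
    have hrφ : ∀ s : G ⟶ M, s ≫ r = φ.hom s := fun s => by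
      conv_lhs => rw [← hp s, Category.assoc, hr]
      exact hq s
    exact ⟨r, ModuleCat.hom_ext (LinearMap.ext hrφ)⟩

theorem essSurj (h : IsProgenerator G pow ι) : (preadditiveCoyonedaObj G).EssSurj where
  mem_essImage N := by
    let θ : (G ⟶ pow N) →ₗ[(End G)ᵐᵒᵖ] N := (h.basis N).constr ℕ (fun n : N => n)
    have hθ : ∀ n : N, θ (ι n) = n := fun n => by
      rw [← h.basis_apply, Module.Basis.constr_basis]
    obtain ⟨f, hf⟩ := h.exists_desc (fun s : LinearMap.ker θ => (s : G ⟶ pow N))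
    obtain ⟨D, c, hc, hcf⟩ := h.exists_coker f
    have hrange : LinearMap.range (postcomp G f) ≤ LinearMap.ker θ := by
      rw [LinearMap.range_eq_map, ← h.span_eq_top, Submodule.map_span_le]
      rintro _ ⟨s, rfl⟩
      exact (congrArg θ (hf s)).trans s.2
    have hker : LinearMap.ker (postcomp G c) = LinearMap.ker θ := by
      refine le_antisymm (fun s hs => ?_) fun s hs =>
        (hcf s).2 ⟨ι (⟨s, hs⟩ : LinearMap.ker θ), hf _⟩
      obtain ⟨s', rfl⟩ := (hcf s).1 hs
      exact hrange ⟨s', rfl⟩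
    exact ⟨D, ⟨(((postcomp G c).quotKerEquivOfSurjective hc).symm ≪≫ₗ
      Submodule.quotEquivOfEq _ _ hker ≪≫ₗ
      θ.quotKerEquivOfSurjective fun n => ⟨ι n, hθ n⟩).toModuleIso⟩⟩

theorem isModuleCategory (h : IsProgenerator G pow ι) : IsModuleCategory.{u} C :=
  have : (preadditiveCoyonedaObj G).IsEquivalence :=
    { faithful := h.faithful, full := h.full, essSurj := h.essSurj }
  ⟨(End G)ᵐᵒᵖ, inferInstance, ⟨(preadditiveCoyonedaObj G).asEquivalence⟩⟩

end IsProgenerator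

end Progenerator

namespace TorsionPair.TwoTerm

variable {R : Type u} [Ring R] {t : TorsionPair (ModuleCat.{u} R)}

/-! ### Replacing a map by a two-term complex -/

section OfMap

variable {A Z L : Type u} [AddCommGroup A] [Module R A] [AddCommGroup Z] [Module R Z]
  [AddCommGroup L] [Module R L]

/-- The pullback of two linear maps. -/
abbrev pullback (z : A →ₗ[R] Z) (c : L →ₗ[R] Z) : Submodule R (A × L) :=
  LinearMap.eqLocus (z ∘ₗ LinearMap.fst R A L) (c ∘ₗ LinearMap.snd R A L)

variable (z : A →ₗ[R] Z) (c : L →ₗ[R] Z)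

/-- The projection of the pullback to `L`, which is the differential of `ofMap`. -/
def ofMapD : pullback z c →ₗ[R] L := LinearMap.snd R A L ∘ₗ (pullback z c).subtype

variable {z c}

theorem isF_ker_ofMapD (hF : t.IsF (LinearMap.ker z)) : t.IsF (LinearMap.ker (ofMapD z c)) := by
  have hsnd : ∀ x : LinearMap.ker (ofMapD z c), x.1.1.2 = 0 := fun x => x.2
  refine hF.of_injective ((LinearMap.fst R A L ∘ₗ (pullback z c).subtype ∘ₗ
    (LinearMap.ker (ofMapD z c)).subtype).codRestrict _ fun x => ?_) fun x y hxy => ?_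
  · exact x.1.2.trans ((congrArg c (hsnd x)).trans (map_zero c))
  · exact Subtype.ext (Subtype.ext
      (Prod.ext (congrArg Subtype.val hxy) ((hsnd x).trans (hsnd y).symm)))

theorem isT_coker_ofMapD (hc : Function.Surjective ((LinearMap.range z).mkQ ∘ₗ c))
    (hT : t.IsT (Z ⧸ LinearMap.range z)) :
    t.IsT (L ⧸ LinearMap.range (ofMapD z c)) := by
  have hker : LinearMap.ker ((LinearMap.range z).mkQ ∘ₗ c) = LinearMap.range (ofMapD z c) := by
    ext l
    constructor
    · intro hl
      obtain ⟨a, ha⟩ := (Submodule.Quotient.mk_eq_zero _).1 (LinearMap.mem_ker.1 hl)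
      exact ⟨⟨(a, l), ha⟩, rfl⟩
    · rintro ⟨x, rfl⟩
      exact (Submodule.Quotient.mk_eq_zero _).2 ⟨_, x.2⟩
  exact hT.of_equiv
    ((LinearMap.quotKerEquivOfSurjective _ hc).symm ≪≫ₗ Submodule.quotEquivOfEq _ _ hker)

/-- The two-term complex quasi-isomorphic to `z : A → Z` obtained from a map `c : L → Z` from a
projective module which is surjective modulo the range of `z`. -/
abbrev ofMap [Module.Projective R L]
    (hc : Function.Surjective ((LinearMap.range z).mkQ ∘ₗ c)) (hF : t.IsF (LinearMap.ker z))
    (hT : t.IsT (Z ⧸ LinearMap.range z)) : t.TwoTerm where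
  A := pullback z c
  P := L
  d := ofMapD z c
  isF := isF_ker_ofMapD hF
  isT := isT_coker_ofMapD hc hT

end OfMap

/-! ### The vanishing of extensions -/

/-- The condition that `Hom(G, M[1])` vanishes in the derived category for every `M` in the heart:
if `M` is represented by a map `φ : B → C` in degrees `-1` and `0`, a morphism `G → M[1]` is
represented by a map `G.A → C`, and it vanishes if that map decomposes as below. -/
structure IsExtProjective (G : t.TwoTerm) : Prop where
  exists_homotopy {B C : Type u} [AddCommGroup B] [Module R B] [AddCommGroup C] [Module R C]
    (φ : B →ₗ[R] C) (hF : t.IsF (LinearMap.ker φ)) (hT : t.IsT (C ⧸ LinearMap.range φ))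
    (s : G.A →ₗ[R] C) :
    ∃ (g : G.A →ₗ[R] B) (k : G.P →ₗ[R] C), ∀ a, s a = φ (g a) + k (G.d a)

namespace IsExtProjective

variable {G : t.TwoTerm}

theorem of_extend_of_lift
    (extend : ∀ {T : Type u} [AddCommGroup T] [Module R T], t.IsT T → ∀ f : G.A →ₗ[R] T,
      ∃ g : G.P →ₗ[R] T, ∀ a, g (G.d a) = f a)
    (lift : ∀ {E K : Type u} [AddCommGroup E] [Module R E] [AddCommGroup K] [Module R K]
      (p : E →ₗ[R] K), t.IsF (LinearMap.ker p) → ∀ f : G.A →ₗ[R] K,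
        LinearMap.range f ≤ LinearMap.range p → ∃ g : G.A →ₗ[R] E, ∀ a, p (g a) = f a) :
    G.IsExtProjective := by
  refine ⟨fun φ hF hT s => ?_⟩
  obtain ⟨h, hh⟩ := extend hT ((LinearMap.range φ).mkQ ∘ₗ s)
  obtain ⟨k, hk⟩ := Module.projective_lifting_property (LinearMap.range φ).mkQ h
    (Submodule.mkQ_surjective _)
  have hrange : LinearMap.range (s - k ∘ₗ G.d) ≤ LinearMap.range φ := by
    rintro _ ⟨a, rfl⟩
    exact (Submodule.Quotient.eq _).1 ((hh a).symm.trans (LinearMap.congr_fun hk (G.d a)).symm)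
  obtain ⟨g, hg⟩ := lift φ hF _ hrange
  exact ⟨g, k, fun a => by simp [hg]⟩

theorem exists_extension (hG : G.IsExtProjective) {T : Type u} [AddCommGroup T] [Module R T]
    (hT : t.IsT T) (f : G.A →ₗ[R] T) : ∃ g : G.P →ₗ[R] T, ∀ a, g (G.d a) = f a := by
  obtain ⟨g, k, h⟩ := hG.exists_homotopy (0 : PUnit.{u + 1} →ₗ[R] T) isF_of_subsingleton
    (hT.of_surjective (Submodule.mkQ _) (Submodule.mkQ_surjective _)) f
  exact ⟨k, fun a => by simpa using (h a).symm⟩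

theorem exists_lift (hG : G.IsExtProjective) {E K : Type u} [AddCommGroup E] [Module R E]
    [AddCommGroup K] [Module R K] {p : E →ₗ[R] K} (hp : t.IsF (LinearMap.ker p)) {f : G.A →ₗ[R] K}
    (hf : LinearMap.range f ≤ LinearMap.range p) : ∃ g : G.A →ₗ[R] E, ∀ a, p (g a) = f a := by
  have hT : t.IsT (LinearMap.range p ⧸ LinearMap.range p.rangeRestrict) := by
    rw [LinearMap.range_rangeRestrict]
    exact isT_of_subsingleton
  obtain ⟨g, k, h⟩ := hG.exists_homotopy p.rangeRestrict
    ((LinearMap.ker_rangeRestrict p).symm ▸ hp) hT (f.codRestrict _ fun a => hf ⟨a, rfl⟩)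
  obtain ⟨k', hk'⟩ := Module.projective_lifting_property p.rangeRestrict k
    p.surjective_rangeRestrict
  refine ⟨g + k' ∘ₗ G.d, fun a => ?_⟩
  have hk : p (k' (G.d a)) = k (G.d a) := congrArg Subtype.val (LinearMap.congr_fun hk' (G.d a))
  exact (map_add p _ _).trans ((congrArg _ hk).trans (congrArg Subtype.val (h a)).symm)

section Coker

variable {M N : t.TwoTerm} {f₁ : M.A →ₗ[R] N.A} {f₀ : M.P →ₗ[R] N.P}
  (hf : ∀ a, N.d (f₁ a) = f₀ (M.d a))

theorem isF_ker_cokerInl : t.IsF (LinearMap.ker (cokerInl hf)) := by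
  have hle : LinearMap.ker (cokerInl hf) ≤ LinearMap.ker N.d := fun b hb => by
    rw [LinearMap.mem_ker] at hb ⊢
    rw [← coker_d_cokerInl hf, hb, map_zero]
  exact N.isF.of_injective _ (Submodule.inclusion_injective hle)

theorem isT_coker_cokerInl : t.IsT ((coker hf).A ⧸ LinearMap.range (cokerInl hf)) := by
  have hle : LinearMap.range M.d ≤
      LinearMap.ker ((LinearMap.range (cokerInl hf)).mkQ ∘ₗ cokerInr hf) := by
    rintro _ ⟨a, rfl⟩
    exact (Submodule.Quotient.mk_eq_zero _).2 ⟨-f₁ a, (map_neg _ _).trans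
      (neg_eq_of_add_eq_zero_right (cokerInl_apply_add_cokerInr_d hf a))⟩
  refine M.isT.of_surjective ((LinearMap.range M.d).liftQ _ hle) fun y => ?_
  obtain ⟨y, rfl⟩ := Submodule.mkQ_surjective _ y
  obtain ⟨⟨b, p⟩, rfl⟩ := Submodule.mkQ_surjective _ y
  refine ⟨Submodule.Quotient.mk p, (Submodule.Quotient.eq _).2 ⟨-b, ?_⟩⟩
  rw [map_neg, ← cokerInl_add_cokerInr, sub_add_cancel_right]

theorem exists_comp_toCoker (hG : G.IsExtProjective) (s : G ⟶ coker hf) :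
    ∃ s' : G ⟶ N, s' ≫ toCoker hf = s := by
  obtain ⟨s₁, s₀, hs, rfl⟩ := exists_homMk s
  obtain ⟨g, k, h⟩ := hG.exists_homotopy (cokerInl hf) (isF_ker_cokerInl hf)
    (isT_coker_cokerInl hf) s₁
  have hg : ∀ a, cokerInl hf (g a) = s₁ a - k (G.d a) := fun a => eq_sub_of_add_eq (h a).symm
  refine ⟨homMk g (s₀ - (coker hf).d ∘ₗ k) fun a => ?_, homMk_comp_eq_homMk_iff.2
    ⟨-k, fun a => (hg a).trans (sub_eq_add_neg _ _), fun p => ?_⟩⟩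
  · rw [← coker_d_cokerInl hf, hg, map_sub, hs]
    rfl
  · rw [LinearMap.neg_apply, map_neg, ← sub_eq_add_neg]
    rfl

/-- The map from `M.A` to the torsion cycles of the cone. -/
def toTorsionCycles : M.A →ₗ[R] torsionCycles hf :=
  (f₁.prod M.d).codRestrict _ (toConeZ_mem_torsionCycles hf)

theorem isF_ker_toTorsionCycles : t.IsF (LinearMap.ker (toTorsionCycles hf)) := by
  have hle : LinearMap.ker (toTorsionCycles hf) ≤ LinearMap.ker M.d := fun a ha =>
    congrArg (fun x : torsionCycles hf => x.1.2) (LinearMap.mem_ker.1 ha)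
  exact M.isF.of_injective _ (Submodule.inclusion_injective hle)

theorem isT_coker_toTorsionCycles :
    t.IsT (torsionCycles hf ⧸ LinearMap.range (toTorsionCycles hf)) := by
  let τ : torsionCycles hf →ₗ[R] t.torsion (coneH hf) :=
    ((LinearMap.range (toConeZ hf)).mkQ ∘ₗ Submodule.inclusion (torsionCycles_le hf)).codRestrict _
      fun x => ((mem_torsionCycles hf).1 x.2).2
  have hτ : Function.Surjective τ := by
    rintro ⟨z, hz⟩
    obtain ⟨z, rfl⟩ := Submodule.mkQ_surjective _ z
    exact ⟨⟨z, (mem_torsionCycles hf).2 ⟨z.2, hz⟩⟩, rfl⟩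
  have hker : LinearMap.ker τ = LinearMap.range (toTorsionCycles hf) := by
    ext x
    rw [LinearMap.mem_ker, ← Subtype.coe_inj]
    exact (Submodule.Quotient.mk_eq_zero _).trans (exists_congr fun a =>
      Subtype.ext_iff.trans (Subtype.ext_iff (a1 := toTorsionCycles hf a) (a2 := x)).symm)
  exact isT_torsion.of_equiv
    ((τ.quotKerEquivOfSurjective hτ).symm ≪≫ₗ Submodule.quotEquivOfEq _ _ hker)

theorem exists_comp_of_comp_toCoker (hG : G.IsExtProjective) (s : G ⟶ N)
    (h : s ≫ toCoker hf = 0) : ∃ s' : G ⟶ M, s' ≫ homMk f₁ f₀ hf = s := by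
  obtain ⟨s₁, s₀, hs, rfl⟩ := exists_homMk s
  obtain ⟨k, hk₁, hk₀⟩ := homMk_comp_eq_zero_iff.1 h
  obtain ⟨l, hl⟩ := Module.projective_lifting_property (torsionCycles hf).mkQ k
    (Submodule.mkQ_surjective _)
  replace hl : ∀ p, (torsionCycles hf).mkQ (l p) = k p := LinearMap.congr_fun hl
  obtain ⟨g, m, hgm⟩ := hG.exists_homotopy (toTorsionCycles hf) (isF_ker_toTorsionCycles hf)
    (isT_coker_toTorsionCycles hf) ((LinearMap.inl R _ _ ∘ₗ s₁ - l ∘ₗ G.d).codRestrict _ fun a =>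
      (Submodule.Quotient.eq _).1 ((hk₁ a).trans (hl (G.d a)).symm))
  let n : G.P →ₗ[R] N.A × M.P := l + Submodule.subtype _ ∘ₗ m
  have hn : ∀ a, (s₁ a, 0) = (f₁ (g a), M.d (g a)) + n (G.d a) := fun a =>
    (sub_eq_iff_eq_add'.1 (congrArg Subtype.val (hgm a))).trans (add_left_comm _ _ _)
  have hnk : ∀ p, (torsionCycles hf).mkQ (n p) = k p := fun p => by
    have hm : (torsionCycles hf).mkQ (m p) = 0 := (Submodule.Quotient.mk_eq_zero _).2 (m p).2
    exact (map_add _ (l p) (m p : N.A × M.P)).trans (by rw [hl, hm, add_zero])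
  have hn₀ : ∀ p, s₀ p = N.d (n p).1 - f₀ (n p).2 := fun p => by
    rw [← coneD_apply, ← coker_d_mkQ hf, hnk]
    exact hk₀ p
  refine ⟨homMk g (-(LinearMap.snd R _ _ ∘ₗ n)) fun a => ?_, homMk_comp_eq_homMk_iff.2
    ⟨-(LinearMap.fst R _ _ ∘ₗ n), fun a => ?_, fun p => ?_⟩⟩
  · exact eq_neg_of_add_eq_zero_left (congrArg Prod.snd (hn a)).symm
  · exact eq_add_neg_of_add_eq (congrArg Prod.fst (hn a)).symm
  · simp [hn₀, sub_eq_add_neg]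

end Coker

end IsExtProjective

end TorsionPair.TwoTerm

namespace TorsionPair.TwoTerm

variable {R : Type u} [Ring R] {t : TorsionPair (ModuleCat.{u} R)}

/-! ### An epimorphism is the cokernel of its kernel -/

namespace IsConeEpi

variable {M N X : t.TwoTerm} {f₁ : M.A →ₗ[R] N.A} {f₀ : M.P →ₗ[R] N.P}
  {hf : ∀ a, N.d (f₁ a) = f₀ (M.d a)} {u₁ : M.A →ₗ[R] X.A} {u₀ : M.P →ₗ[R] X.P}
  {hu : ∀ a, X.d (u₁ a) = u₀ (M.d a)}

theorem isF_ker_toConeZ : t.IsF (LinearMap.ker (toConeZ hf)) := by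
  have hle : LinearMap.ker (toConeZ hf) ≤ LinearMap.ker M.d := fun a ha =>
    congrArg (fun z : LinearMap.ker (coneD N f₀) => z.1.2) (LinearMap.mem_ker.1 ha)
  exact M.isF.of_injective _ (Submodule.inclusion_injective hle)

/-- The kernel in the heart of an epimorphism: the cone, truncated to its cycles and shifted. -/
noncomputable abbrev kernel (h : IsConeEpi hf) : t.TwoTerm :=
  ofMap (c := Finsupp.linearCombination R (id : LinearMap.ker (coneD N f₀) → _))
    ((Submodule.mkQ_surjective _).comp (Finsupp.linearCombination_id_surjective R _))
    isF_ker_toConeZ h.isT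

/-- The inclusion of the kernel. -/
noncomputable def kernelι (h : IsConeEpi hf) : h.kernel ⟶ M :=
  homMk (M := h.kernel) (LinearMap.fst R _ _ ∘ₗ (pullback _ _).subtype)
    (LinearMap.snd R _ _ ∘ₗ (LinearMap.ker (coneD N f₀)).subtype ∘ₗ
      Finsupp.linearCombination R id) fun x => congrArg (fun z => z.1.2) x.2

theorem kernelι_comp (h : IsConeEpi hf) : h.kernelι ≫ homMk f₁ f₀ hf = 0 :=
  homMk_comp_eq_zero_iff.2 ⟨LinearMap.fst R _ _ ∘ₗ (LinearMap.ker (coneD N f₀)).subtype ∘ₗ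
    Finsupp.linearCombination R id, fun x => congrArg (fun z => z.1.1) x.2, fun l =>
      (sub_eq_zero.1 ((coneD_apply f₀ _).symm.trans (Finsupp.linearCombination R id l).2)).symm⟩

theorem exists_cycles_hom_of_kernelι_comp_eq_zero (h : IsConeEpi hf)
    (hfu : h.kernelι ≫ homMk u₁ u₀ hu = 0) :
    ∃ w : LinearMap.ker (coneD N f₀) →ₗ[R] X.A,
      (∀ a, u₁ a = w (toConeZ hf a)) ∧ ∀ z, u₀ z.1.2 = X.d (w z) := by
  obtain ⟨v, hv₁, hv₀⟩ := homMk_comp_eq_zero_iff.1 hfu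
  have hc := Finsupp.linearCombination_id_surjective R (LinearMap.ker (coneD N f₀))
  obtain ⟨w, hw⟩ := exists_linearMap_comp_eq_of_ker_le hc (f := v) fun l hl =>
    (hv₁ ⟨(0, l), (map_zero (toConeZ hf)).trans (LinearMap.mem_ker.1 hl).symm⟩).symm.trans
      (map_zero u₁)
  refine ⟨w, fun a => ?_, fun z => ?_⟩
  · obtain ⟨l, hl⟩ := hc (toConeZ hf a)
    rw [← hl, hw]
    exact hv₁ ⟨(a, l), hl.symm⟩
  · obtain ⟨l, rfl⟩ := hc z
    rw [hw]
    exact hv₀ l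

theorem exists_comp_eq_of_cycles_hom (h : IsConeEpi hf)
    (w : LinearMap.ker (coneD N f₀) →ₗ[R] X.A) (hw₁ : ∀ a, u₁ a = w (toConeZ hf a))
    (hw₀ : ∀ z, u₀ z.1.2 = X.d (w z)) : ∃ r : N ⟶ X, homMk f₁ f₀ hf ≫ r = homMk u₁ u₀ hu := by
  obtain ⟨v, hv⟩ := exists_extension_of_projective h.surjective w
  obtain ⟨v₀, hv₀⟩ := exists_linearMap_comp_eq_of_ker_le h.surjective
    (f := X.d ∘ₗ v - u₀ ∘ₗ LinearMap.snd R N.A M.P) fun z hz => LinearMap.mem_ker.2 <|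
      sub_eq_zero.2 ((congrArg X.d (hv ⟨z, hz⟩)).trans (hw₀ ⟨z, hz⟩).symm)
  have hvd : ∀ a, u₁ a = v (f₁ a, 0) + v (0, M.d a) := fun a => by
    rw [← map_add, Prod.mk_add_mk, add_zero, zero_add, hw₁]
    exact (hv (toConeZ hf a)).symm
  refine ⟨homMk (v ∘ₗ LinearMap.inl R _ _) v₀ fun b => ?_, homMk_comp_eq_homMk_iff.2
    ⟨-(v ∘ₗ LinearMap.inr R _ _), fun a => ?_, fun p => ?_⟩⟩
  · simpa [coneD_apply] using (hv₀ (b, 0)).symm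
  · simp [hvd]
  · have hp := hv₀ (0, p)
    simp only [coneD_apply, map_zero, zero_sub, map_neg] at hp
    simp [neg_eq_iff_eq_neg.1 hp, sub_eq_add_neg]

theorem exists_comp_eq (h : IsConeEpi hf) {u : M ⟶ X} (hu : h.kernelι ≫ u = 0) :
    ∃ r : N ⟶ X, homMk f₁ f₀ hf ≫ r = u := by
  obtain ⟨u₁, u₀, hu', rfl⟩ := exists_homMk u
  obtain ⟨w, hw₁, hw₀⟩ := h.exists_cycles_hom_of_kernelι_comp_eq_zero hu
  exact h.exists_comp_eq_of_cycles_hom w hw₁ hw₀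

end IsConeEpi

end TorsionPair.TwoTerm

/-! ### Tilting objects -/

theorem exists_finset_support_subset {R A B I : Type*} [Ring R] [AddCommGroup A]
    [Module R A] [AddCommGroup B] [Module R B] [Module.Finite R A] (f : A →ₗ[R] I →₀ B) :
    ∃ S : Finset I, ∀ a, (f a).support ⊆ S := by
  classical
  obtain ⟨s, hs⟩ := (Module.Finite.fg_top : (⊤ : Submodule R A).FG)
  refine ⟨s.biUnion fun a => (f a).support, fun a => ?_⟩
  have h : (⊤ : Submodule R A) ≤
      (Finsupp.supported B R (s.biUnion fun a => (f a).support : Set I)).comap f := by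
    rw [← hs, Submodule.span_le]
    exact fun a ha => (Finsupp.mem_supported R _).2 fun i hi => Finset.mem_biUnion.2 ⟨a, ha, hi⟩
  exact_mod_cast (Finsupp.mem_supported R _).1 (h (Submodule.mem_top (x := a)))

namespace TorsionPair

variable {R : Type u} [Ring R] {t : TorsionPair (ModuleCat.{u} R)}

section KerExtOne

variable {F T V : Type u} [AddCommGroup F] [Module R F] [AddCommGroup T] [Module R T]
  [AddCommGroup V] [Module R V]

theorem IsF.kerExtOne_of_surjective (hF : t.IsF F)
    (h : KerExtOne (ModuleCat.of R V) (ModuleCat.of R F)) {J : Type u} {p : (J →₀ V) →ₗ[R] T}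
    (hp : Function.Surjective p) (hpT : t.IsT (LinearMap.ker p)) :
    KerExtOne (ModuleCat.of R T) (ModuleCat.of R F) := by
  refine kerExtOne_of_forall_split fun E _ _ i q hi hiq hq => ?_
  choose σ hσ using fun a : J => h.exists_lift hi hiq hq (p ∘ₗ Finsupp.lsingle a)
  have hs : q ∘ₗ Finsupp.lsum ℕ σ = p := Finsupp.lhom_ext fun a v => by simpa using hσ a v
  replace hs : ∀ y, q (Finsupp.lsum ℕ σ y) = p y := LinearMap.congr_fun hs
  obtain ⟨g, hg⟩ := exists_linearMap_comp_eq_of_range_le hi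
    (f := Finsupp.lsum ℕ σ ∘ₗ (LinearMap.ker p).subtype) <| by
      rintro _ ⟨y, rfl⟩
      exact (hiq _).1 ((hs y).trans y.2)
  obtain ⟨s, hs'⟩ := exists_linearMap_comp_eq_of_ker_le hp (f := Finsupp.lsum ℕ σ) fun y hy =>
    (hg ⟨y, hy⟩).symm.trans (by rw [hpT.apply_eq_zero hF g, map_zero])
  refine ⟨s, fun v => ?_⟩
  obtain ⟨y, rfl⟩ := hp v
  rw [hs', hs]

theorem IsT.apply_eq_zero_of_kerExtOne (hT : t.IsT T) (hF : t.IsF F) {j : V →ₗ[R] T}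
    (h : KerExtOne (ModuleCat.of R (T ⧸ LinearMap.range j)) (ModuleCat.of R F))
    {φ : V →ₗ[R] F} (hφ : LinearMap.ker j ≤ LinearMap.ker φ) (v : V) : φ v = 0 := by
  obtain ⟨φ', hφ'⟩ := exists_linearMap_comp_eq_of_ker_le (f := φ) j.surjective_rangeRestrict
    (j.ker_rangeRestrict.trans_le hφ)
  obtain ⟨g, hg⟩ := h.exists_extension (LinearMap.range j).injective_subtype
    (LinearMap.exact_subtype_mkQ _) (Submodule.mkQ_surjective _) φ'
  rw [← hφ', ← hg, hT.apply_eq_zero hF]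

end KerExtOne

namespace TwoTerm

theorem kerExtOne_coker (G : t.TwoTerm) {F : Type u} [AddCommGroup F] [Module R F]
    (h : ∀ f : G.A →ₗ[R] F, ∃ g : G.P →ₗ[R] F, ∀ a, g (G.d a) = f a) :
    KerExtOne (ModuleCat.of R (G.P ⧸ LinearMap.range G.d)) (ModuleCat.of R F) := by
  refine kerExtOne_of_projective (LinearMap.range G.d).injective_subtype
    (LinearMap.exact_subtype_mkQ _) (Submodule.mkQ_surjective _) fun f => ?_
  obtain ⟨g, hg⟩ := h (f ∘ₗ G.d.rangeRestrict)
  refine ⟨g, ?_⟩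
  rintro ⟨_, a, rfl⟩
  exact hg a

theorem sum_homMk {M N : t.TwoTerm} {I : Type*} (S : Finset I) (f₁ : I → M.A →ₗ[R] N.A)
    (f₀ : I → M.P →ₗ[R] N.P) (hf : ∀ i a, N.d (f₁ i a) = f₀ i (M.d a)) :
    ∑ i ∈ S, homMk (f₁ i) (f₀ i) (hf i) =
      homMk (∑ i ∈ S, f₁ i) (∑ i ∈ S, f₀ i) (fun a => by simp [hf]) := by
  classical
  induction S using Finset.induction_on with
  | empty => rfl
  | insert i S hi ih => simp only [Finset.sum_insert hi, ih, homMk_add_homMk]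

theorem mem_span_ι (G : t.TwoTerm) [Module.Finite R G.A] [Module.Finite R G.P] {I : Type u}
    (s : G ⟶ G.pow I) :
    s ∈ Submodule.span (End G)ᵐᵒᵖ (Set.range (G.ι : I → (G ⟶ G.pow I))) := by
  classical
  obtain ⟨s₁, s₀, hs, rfl⟩ := exists_homMk s
  obtain ⟨S₁, hS₁⟩ := exists_finset_support_subset s₁
  obtain ⟨S₀, hS₀⟩ := exists_finset_support_subset s₀
  let e (i : I) : End G := homMk (M := G) (N := G) (Finsupp.lapply i ∘ₗ s₁)
    (Finsupp.lapply i ∘ₗ s₀) fun a => DFunLike.congr_fun (hs a) i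
  have hsum : ∑ i ∈ S₁ ∪ S₀, MulOpposite.op (e i) • G.ι i = homMk s₁ s₀ hs := by
    refine (sum_homMk (N := G.pow I) _ (fun i => Finsupp.lsingle i ∘ₗ Finsupp.lapply i ∘ₗ s₁)
      (fun i => Finsupp.lsingle i ∘ₗ Finsupp.lapply i ∘ₗ s₀) fun i a => ?_).trans ?_
    · exact (Finsupp.mapRange_single (hf := map_zero G.d)).trans
        (congrArg _ (DFunLike.congr_fun (hs a) i))
    · congr 1 <;> refine LinearMap.ext fun x => (LinearMap.sum_apply _ _ _).trans ?_
      · exact (Finsupp.sum_of_support_subset _ ((hS₁ x).trans Finset.subset_union_left)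
          Finsupp.single (by simp)).symm.trans (Finsupp.sum_single _)
      · exact (Finsupp.sum_of_support_subset _ ((hS₀ x).trans Finset.subset_union_right)
          Finsupp.single (by simp)).symm.trans (Finsupp.sum_single _)
  rw [← hsum]
  exact Submodule.sum_mem _ fun i _ => Submodule.smul_mem _ (MulOpposite.op (e i))
    (Submodule.subset_span ⟨i, rfl⟩)

/-- The conditions on a complex `G.A ⟶ G.P` which make it a small projective generator of the
heart. The fields `finite_A` and `finite_P` give smallness, while `pres` and `sub`, the analogues
of conditions 1 and 5 of the theorem, make `G` a generator. -/
structure IsTilting (G : t.TwoTerm) : Prop where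
  isExtProjective : G.IsExtProjective
  pres {T : Type u} [AddCommGroup T] [Module R T] (hT : t.IsT T) :
    ∃ (I : Type u) (p : (I →₀ G.P ⧸ LinearMap.range G.d) →ₗ[R] T), Function.Surjective p ∧
      t.IsT (LinearMap.ker p)
  finite_A : Module.Finite R G.A
  finite_P : Module.Finite R G.P
  sub : ∃ (I : Type u) (h : (I →₀ G.A) →ₗ[R] R ⧸ t.torsion R) (T : Type u) (_ : AddCommGroup T)
    (_ : Module R T) (j : (R ⧸ t.torsion R) →ₗ[R] T), t.IsT T ∧
      ∀ r, j r = 0 → ∃ x, (∀ i, G.d (x i) = 0) ∧ h x = r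

namespace IsTilting

variable {G : t.TwoTerm}

theorem kerExtOne (hG : G.IsTilting) {F T : Type u} [AddCommGroup F] [Module R F]
    [AddCommGroup T] [Module R T] (hF : t.IsF F) (hT : t.IsT T)
    (h : ∀ f : G.A →ₗ[R] F, ∃ g : G.P →ₗ[R] F, ∀ a, g (G.d a) = f a) :
    KerExtOne (ModuleCat.of R T) (ModuleCat.of R F) := by
  obtain ⟨J, p, hp, hpT⟩ := hG.pres hT
  exact hF.kerExtOne_of_surjective (G.kerExtOne_coker h) hp hpT

theorem eq_zero_of_exists_extension (hG : G.IsTilting)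
    {F : Type u} [AddCommGroup F] [Module R F] (hF : t.IsF F)
    (h : ∀ f : G.A →ₗ[R] F, ∃ g : G.P →ₗ[R] F, ∀ a, g (G.d a) = f a) (x : F) : x = 0 := by
  have hx : t.torsion R ≤ LinearMap.ker (LinearMap.toSpanSingleton R F x) := fun r hr =>
    isT_torsion.apply_eq_zero hF (LinearMap.toSpanSingleton R F x ∘ₗ Submodule.subtype _) ⟨r, hr⟩
  let φ := (t.torsion R).liftQ _ hx
  obtain ⟨I, h', T, _, _, j, hT, hj⟩ := hG.sub
  have hφj : LinearMap.ker j ≤ LinearMap.ker φ := by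
    intro r hr
    obtain ⟨y, hy, rfl⟩ := hj r hr
    choose g hg using fun i => h (φ ∘ₗ h' ∘ₗ Finsupp.lsingle i)
    have hφg : φ ∘ₗ h' = Finsupp.lsum ℕ g ∘ₗ Finsupp.mapRange.linearMap G.d :=
      Finsupp.lhom_ext fun i a => by simpa using (hg i a).symm
    have hy' : Finsupp.mapRange.linearMap G.d y = 0 := Finsupp.ext hy
    exact (LinearMap.congr_fun hφg y).trans (by rw [LinearMap.comp_apply, hy', map_zero])
  have hφ := hT.apply_eq_zero_of_kerExtOne hF
    (hG.kerExtOne hF (hT.of_surjective _ (Submodule.mkQ_surjective _)) h) hφj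
  simpa [φ] using hφ (Submodule.Quotient.mk 1)

theorem surjective_d (hG : G.IsTilting) {C : t.TwoTerm} (h : ∀ s : G ⟶ C, s = 0) :
    Function.Surjective C.d := by
  have hu (u : (G.P ⧸ LinearMap.range G.d) →ₗ[R] C.P ⧸ LinearMap.range C.d) : u = 0 := by
    obtain ⟨u₀, hu₀⟩ := exists_projective_lift (p := (LinearMap.range C.d).mkQ)
      (f := u ∘ₗ Submodule.mkQ _) (by simp)
    obtain ⟨g, hg⟩ := hG.isExtProjective.exists_lift (p := C.d) C.isF (f := u₀ ∘ₗ G.d) <| by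
      rintro _ ⟨a, rfl⟩
      rw [← Submodule.ker_mkQ (LinearMap.range C.d), LinearMap.mem_ker, LinearMap.comp_apply, hu₀,
        LinearMap.comp_apply, Submodule.mkQ_apply,
        (Submodule.Quotient.mk_eq_zero _).2 (LinearMap.mem_range_self G.d a), map_zero]
    obtain ⟨k, -, hk⟩ := (homMk_eq_zero_iff _).1 (h (homMk g u₀ hg))
    refine Submodule.linearMap_qext _ (LinearMap.ext fun p => (hu₀ p).symm.trans ?_)
    rw [hk]
    exact (Submodule.Quotient.mk_eq_zero _).2 ⟨_, rfl⟩
  obtain ⟨I, p, hp, -⟩ := hG.pres C.isT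
  have hp0 : p = 0 := Finsupp.lhom_ext fun i => LinearMap.congr_fun (hu (p ∘ₗ Finsupp.lsingle i))
  intro y
  obtain ⟨z, hz⟩ := hp (Submodule.Quotient.mk y)
  rw [hp0] at hz
  exact (Submodule.Quotient.mk_eq_zero _).1 hz.symm

theorem injective_d (hG : G.IsTilting) {C : t.TwoTerm} (h : ∀ s : G ⟶ C, s = 0) :
    Function.Injective C.d := by
  refine (injective_iff_map_eq_zero _).2 fun x hx =>
    congrArg Subtype.val (hG.eq_zero_of_exists_extension C.isF (fun f => ?_) ⟨x, hx⟩)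
  obtain ⟨k, hk₁, hk₀⟩ := (homMk_eq_zero_iff _).1
    (h (homMk (Submodule.subtype _ ∘ₗ f) 0 fun a => LinearMap.mem_ker.1 (f a).2))
  exact ⟨k.codRestrict _ fun p => (hk₀ p).symm, fun a => Subtype.ext (hk₁ a).symm⟩

theorem id_eq_zero (hG : G.IsTilting) {C : t.TwoTerm} (h : ∀ s : G ⟶ C, s = 0) : 𝟙 C = 0 := by
  let e := LinearEquiv.ofBijective C.d ⟨hG.injective_d h, hG.surjective_d h⟩
  exact (homMk_eq_zero_iff (fun _ => rfl)).2
    ⟨e.symm, fun a => (e.symm_apply_apply a).symm, fun p => (e.apply_symm_apply p).symm⟩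

theorem isConeEpi (hG : G.IsTilting) {M N : t.TwoTerm} {f₁ : M.A →ₗ[R] N.A} {f₀ : M.P →ₗ[R] N.P}
    {hf : ∀ a, N.d (f₁ a) = f₀ (M.d a)} (h : ∀ s : G ⟶ N, ∃ s', s' ≫ homMk f₁ f₀ hf = s) :
    IsConeEpi hf := by
  refine isConeEpi_of_toCoker_eq_zero ?_
  rw [← Category.comp_id (toCoker hf), hG.id_eq_zero, Limits.comp_zero]
  intro s
  obtain ⟨s, rfl⟩ := hG.isExtProjective.exists_comp_toCoker hf s
  obtain ⟨s, rfl⟩ := h s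
  rw [Category.assoc, homMk_comp_toCoker, Limits.comp_zero]

theorem separates (hG : G.IsTilting)
    {M N : t.TwoTerm} (f : M ⟶ N) (h : ∀ s : G ⟶ M, s ≫ f = 0) : f = 0 := by
  obtain ⟨p, hp⟩ := exists_pow_desc (fun s : G ⟶ M => s)
  obtain ⟨p₁, p₀, hp', rfl⟩ := exists_homMk p
  have := (hG.isConeEpi fun s => ⟨_, hp s⟩).epi
  rw [← cancel_epi (homMk p₁ p₀ hp'), Limits.comp_zero]
  refine pow_hom_ext fun s => ?_
  rw [← Category.assoc, hp, h, Limits.comp_zero]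

theorem exists_factor (hG : G.IsTilting) {M N X : t.TwoTerm} {f : M ⟶ N}
    (h : ∀ s : G ⟶ N, ∃ s', s' ≫ f = s) (u : M ⟶ X)
    (hu : ∀ s : G ⟶ M, s ≫ f = 0 → s ≫ u = 0) : ∃ r : N ⟶ X, f ≫ r = u := by
  obtain ⟨f₁, f₀, hf, rfl⟩ := exists_homMk f
  have hf' := hG.isConeEpi h
  refine hf'.exists_comp_eq (hG.separates _ fun s => ?_)
  rw [← Category.assoc]
  exact hu _ (by rw [Category.assoc, hf'.kernelι_comp, Limits.comp_zero])

theorem isProgenerator (hG : G.IsTilting) : IsProgenerator G G.pow G.ι where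
  exists_desc := exists_pow_desc
  span_eq_top I :=
    have := hG.finite_A
    have := hG.finite_P
    eq_top_iff.2 fun s _ => G.mem_span_ι s
  separates := hG.separates
  exists_factor p hp q hq := hG.exists_factor (fun s => ⟨_, hp s⟩) q hq
  exists_coker f := by
    obtain ⟨f₁, f₀, hf, rfl⟩ := exists_homMk f
    refine ⟨coker hf, toCoker hf, hG.isExtProjective.exists_comp_toCoker hf, fun s =>
      ⟨hG.isExtProjective.exists_comp_of_comp_toCoker hf s, ?_⟩⟩
    rintro ⟨s, rfl⟩
    rw [Category.assoc, homMk_comp_toCoker, Limits.comp_zero]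

end IsTilting

end TwoTerm

end TorsionPair

/-! ### Tilting complexes -/

theorem pres_self {R : Type u} [Ring R] (V : ModuleCat.{u} R) : Pres V V := by
  refine ⟨PUnit, PUnit, 0, (Finsupp.uniqueLinearEquiv R V PUnit.unit).toLinearMap, fun x => ?_,
    (Finsupp.uniqueLinearEquiv R V PUnit.unit).surjective⟩
  simp only [LinearEquiv.coe_coe, LinearEquiv.map_eq_zero_iff, Set.mem_range,
    LinearMap.zero_apply, exists_const]
  exact eq_comm

namespace ThreeTermComplex

variable {R : Type u} [Ring R] (G : ThreeTermComplex R)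

/-- The map `Q / X → P` induced by the differential. -/
def quotD : (G.Q ⧸ LinearMap.range G.j) →ₗ[R] G.P :=
  (LinearMap.range G.j).liftQ G.d (LinearMap.range_le_ker_iff.2 G.d_comp_j)

theorem range_quotD : LinearMap.range G.quotD = LinearMap.range G.d :=
  Submodule.range_liftQ _ _ _

theorem ker_quotD : LinearMap.ker G.quotD = G.HNegOne :=
  Submodule.ker_liftQ _ _ _

end ThreeTermComplex

namespace TorsionPair

variable {R : Type u} [Ring R] {t : TorsionPair (ModuleCat.{u} R)}

/-- Conditions 1 to 5 of the theorem on a complex `X → Q → P`, without the projectivity of `Q` and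
the injectivity of `X → Q`. -/
structure IsTiltingComplex (t : TorsionPair (ModuleCat.{u} R)) (G : ThreeTermComplex R) :
    Prop where
  eq_pres : t.T = Pres G.H0
  pres_le : Pres G.H0 ≤ KerExtOne G.H0
  finite_Q : Module.Finite R G.Q
  finite_P : Module.Finite R G.P
  projective_P : Module.Projective R G.P
  isF : t.F (ModuleCat.of R G.HNegOne)
  le_reject : G.HNegOne ≤ reject t.T (G.Q ⧸ LinearMap.range G.j)
  le_kerExtOne : t.F ≤ KerExtOne G.cokerJ
  exists_subGen : ∃ (I : Type u) (h : (I →₀ G.Q ⧸ LinearMap.range G.j) →ₗ[R] R ⧸ t.torsion R),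
    SubGen G.H0
      (ModuleCat.of R ((R ⧸ t.torsion R) ⧸ LinearMap.range (h ∘ₗ G.HNegOneIncl I)))

namespace IsTiltingComplex

variable {G : ThreeTermComplex R}

theorem isT_H0 (h : t.IsTiltingComplex G) : t.IsT (G.P ⧸ LinearMap.range G.d) := by
  change t.T G.H0
  rw [h.eq_pres]
  exact pres_self _

/-- The two-term complex `Q / X → P`. -/
abbrev toTwoTerm (h : t.IsTiltingComplex G) : t.TwoTerm where
  A := G.Q ⧸ LinearMap.range G.j
  P := G.P
  d := G.quotD
  projective := h.projective_P
  isF := by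
    rw [G.ker_quotD]
    exact h.isF
  isT := by
    rw [G.range_quotD]
    exact h.isT_H0

theorem exists_extension (h : t.IsTiltingComplex G) {T : Type u} [AddCommGroup T] [Module R T]
    (hT : t.IsT T) (f : (G.Q ⧸ LinearMap.range G.j) →ₗ[R] T) :
    ∃ g : G.P →ₗ[R] T, ∀ a, g (G.quotD a) = f a := by
  have hker : LinearMap.ker G.quotD.rangeRestrict ≤ LinearMap.ker f := by
    rw [LinearMap.ker_rangeRestrict, G.ker_quotD]
    exact h.le_reject.trans
      ((iInf_le _ (ModuleCat.of R T)).trans ((iInf_le _ hT).trans (iInf_le _ f)))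
  obtain ⟨g, hg⟩ := exists_linearMap_comp_eq_of_ker_le G.quotD.surjective_rangeRestrict hker
  have hext : KerExtOne (ModuleCat.of R (G.P ⧸ LinearMap.range G.quotD)) (ModuleCat.of R T) := by
    rw [G.range_quotD]
    exact h.pres_le _ (h.eq_pres ▸ hT)
  obtain ⟨g', hg'⟩ := hext.exists_extension (Submodule.subtype_injective _)
    (LinearMap.exact_subtype_mkQ _) (Submodule.mkQ_surjective _) g
  exact ⟨g', fun a => (hg' (G.quotD.rangeRestrict a)).trans (hg a)⟩

theorem exists_lift (h : t.IsTiltingComplex G) {E K : Type u} [AddCommGroup E] [Module R E]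
    [AddCommGroup K] [Module R K] (p : E →ₗ[R] K) (hp : t.IsF (LinearMap.ker p))
    (f : (G.Q ⧸ LinearMap.range G.j) →ₗ[R] K) (hf : LinearMap.range f ≤ LinearMap.range p) :
    ∃ g : (G.Q ⧸ LinearMap.range G.j) →ₗ[R] E, ∀ a, p (g a) = f a := by
  have hext : KerExtOne G.cokerJ (ModuleCat.of R (LinearMap.ker p)) := h.le_kerExtOne _ hp
  have hexact : Function.Exact (LinearMap.ker p).subtype p.rangeRestrict := fun x => by
    rw [← LinearMap.mem_ker, LinearMap.ker_rangeRestrict]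
    simp
  obtain ⟨g, hg⟩ := hext.exists_lift (Submodule.subtype_injective _) hexact
    p.surjective_rangeRestrict (f.codRestrict _ fun a => hf ⟨a, rfl⟩)
  exact ⟨g, fun a => congrArg Subtype.val (hg a)⟩

theorem exists_presentation (h : t.IsTiltingComplex G) {T : Type u} [AddCommGroup T] [Module R T]
    (hT : t.IsT T) : ∃ (I : Type u) (p : (I →₀ G.P ⧸ LinearMap.range G.quotD) →ₗ[R] T),
      Function.Surjective p ∧ t.IsT (LinearMap.ker p) := by
  rw [G.range_quotD]
  have hpres : t.T (ModuleCat.of R T) := hT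
  rw [h.eq_pres] at hpres
  obtain ⟨I, J, f, p, hfp, hp⟩ := hpres
  refine ⟨I, p, hp, (h.isT_H0.finsupp J).of_surjective
    (f.codRestrict _ fun x => hfp.apply_apply_eq_zero x) ?_⟩
  rintro ⟨x, hx⟩
  obtain ⟨y, hy⟩ := (hfp x).1 hx
  exact ⟨y, Subtype.ext hy⟩

theorem isTilting (h : t.IsTiltingComplex G) : h.toTwoTerm.IsTilting where
  isExtProjective := .of_extend_of_lift h.exists_extension h.exists_lift
  pres := h.exists_presentation
  finite_A := have := h.finite_Q; inferInstanceAs (Module.Finite R (G.Q ⧸ LinearMap.range G.j))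
  finite_P := h.finite_P
  sub := by
    obtain ⟨I, g, N, i, ⟨J, p, hp⟩, hi⟩ := h.exists_subGen
    refine ⟨I, g, N, inferInstance, inferInstance, i ∘ₗ Submodule.mkQ _,
      (h.isT_H0.finsupp J).of_surjective p hp, fun r hr => ?_⟩
    obtain ⟨x, hx⟩ := (Submodule.Quotient.mk_eq_zero _).1 (hi (hr.trans (map_zero i).symm))
    refine ⟨G.HNegOneIncl I x, fun a => ?_, hx⟩
    change _ ∈ LinearMap.ker G.quotD
    rw [G.ker_quotD]
    exact (x a).2

end IsTiltingComplex

end TorsionPair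

/-! ### The colimit of a directed system of quotients -/

open scoped Classical in
/-- The embedding of a direct sum in a power of itself which puts each summand in its own copy. -/
noncomputable def directSumToFinsupp (R : Type*) {I : Type*} [Ring R] [DecidableEq I]
    (M : I → Type*) [∀ i, AddCommGroup (M i)] [∀ i, Module R (M i)] :
    DirectSum I M →ₗ[R] (I →₀ DirectSum I M) :=
  (finsuppLequivDFinsupp R).symm.toLinearMap ∘ₗ
    DFinsupp.mapRange.linearMap fun i => DirectSum.lof R I M i

theorem directSumToFinsupp_apply {R I : Type*} [Ring R] [DecidableEq I] {M : I → Type*}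
    [∀ i, AddCommGroup (M i)] [∀ i, Module R (M i)] (x : DirectSum I M) (i : I) :
    directSumToFinsupp R M x i = DirectSum.lof R I M i (x i) := by
  rfl

theorem mem_support_directSumToFinsupp {R I : Type*} [Ring R] [DecidableEq I] {M : I → Type*}
    [∀ i, AddCommGroup (M i)] [∀ i, Module R (M i)] {x : DirectSum I M} {i : I} :
    i ∈ (directSumToFinsupp R M x).support ↔ x i ≠ 0 := by
  rw [Finsupp.mem_support_iff, directSumToFinsupp_apply, Ne, DirectSum.lof_eq_of,
    map_eq_zero_iff _ (DirectSum.of_injective i)]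

namespace DirectedQuotients

variable {R B I : Type*} [Ring R] [AddCommGroup B] [Module R B] [DecidableEq I]
  (N : I → Submodule R B)

/-- The degree-zero term of the bar complex of the directed system of the quotients `B ⧸ N i`. -/
abbrev Bar₀ : Type _ := DirectSum I fun i => B ⧸ N i

/-- The degree-one term of the bar complex: the component at `(i, j)` is the source of the
transition map from `i` to `i ⊔ j`. -/
abbrev Bar₁ : Type _ := DirectSum (I × I) fun i => B ⧸ N i.1

/-- The degree-two term of the bar complex: the component at `(i, j, k)` is the source of the
composable transition maps from `i` to `i ⊔ j` to `i ⊔ j ⊔ k`. -/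
abbrev Bar₂ : Type _ := DirectSum (I × I × I) fun i => B ⧸ N i.1

/-- The projection of `B` to the component of `Bar₀ N` at `i`. -/
def of₀ (i : I) : B →ₗ[R] Bar₀ N := DirectSum.lof R _ _ i ∘ₗ (N i).mkQ

/-- The projection of `B` to the component of `Bar₁ N` at `(i, j)`. -/
def of₁ (i j : I) : B →ₗ[R] Bar₁ N :=
  DirectSum.lof R _ (fun i : I × I => B ⧸ N i.1) (i, j) ∘ₗ (N i).mkQ

/-- The projection of `B` to the component of `Bar₂ N` at `(i, j, k)`. -/
def of₂ (i j k : I) : B →ₗ[R] Bar₂ N :=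
  DirectSum.lof R _ (fun i : I × I × I => B ⧸ N i.1) (i, j, k) ∘ₗ (N i).mkQ

variable {N}

theorem of₀_eq_zero {i : I} {x : B} (h : x ∈ N i) : of₀ N i x = 0 := by
  rw [of₀, LinearMap.comp_apply, Submodule.mkQ_apply, (Submodule.Quotient.mk_eq_zero _).2 h,
    map_zero]

theorem of₁_eq_zero {i j : I} {x : B} (h : x ∈ N i) : of₁ N i j x = 0 := by
  rw [of₁, LinearMap.comp_apply, Submodule.mkQ_apply, (Submodule.Quotient.mk_eq_zero _).2 h,
    map_zero]

variable (N) in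
/-- The map which sends the component at `i` to the component at `(i, k)`. On any given element, it
is a contracting homotopy up to boundaries as soon as `k` is large enough. -/
def homotopy (k : I) : Bar₀ N →ₗ[R] Bar₁ N := DirectSum.toModule R _ _ fun i =>
  (N i).liftQ (of₁ N i k) fun _ hx => of₁_eq_zero hx

theorem homotopy_of₀ (i k : I) (x : B) : homotopy N k (of₀ N i x) = of₁ N i k x := by
  rw [homotopy, of₀, LinearMap.comp_apply, DirectSum.toModule_lof]
  rfl

variable [SemilatticeSup I] (hN : Monotone N)

/-- The differential of the bar complex whose cokernel is the colimit of the quotients. -/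
def d₁ : Bar₁ N →ₗ[R] Bar₀ N := DirectSum.toModule R _ _ fun i =>
  (N i.1).liftQ (of₀ N i.1 - of₀ N (i.1 ⊔ i.2)) fun x hx => by
    rw [LinearMap.mem_ker, LinearMap.sub_apply, of₀_eq_zero hx, of₀_eq_zero (hN le_sup_left hx),
      sub_self]

theorem d₁_of₁ (i j : I) (x : B) : d₁ hN (of₁ N i j x) = of₀ N i x - of₀ N (i ⊔ j) x := by
  rw [d₁, of₁, LinearMap.comp_apply, DirectSum.toModule_lof]
  rfl

/-- The differential of the bar complex from degree two. -/
def d₂ : Bar₂ N →ₗ[R] Bar₁ N := DirectSum.toModule R _ _ fun i =>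
  (N i.1).liftQ (of₁ N i.1 i.2.1 + of₁ N (i.1 ⊔ i.2.1) i.2.2 - of₁ N i.1 (i.2.1 ⊔ i.2.2))
    fun x hx => by
      rw [LinearMap.mem_ker, LinearMap.sub_apply, LinearMap.add_apply, of₁_eq_zero hx,
        of₁_eq_zero hx, of₁_eq_zero (hN le_sup_left hx), add_zero, sub_self]

theorem d₂_of₂ (i j k : I) (x : B) :
    d₂ hN (of₂ N i j k x) = of₁ N i j x + of₁ N (i ⊔ j) k x - of₁ N i (j ⊔ k) x := by
  rw [d₂, of₂, LinearMap.comp_apply, DirectSum.toModule_lof]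
  rfl

theorem d₁_d₂ (y : Bar₂ N) : d₁ hN (d₂ hN y) = 0 := by
  refine LinearMap.congr_fun (f := d₁ hN ∘ₗ d₂ hN) (g := 0)
    (DirectSum.linearMap_ext _ fun ⟨i, j, k⟩ =>
      Submodule.linearMap_qext _ (LinearMap.ext fun x => ?_)) y
  change d₁ hN (d₂ hN (of₂ N i j k x)) = 0
  rw [d₂_of₂]
  simp only [map_add, map_sub, d₁_of₁, sup_assoc]
  abel

theorem exists_sub_homotopy_mem_range [Nonempty I] (y : Bar₁ N) : ∃ k₀ : I, ∀ k, k₀ ≤ k →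
    y - homotopy N k (d₁ hN y) ∈ LinearMap.range (d₂ hN) := by
  induction y using DirectSum.induction_on with
  | zero => exact ⟨Classical.arbitrary I, fun k _ => by simp only [map_zero, sub_zero, zero_mem]⟩
  | of i x =>
    obtain ⟨i, j⟩ := i
    obtain ⟨x, rfl⟩ := Submodule.mkQ_surjective _ x
    refine ⟨j, fun k hk => ⟨of₂ N i j k x, ?_⟩⟩
    change _ = of₁ N i j x - homotopy N k (d₁ hN (of₁ N i j x))
    rw [d₂_of₂, d₁_of₁, map_sub, homotopy_of₀, homotopy_of₀, sup_eq_right.2 hk]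
    abel
  | add x y hx hy =>
    obtain ⟨k₁, h₁⟩ := hx
    obtain ⟨k₂, h₂⟩ := hy
    refine ⟨k₁ ⊔ k₂, fun k hk => ?_⟩
    rw [map_add, map_add, add_sub_add_comm]
    exact add_mem (h₁ k (le_sup_left.trans hk)) (h₂ k (le_sup_right.trans hk))

theorem exact_d₂_d₁ [Nonempty I] : Function.Exact (d₂ hN) (d₁ hN) := by
  intro y
  refine ⟨fun hy => ?_, ?_⟩
  · obtain ⟨k, hk⟩ := exists_sub_homotopy_mem_range hN y
    have hy_mem := hk k le_rfl
    rwa [hy, map_zero, sub_zero] at hy_mem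
  · rintro ⟨x, rfl⟩
    exact d₁_d₂ hN x

theorem d₁_surjective (hmem : ∀ x, ∃ j, x ∈ N j) : Function.Surjective (d₁ hN) := by
  intro y
  induction y using DirectSum.induction_on with
  | zero => exact ⟨0, map_zero _⟩
  | of i x =>
    obtain ⟨x, rfl⟩ := Submodule.mkQ_surjective _ x
    obtain ⟨j, hj⟩ := hmem x
    refine ⟨of₁ N i j x, ?_⟩
    rw [d₁_of₁, of₀_eq_zero (hN le_sup_right hj), sub_zero]
    rfl
  | add x y hx hy =>
    obtain ⟨x, rfl⟩ := hx
    obtain ⟨y, rfl⟩ := hy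
    exact ⟨x + y, map_add _ _ _⟩

theorem exists_desc (hN : Monotone N) (k : I) : ∃ π : Bar₀ N →ₗ[R] B ⧸ N k,
    ∀ i x, i ≤ k → π (of₀ N i x) = Submodule.Quotient.mk x := by
  classical
  refine ⟨DirectSum.toModule R _ _ fun i => if h : i ≤ k then Submodule.factor (hN h) else 0,
    fun i x h => ?_⟩
  rw [of₀, LinearMap.comp_apply, DirectSum.toModule_lof, dif_pos h]
  rfl

theorem exists_eq_top [OrderBot I] (f : B →ₗ[R] Bar₁ N) (hf : ∀ x, d₁ hN (f x) = of₀ N ⊥ x)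
    (S : Finset (I × I)) (hS : ∀ x, (directSumToFinsupp R _ (f x)).support ⊆ S) :
    ∃ i, N i = ⊤ := by
  classical
  let k : I := S.sup fun i => i.1 ⊔ i.2
  obtain ⟨π, hπ⟩ := exists_desc hN k
  refine ⟨k, eq_top_iff.2 fun x _ => ?_⟩
  rw [← Submodule.Quotient.mk_eq_zero, ← hπ ⊥ x bot_le, ← hf,
    ← DirectSum.sum_support_of (f x), map_sum, map_sum]
  refine Finset.sum_eq_zero fun i hi => ?_
  have hik : i.1 ⊔ i.2 ≤ k := Finset.le_sup (f := fun i : I × I => i.1 ⊔ i.2)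
    (hS x (mem_support_directSumToFinsupp.2 (DFinsupp.mem_support_iff.1 hi)))
  obtain ⟨y, hy⟩ := Submodule.mkQ_surjective _ (f x i)
  rw [← hy]
  change π (d₁ hN (of₁ N i.1 i.2 y)) = 0
  rw [d₁_of₁, map_sub, hπ _ _ hik, hπ _ _ (le_sup_left.trans hik), sub_self]

end DirectedQuotients

namespace TorsionPair.TwoTerm

variable {R : Type u} [Ring R] {t : TorsionPair (ModuleCat.{u} R)}

/-! ### Extensions of an object of the heart -/

section Extension

variable {B C : Type u} [AddCommGroup B] [Module R B] [AddCommGroup C] [Module R C]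
  {φ : B →ₗ[R] C} (G : t.TwoTerm) (s : G.A →ₗ[R] C)

/-- The extension of `G` by the complex `φ : B → C` whose class in `Ext¹` is given by `s`. -/
def extensionMap (φ : B →ₗ[R] C) : B × G.A →ₗ[R] C × G.P :=
  (φ.coprod s).prod (G.d ∘ₗ LinearMap.snd R B G.A)

theorem isF_ker_extensionMap (hF : t.IsF (LinearMap.ker φ)) :
    t.IsF (LinearMap.ker (extensionMap G s φ)) := by
  refine hF.of_exact G.isF
    ((LinearMap.inl R B G.A).restrict fun b hb => by simpa [extensionMap] using hb)
    ((LinearMap.snd R B G.A).restrict fun x hx => congrArg Prod.snd hx)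
    (fun b b' h => Subtype.ext (congrArg (fun x => x.1.1) h)) fun x => ⟨fun hx => ?_, ?_⟩
  · have ha : x.1.2 = 0 := congrArg Subtype.val hx
    have hb : φ x.1.1 + s x.1.2 = 0 := congrArg Prod.fst x.2
    rw [ha, map_zero, add_zero] at hb
    exact ⟨⟨x.1.1, hb⟩, Subtype.ext (Prod.ext rfl ha.symm)⟩
  · rintro ⟨b, rfl⟩
    rfl

theorem isT_coker_extensionMap (hT : t.IsT (C ⧸ LinearMap.range φ)) :
    t.IsT ((C × G.P) ⧸ LinearMap.range (extensionMap G s φ)) := by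
  refine hT.of_exact G.isT
    (Submodule.mapQ _ _ (LinearMap.inl R C G.P) ?_)
    (Submodule.mapQ _ _ (LinearMap.snd R C G.P) ?_) (fun x => ⟨fun hx => ?_, ?_⟩) fun y => ?_
  · rintro _ ⟨b, rfl⟩
    exact ⟨(b, 0), by simp [extensionMap]⟩
  · rintro _ ⟨x, rfl⟩
    exact ⟨x.2, rfl⟩
  · obtain ⟨⟨c, p⟩, rfl⟩ := Submodule.mkQ_surjective _ x
    obtain ⟨a, ha⟩ : ∃ a, G.d a = p := (Submodule.Quotient.mk_eq_zero _).1 hx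
    refine ⟨Submodule.Quotient.mk (c - s a), (Submodule.Quotient.eq _).2 ⟨(0, -a), ?_⟩⟩
    simp [extensionMap, ha]
  · rintro ⟨y, rfl⟩
    obtain ⟨c, rfl⟩ := Submodule.mkQ_surjective _ y
    exact map_zero (LinearMap.range G.d).mkQ
  · obtain ⟨p, rfl⟩ := Submodule.mkQ_surjective _ y
    exact ⟨Submodule.Quotient.mk (0, p), rfl⟩

/-- A surjection onto the degree `0` term of the extension, projective if `P` is. -/
noncomputable def extensionCover (C P : Type u) [AddCommGroup C] [Module R C] [AddCommGroup P]
    [Module R P] : (C →₀ R) × P →ₗ[R] C × P :=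
  (Finsupp.linearCombination R id).prodMap LinearMap.id

theorem mkQ_extensionCover_surjective : Function.Surjective
    ((LinearMap.range (extensionMap G s φ)).mkQ ∘ₗ extensionCover C G.P) :=
  (Submodule.mkQ_surjective _).comp
    ((Finsupp.linearCombination_id_surjective R C).prodMap Function.surjective_id)

variable (hF : t.IsF (LinearMap.ker φ)) (hT : t.IsT (C ⧸ LinearMap.range φ))

/-- The extension of `G` by the complex `φ : B → C` given by `s`, as an object of the heart. -/
noncomputable abbrev extension : t.TwoTerm :=
  ofMap (z := extensionMap G s φ) (c := extensionCover C G.P)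
    (mkQ_extensionCover_surjective G s) (isF_ker_extensionMap G s hF)
    (isT_coker_extensionMap G s hT)

/-- The component in degree `-1` of the projection of the extension to `G`. -/
noncomputable def extensionFst : (extension G s hF hT).A →ₗ[R] G.A :=
  LinearMap.snd R B G.A ∘ₗ LinearMap.fst R _ _ ∘ₗ (pullback _ _).subtype

/-- The component in degree `0` of the projection of the extension to `G`. -/
noncomputable def extensionSnd : (extension G s hF hT).P →ₗ[R] G.P := LinearMap.snd R (C →₀ R) G.P

theorem d_extensionFst (x : (extension G s hF hT).A) :
    G.d (extensionFst G s hF hT x) = extensionSnd G s hF hT ((extension G s hF hT).d x) :=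
  congrArg Prod.snd x.2

theorem apply_add_apply_extensionFst (x : (extension G s hF hT).A) :
    φ x.1.1.1 + s (extensionFst G s hF hT x) =
      Finsupp.linearCombination R id ((extension G s hF hT).d x).1 :=
  congrArg Prod.fst x.2

theorem isConeEpi_extension : IsConeEpi (d_extensionFst G s hF hT) := by
  let ψ : LinearMap.ker (coneD G (extensionSnd G s hF hT)) →ₗ[R] C :=
    (Finsupp.linearCombination R id ∘ₗ LinearMap.fst R _ _ ∘ₗ LinearMap.snd R _ _ -
      s ∘ₗ LinearMap.fst R _ _) ∘ₗ Submodule.subtype _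
  let θ := (LinearMap.range φ).mkQ ∘ₗ ψ
  have hcone : ∀ x, coneD G (extensionSnd G s hF hT) x = G.d x.1 - x.2.2 := coneD_apply _
  have hψ : Function.Surjective ψ := fun c => by
    obtain ⟨l, rfl⟩ := Finsupp.linearCombination_id_surjective R C c
    exact ⟨⟨(0, (l, 0)), by simp [hcone]⟩, by simp [ψ]⟩
  have hker : LinearMap.ker θ = LinearMap.range (toConeZ (d_extensionFst G s hF hT)) := by
    ext ⟨⟨a, l, p⟩, hx⟩
    have hp : G.d a = p := sub_eq_zero.1 ((hcone _).symm.trans hx)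
    constructor
    · intro hθ
      obtain ⟨b, hb⟩ : ∃ b, φ b = Finsupp.linearCombination R id l - s a :=
        (Submodule.Quotient.mk_eq_zero _).1 hθ
      exact ⟨⟨((b, a), (l, p)), Prod.ext (eq_sub_iff_add_eq.1 hb) hp⟩, rfl⟩
    · rintro ⟨x, hx⟩
      rw [← hx]
      exact (Submodule.Quotient.mk_eq_zero _).2
        ⟨x.1.1.1, eq_sub_of_add_eq (apply_add_apply_extensionFst G s hF hT x)⟩
  refine ⟨fun p => ⟨(0, (0, -p)), by simp [hcone]⟩, hT.of_equiv ((θ.quotKerEquivOfSurjective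
    ((Submodule.mkQ_surjective _).comp hψ)).symm ≪≫ₗ Submodule.quotEquivOfEq _ _ hker)⟩

end Extension

theorem isExtProjective_of_projective (G : t.TwoTerm) [Projective G] : G.IsExtProjective := by
  refine ⟨fun {B C} _ _ _ _ φ hF hT s => ?_⟩
  let p := homMk _ _ (d_extensionFst G s hF hT)
  have : Epi p := (isConeEpi_extension G s hF hT).epi
  obtain ⟨σ₁, σ₀, hσ, hσ_eq⟩ := exists_homMk (Projective.factorThru (𝟙 G) p)
  have hp := Projective.factorThru_comp (𝟙 G) p
  rw [hσ_eq, id_eq_homMk] at hp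
  obtain ⟨k, hk, -⟩ := homMk_comp_eq_homMk_iff.1 hp
  replace hk : ∀ a, extensionFst G s hF hT (σ₁ a) = a + k (G.d a) := hk
  refine ⟨-(LinearMap.fst R B G.A ∘ₗ LinearMap.fst R _ _ ∘ₗ (pullback _ _).subtype ∘ₗ σ₁),
    Finsupp.linearCombination R id ∘ₗ LinearMap.fst R _ _ ∘ₗ σ₀ - s ∘ₗ k, fun a => ?_⟩
  have ha := apply_add_apply_extensionFst G s hF hT (σ₁ a)
  rw [hk, map_add, hσ] at ha
  change s a = φ (-(σ₁ a).1.1.1) + (Finsupp.linearCombination R id (σ₀ (G.d a)).1 - s (k (G.d a)))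
  rw [← ha, map_neg]
  abel

/-! ### Small projective generators -/

/-- A projective separator `G` of the heart which is small: a morphism from `G` to a power factors,
as far as morphisms out of that power can tell, through finitely many summands. -/
structure IsSmallProjectiveGenerator (G : t.TwoTerm) : Prop where
  projective : Projective G
  isSeparator : IsSeparator G
  small {M : t.TwoTerm} {I : Type u} (φ : G ⟶ M.pow I) : ∃ S : Finset I,
    ∀ {N : t.TwoTerm} (u : M.pow I ⟶ N), (∀ i ∈ S, M.ι i ≫ u = 0) → φ ≫ u = 0

theorem iSup_range_map_ι {S : Type u} [Ring S] (e : t.TwoTerm ≌ ModuleCat.{u} S) (M : t.TwoTerm)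
    (I : Type u) : ⨆ i : I, LinearMap.range (e.functor.map (M.ι i)).hom = ⊤ := by
  let D := ⨆ i : I, LinearMap.range (e.functor.map (M.ι i)).hom
  let q : e.functor.obj (M.pow I) ⟶ ModuleCat.of S (_ ⧸ D) := ModuleCat.ofHom D.mkQ
  let adj := e.toAdjunction.homEquiv (M.pow I) (ModuleCat.of S (_ ⧸ D))
  have hιq : ∀ i, e.functor.map (M.ι i) ≫ q = e.functor.map (M.ι i) ≫ 0 := fun i => by
    ext x
    exact (Submodule.Quotient.mk_eq_zero D).2
      (le_iSup (fun i : I => LinearMap.range (e.functor.map (M.ι i)).hom) i ⟨x, rfl⟩)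
  have hadj : adj q = adj 0 := pow_hom_ext fun i => by
    rw [← Adjunction.homEquiv_naturality_left, ← Adjunction.homEquiv_naturality_left, hιq]
  have hq : D.mkQ = 0 := congrArg ModuleCat.Hom.hom (adj.injective hadj)
  change D = ⊤
  rw [← D.ker_mkQ, hq, LinearMap.ker_zero]

theorem exists_finset_of_hom_pow {S : Type u} [Ring S] (e : t.TwoTerm ≌ ModuleCat.{u} S)
    {M : t.TwoTerm} {I : Type u} (φ : e.inverse.obj (ModuleCat.of S S) ⟶ M.pow I) :
    ∃ T : Finset I, ∀ {N : t.TwoTerm} (u : M.pow I ⟶ N), (∀ i ∈ T, M.ι i ≫ u = 0) →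
      φ ≫ u = 0 := by
  let adj (N : t.TwoTerm) := e.symm.toAdjunction.homEquiv (ModuleCat.of S S) N
  let x : e.functor.obj (M.pow I) := (adj _ φ).hom (1 : S)
  have hx : x ∈ ⨆ i : I, LinearMap.range (e.functor.map (M.ι i)).hom := by
    rw [iSup_range_map_ι e M I]
    exact Submodule.mem_top
  obtain ⟨T, hT⟩ := Submodule.mem_iSup_iff_exists_finset.1 hx
  refine ⟨T, fun {N} u hu => (adj N).injective ?_⟩
  have hle : ⨆ i ∈ T, LinearMap.range (e.functor.map (M.ι i)).hom ≤
      LinearMap.ker (e.functor.map u).hom := by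
    refine iSup₂_le fun i hi => ?_
    rintro _ ⟨y, rfl⟩
    have hιu : e.functor.map (M.ι i) ≫ e.functor.map u = 0 := by
      rw [← Functor.map_comp, hu i hi, Functor.map_zero]
    exact congrArg (fun f => f.hom y) hιu
  have hφu : adj _ φ ≫ e.functor.map u = 0 := by
    ext
    exact hle hT
  calc adj N (φ ≫ u) = adj _ φ ≫ e.functor.map u := Adjunction.homEquiv_naturality_right _ _ _
    _ = adj _ φ ≫ e.functor.map 0 := by rw [hφu, Functor.map_zero, Limits.comp_zero]
    _ = adj N (φ ≫ 0) := (Adjunction.homEquiv_naturality_right _ _ _).symm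
    _ = adj N 0 := by rw [Limits.comp_zero]

theorem exists_isSmallProjectiveGenerator (h : IsModuleCategory.{u} t.TwoTerm) :
    ∃ G : t.TwoTerm, G.IsSmallProjectiveGenerator := by
  obtain ⟨S, _, ⟨e⟩⟩ := h
  have hS : IsSeparator (ModuleCat.of S S) := (Preadditive.isSeparator_iff _).2 fun M N f hf => by
    ext x
    simpa using congrArg (fun g => g.hom (1 : S))
      (hf (ModuleCat.ofHom (LinearMap.toSpanSingleton S M x)))
  exact ⟨e.inverse.obj (ModuleCat.of S S), (e.symm.map_projective_iff _).2 inferInstance,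
    hS.of_equivalence e.symm, exists_finset_of_hom_pow e⟩

namespace IsSmallProjectiveGenerator

variable {G : t.TwoTerm}

theorem of_iso (hG : G.IsSmallProjectiveGenerator) {G' : t.TwoTerm} (e : G ≅ G') :
    G'.IsSmallProjectiveGenerator where
  projective := Projective.of_iso e hG.projective
  isSeparator := (Preadditive.isSeparator_iff _).2 fun M N f h => by
    refine (Preadditive.isSeparator_iff _).1 hG.isSeparator f fun s => ?_
    rw [← cancel_epi e.inv, ← Category.assoc, h, Limits.comp_zero]
  small φ := by
    obtain ⟨S, hS⟩ := hG.small (e.hom ≫ φ)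
    refine ⟨S, fun u hu => ?_⟩
    rw [← cancel_epi e.hom, ← Category.assoc, hS u hu, Limits.comp_zero]

theorem isExtProjective (hG : G.IsSmallProjectiveGenerator) : G.IsExtProjective :=
  have := hG.projective
  isExtProjective_of_projective G

end IsSmallProjectiveGenerator

end TorsionPair.TwoTerm

/-- The filter map `Finsupp.filter` as a linear map. -/
def finsuppFilter (R : Type*) {I A : Type*} [Ring R] [AddCommGroup A] [Module R A] (p : I → Prop)
    [DecidablePred p] : (I →₀ A) →ₗ[R] (I →₀ A) where
  toFun := Finsupp.filter p
  map_add' _ _ := Finsupp.filter_add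
  map_smul' _ _ := Finsupp.filter_smul

namespace TorsionPair

variable {R : Type u} [Ring R] {t : TorsionPair (ModuleCat.{u} R)}

namespace TwoTerm

/-! ### Modules as objects of the heart -/

/-- A torsion-free module as an object of the heart, concentrated in degree `-1`. -/
abbrev ofTorsionFree {F : Type u} [AddCommGroup F] [Module R F] (hF : t.IsF F) : t.TwoTerm where
  A := F
  P := PUnit.{u + 1}
  d := 0
  isF := hF.of_injective _ (Submodule.subtype_injective _)
  isT := isT_of_subsingleton

section OfTorsion

variable {T : Type u} [AddCommGroup T] [Module R T] (hT : t.IsT T)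

/-- A torsion module as an object of the heart, concentrated in degree `0`. -/
noncomputable abbrev ofTorsion : t.TwoTerm :=
  ofMap (z := (0 : PUnit.{u + 1} →ₗ[R] T)) (c := Finsupp.linearCombination R (id : T → T))
    ((Submodule.mkQ_surjective _).comp (Finsupp.linearCombination_id_surjective R T))
    isF_of_subsingleton (hT.of_surjective (Submodule.mkQ _) (Submodule.mkQ_surjective _))

/-- The augmentation of `ofTorsion`. -/
noncomputable abbrev ofTorsionπ : (ofTorsion hT).P →ₗ[R] T :=
  Finsupp.linearCombination R (id : T → T)

theorem ofTorsionπ_surjective : Function.Surjective (ofTorsionπ hT) :=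
  Finsupp.linearCombination_id_surjective R T

theorem exact_d_ofTorsionπ : Function.Exact (ofTorsion hT).d (ofTorsionπ hT) := fun p => by
  refine ⟨fun hp => ⟨⟨(0, p), hp.symm⟩, rfl⟩, ?_⟩
  rintro ⟨x, rfl⟩
  exact x.2.symm

end OfTorsion

theorem IsConeEpi.exists_presentation {M N : t.TwoTerm} {p₁ : M.A →ₗ[R] N.A}
    {p₀ : M.P →ₗ[R] N.P} {hp : ∀ a, N.d (p₁ a) = p₀ (M.d a)} (h : IsConeEpi hp)
    {V T : Type u} [AddCommGroup V] [Module R V] [AddCommGroup T] [Module R T]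
    {μ : M.P →ₗ[R] V} (hMμ : Function.Exact M.d μ) (hμ : Function.Surjective μ)
    {π : N.P →ₗ[R] T} (hNπ : Function.Exact N.d π) (hπ : Function.Surjective π) :
    ∃ q : V →ₗ[R] T, Function.Surjective q ∧ t.IsT (LinearMap.ker q) := by
  obtain ⟨q, hq⟩ := exists_linearMap_comp_eq_of_ker_le hμ (f := π ∘ₗ p₀) fun x hx => by
    obtain ⟨a, rfl⟩ := (hMμ x).1 hx
    rw [LinearMap.mem_ker, LinearMap.comp_apply, ← hp, hNπ.apply_apply_eq_zero]
  replace hq : ∀ x, q (μ x) = π (p₀ x) := hq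
  have hker : ∀ z : LinearMap.ker (coneD N p₀), q (μ z.1.2) = 0 := fun z => by
    have hz : N.d z.1.1 = p₀ z.1.2 := sub_eq_zero.1 ((coneD_apply _ _).symm.trans z.2)
    rw [hq, ← hz, hNπ.apply_apply_eq_zero]
  let τ : LinearMap.ker (coneD N p₀) →ₗ[R] LinearMap.ker q :=
    (μ ∘ₗ LinearMap.snd R _ _ ∘ₗ Submodule.subtype _).codRestrict _ hker
  have hτ : LinearMap.range (toConeZ hp) ≤ LinearMap.ker τ := by
    rintro _ ⟨a, rfl⟩
    exact Subtype.ext (hMμ.apply_apply_eq_zero a)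
  refine ⟨q, fun y => ?_, h.isT.of_surjective ((LinearMap.range (toConeZ hp)).liftQ τ hτ) ?_⟩
  · obtain ⟨l, rfl⟩ := hπ y
    obtain ⟨x, rfl⟩ := h.surjective l
    refine ⟨μ (-x.2), ?_⟩
    rw [hq, coneD_apply, map_sub, hNπ.apply_apply_eq_zero, map_neg, map_neg, zero_sub]
  · rintro ⟨y, hy⟩
    obtain ⟨x, rfl⟩ := hμ y
    obtain ⟨k, hk⟩ := (hNπ (p₀ x)).1 ((hq x).symm.trans hy)
    exact ⟨Submodule.Quotient.mk ⟨(k, x), (coneD_apply _ _).trans (sub_eq_zero.2 hk)⟩, rfl⟩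

namespace IsSmallProjectiveGenerator

variable {G : t.TwoTerm}

theorem exists_isConeEpi (hG : G.IsSmallProjectiveGenerator) (M : t.TwoTerm) :
    ∃ (I : Type u) (p₁ : (G.pow I).A →ₗ[R] M.A) (p₀ : (G.pow I).P →ₗ[R] M.P)
      (hp : ∀ a, M.d (p₁ a) = p₀ ((G.pow I).d a)), IsConeEpi hp := by
  obtain ⟨p, hp⟩ := exists_pow_desc (fun s : G ⟶ M => s)
  have : Epi p := Preadditive.epi_of_cancel_zero _ fun u hu =>
    (Preadditive.isSeparator_iff _).1 hG.isSeparator u fun s => by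
      rw [← hp s, Category.assoc, hu, Limits.comp_zero]
  obtain ⟨p₁, p₀, hp', rfl⟩ := exists_homMk p
  exact ⟨_, p₁, p₀, hp', isConeEpi_of_epi⟩

theorem exists_presentation (hG : G.IsSmallProjectiveGenerator) {T : Type u} [AddCommGroup T]
    [Module R T] (hT : t.IsT T) :
    ∃ (I : Type u) (p : (I →₀ G.P ⧸ LinearMap.range G.d) →ₗ[R] T), Function.Surjective p ∧
      t.IsT (LinearMap.ker p) := by
  obtain ⟨I, p₁, p₀, hp, h⟩ := hG.exists_isConeEpi (ofTorsion hT)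
  exact ⟨I, h.exists_presentation (exact_mapRange (LinearMap.exact_map_mkQ_range G.d) I)
    (Finsupp.mapRange_surjective _ (map_zero _) (Submodule.mkQ_surjective _))
    (exact_d_ofTorsionπ hT) (ofTorsionπ_surjective hT)⟩

theorem kerExtOne (hG : G.IsSmallProjectiveGenerator) {T : Type u} [AddCommGroup T] [Module R T]
    (hT : t.IsT T) : KerExtOne (ModuleCat.of R (G.P ⧸ LinearMap.range G.d)) (ModuleCat.of R T) :=
  G.kerExtOne_coker (hG.isExtProjective.exists_extension hT)

/-! ### Smallness and finite supports -/

theorem exists_finset_homotopy (hG : G.IsSmallProjectiveGenerator) {M : t.TwoTerm} {I : Type u}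
    {s₁ : G.A →ₗ[R] (I →₀ M.A)} {s₀ : G.P →ₗ[R] (I →₀ M.P)}
    (hs : ∀ a, (M.pow I).d (s₁ a) = s₀ (G.d a)) :
    ∃ (S : Finset I) (k : G.P →ₗ[R] (I →₀ M.A)),
      ∀ i ∉ S, (∀ a, s₁ a i = k (G.d a) i) ∧ ∀ p, s₀ p i = M.d (k p i) := by
  classical
  obtain ⟨S, hS⟩ := hG.small (homMk (N := M.pow I) s₁ s₀ hs)
  obtain ⟨k, hk₁, hk₀⟩ := homMk_comp_eq_zero_iff.1 <| hS
    (homMk (M := M.pow I) (N := M.pow I) (finsuppFilter R (· ∉ S)) (finsuppFilter R (· ∉ S))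
      fun x => Finsupp.ext fun i => by
        by_cases hi : i ∈ S <;> simp [finsuppFilter, hi])
    fun i hi => homMk_comp_eq_zero_iff.2
      ⟨0, fun a => Finsupp.filter_single_of_neg (· ∉ S) (not_not_intro hi),
        fun p => (Finsupp.filter_single_of_neg (· ∉ S) (not_not_intro hi)).trans (map_zero _).symm⟩
  refine ⟨S, k, fun i hi => ⟨fun a => ?_, fun p => ?_⟩⟩
  · exact (Finsupp.filter_apply_pos (· ∉ S) _ hi).symm.trans (DFunLike.congr_fun (hk₁ a) i)
  · exact (Finsupp.filter_apply_pos (· ∉ S) _ hi).symm.trans (DFunLike.congr_fun (hk₀ p) i)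

theorem exists_finset_of_isT (hG : G.IsSmallProjectiveGenerator) {T : Type u} [AddCommGroup T]
    [Module R T] (hT : t.IsT T) {I : Type u} (f : (G.P ⧸ LinearMap.range G.d) →ₗ[R] (I →₀ T)) :
    ∃ S : Finset I, ∀ x, (f x).support ⊆ S := by
  obtain ⟨s₀, hs₀⟩ := Module.projective_lifting_property
    (Finsupp.mapRange.linearMap (ofTorsionπ hT) : (I →₀ (ofTorsion hT).P) →ₗ[R] (I →₀ T))
    (f ∘ₗ Submodule.mkQ _)
    (Finsupp.mapRange_surjective _ (map_zero _) (ofTorsionπ_surjective hT))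
  have hrange : LinearMap.range (s₀ ∘ₗ G.d) ≤ LinearMap.range ((ofTorsion hT).pow I).d := by
    rintro _ ⟨a, rfl⟩
    refine (exact_mapRange (exact_d_ofTorsionπ hT) I _).1 ((LinearMap.congr_fun hs₀ _).trans ?_)
    exact (congrArg f ((Submodule.Quotient.mk_eq_zero _).2 ⟨a, rfl⟩)).trans (map_zero f)
  obtain ⟨s₁, hs₁⟩ := hG.isExtProjective.exists_lift ((ofTorsion hT).pow I).isF hrange
  obtain ⟨S, k, hk⟩ := hG.exists_finset_homotopy hs₁
  refine ⟨S, fun x i hx => by_contra fun hi => Finsupp.mem_support_iff.1 hx ?_⟩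
  obtain ⟨p, rfl⟩ := Submodule.mkQ_surjective _ x
  calc f (Submodule.mkQ _ p) i = ofTorsionπ hT (s₀ p i) :=
        (DFunLike.congr_fun (LinearMap.congr_fun hs₀ p) i).symm
    _ = 0 := by rw [(hk i hi).2, (exact_d_ofTorsionπ hT).apply_apply_eq_zero]

theorem exists_finset_of_isF (hG : G.IsSmallProjectiveGenerator) [Module.Finite R G.P]
    {F : Type u} [AddCommGroup F] [Module R F] (hF : t.IsF F) {I : Type u}
    (f : G.A →ₗ[R] (I →₀ F)) : ∃ S : Finset I, ∀ x, (f x).support ⊆ S := by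
  classical
  obtain ⟨S, k, hk⟩ := hG.exists_finset_homotopy (M := ofTorsionFree hF) (s₁ := f) (s₀ := 0)
    fun a => Subsingleton.elim _ _
  obtain ⟨S', hS'⟩ := exists_finset_support_subset k
  refine ⟨S ∪ S', fun x i hx => Finset.mem_union.2 (or_iff_not_imp_left.2 fun hi => ?_)⟩
  refine hS' (G.d x) (Finsupp.mem_support_iff.2 ?_)
  rw [← (hk i hi).1]
  exact Finsupp.mem_support_iff.1 hx

end IsSmallProjectiveGenerator

end TwoTerm

/-! ### Finite generation -/

section DirectedQuotients

variable {I B : Type u} [AddCommGroup B] [Module R B] [DecidableEq I] [SemilatticeSup I]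
  {N : I → Submodule R B} (hN : Monotone N)

open DirectedQuotients

theorem isT_ker_d₁ [Nonempty I] (hT : ∀ i, t.IsT (B ⧸ N i)) :
    t.IsT (LinearMap.ker (d₁ hN)) := by
  refine IsT.of_surjective (M := Bar₂ N) (IsT.directSum fun i => hT i.1)
    ((d₂ hN).codRestrict _ (d₁_d₂ hN)) ?_
  rintro ⟨x, hx⟩
  obtain ⟨y, hy⟩ := (exact_d₂_d₁ hN x).1 hx
  exact ⟨y, Subtype.ext hy⟩

theorem isF_ker_d₁ (hF : ∀ i, t.IsF (B ⧸ N i)) : t.IsF (LinearMap.ker (d₁ hN)) :=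
  IsF.of_injective (N := Bar₁ N) (IsF.directSum fun i => hF i.1) _
    (Submodule.subtype_injective _)

end DirectedQuotients

theorem monotone_span_finset (R : Type*) {B : Type*} [Ring R] [AddCommGroup B] [Module R B] :
    Monotone fun i : Finset B => Submodule.span R (i : Set B) :=
  fun _ _ h => Submodule.span_mono (Finset.coe_subset.2 h)

theorem finite_of_isT {V : Type u} [AddCommGroup V] [Module R V] (hV : t.IsT V)
    (hext : ∀ {T : Type u} [AddCommGroup T] [Module R T], t.IsT T →
      KerExtOne (ModuleCat.of R V) (ModuleCat.of R T))
    (hsmall : ∀ {T : Type u} [AddCommGroup T] [Module R T], t.IsT T →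
      ∀ {I : Type u} (f : V →ₗ[R] (I →₀ T)), ∃ S : Finset I, ∀ x, (f x).support ⊆ S) :
    Module.Finite R V := by
  classical
  let N : Finset V → Submodule R V := fun i => Submodule.span R i
  have hN : Monotone N := monotone_span_finset R
  have hT : ∀ i, t.IsT (V ⧸ N i) := fun i => hV.of_surjective _ (Submodule.mkQ_surjective _)
  obtain ⟨f, hf⟩ := (hext (isT_ker_d₁ hN hT)).exists_lift (Submodule.subtype_injective _)
    (LinearMap.exact_subtype_ker_map _) (DirectedQuotients.d₁_surjective hN
      fun x => ⟨{x}, Submodule.subset_span (Finset.mem_singleton_self x)⟩)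
    (DirectedQuotients.of₀ N ⊥)
  obtain ⟨S, hS⟩ := hsmall (T := DirectedQuotients.Bar₁ N) (IsT.directSum fun i => hT i.1)
    (directSumToFinsupp R _ ∘ₗ f)
  obtain ⟨i, hi⟩ := DirectedQuotients.exists_eq_top hN f hf S hS
  exact ⟨⟨i, hi⟩⟩

section TorsionClosure

variable {B : Type u} [AddCommGroup B] [Module R B]

/-- The largest submodule containing `W` whose quotient by `W` is torsion. -/
def torsionClosure (t : TorsionPair (ModuleCat.{u} R)) (W : Submodule R B) : Submodule R B :=
  (t.torsion (B ⧸ W)).comap W.mkQ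

theorem le_torsionClosure (W : Submodule R B) : W ≤ t.torsionClosure W :=
  (Submodule.ker_mkQ W).symm.trans_le (LinearMap.ker_le_comap _)

theorem torsionClosure_mono : Monotone (t.torsionClosure (B := B)) :=
  fun _ _ h _ hx => map_mem_torsion (Submodule.factor h) hx

theorem isF_quotient_torsionClosure (W : Submodule R B) : t.IsF (B ⧸ t.torsionClosure W) := by
  refine (isF_quotient_torsion (t := t) (M := B ⧸ W)).of_injective
    ((t.torsionClosure W).mapQ (t.torsion (B ⧸ W)) W.mkQ le_rfl) ?_
  refine (injective_iff_map_eq_zero _).2 fun x hx => ?_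
  obtain ⟨x, rfl⟩ := Submodule.mkQ_surjective _ x
  exact (Submodule.Quotient.mk_eq_zero _).2
    ((Submodule.Quotient.mk_eq_zero (t.torsion (B ⧸ W))).1 hx)

theorem isT_quotient_of_torsionClosure_eq_top {W : Submodule R B} (h : t.torsionClosure W = ⊤) :
    t.IsT (B ⧸ W) := by
  refine isT_of_torsion_eq_top (eq_top_iff.2 fun x _ => ?_)
  obtain ⟨x, rfl⟩ := Submodule.mkQ_surjective _ x
  exact (h ▸ Submodule.mem_top : x ∈ t.torsionClosure W)

end TorsionClosure

namespace TwoTerm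

section Replacement

variable {G : t.TwoTerm} {L : Type u} [AddCommGroup L] [Module R L] {r : L →ₗ[R] G.P}

theorem exists_d_eq_add (hr : Function.Surjective ((LinearMap.range G.d).mkQ ∘ₗ r)) :
    ∃ (α : G.P →ₗ[R] G.A) (β : G.P →ₗ[R] L), ∀ p, G.d (α p) = p + r (β p) := by
  have hdr : Function.Surjective (G.d.coprod (-r)) := fun p => by
    obtain ⟨y, hy⟩ := hr (-Submodule.Quotient.mk p)
    obtain ⟨a, ha⟩ : ∃ a, G.d a = r y - -p := (Submodule.Quotient.eq _).1 hy
    exact ⟨(a, y), by simp [ha]⟩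
  obtain ⟨σ, hσ⟩ := Module.projective_lifting_property (G.d.coprod (-r)) LinearMap.id hdr
  refine ⟨LinearMap.fst R _ _ ∘ₗ σ, LinearMap.snd R _ _ ∘ₗ σ, fun p => ?_⟩
  exact eq_add_of_add_neg_eq (LinearMap.congr_fun hσ p)

theorem nonempty_iso_ofMap [Module.Projective R L]
    (hr : Function.Surjective ((LinearMap.range G.d).mkQ ∘ₗ r)) :
    Nonempty (G ≅ ofMap hr G.isF G.isT) := by
  obtain ⟨α, β, hαβ⟩ := exists_d_eq_add hr
  let G' := ofMap hr G.isF G.isT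
  let w₁ : G.A →ₗ[R] G'.A := ((LinearMap.id - α ∘ₗ G.d).prod (-(β ∘ₗ G.d))).codRestrict
    (pullback G.d r) fun a => by
      change G.d (a - α (G.d a)) = r (-β (G.d a))
      rw [map_sub, hαβ, map_neg, sub_add_cancel_left]
  let k : G'.P →ₗ[R] G'.A := ((-(α ∘ₗ r)).prod (-(β ∘ₗ r) - LinearMap.id)).codRestrict
    (pullback G.d r) fun x => by
      change G.d (-α (r x)) = r (-β (r x) - x)
      rw [map_neg, hαβ, map_sub, map_neg]
      abel
  refine ⟨⟨homMk (N := G') w₁ (-β) fun _ => rfl,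
    homMk (M := G') (LinearMap.fst R _ _ ∘ₗ (pullback _ _).subtype) r fun x => x.2, ?_, ?_⟩⟩
  · refine (homMk_comp_eq_homMk_iff (hh := fun _ => rfl)).2
      ⟨-α, fun a => sub_eq_add_neg _ _, fun p => ?_⟩
    change r (-β p) = p + G.d (-α p)
    rw [map_neg, map_neg, hαβ]
    abel
  · refine (homMk_comp_eq_homMk_iff (hh := fun _ => rfl)).2
      ⟨k, fun x => Subtype.ext (Prod.ext ?_ ?_), fun x => ?_⟩
    · change x.1.1 - α (G.d x.1.1) = x.1.1 + -α (r x.1.2)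
      rw [show G.d x.1.1 = r x.1.2 from x.2, sub_eq_add_neg]
    · change -β (G.d x.1.1) = x.1.2 + (-β (r x.1.2) - x.1.2)
      rw [show G.d x.1.1 = r x.1.2 from x.2, add_sub_cancel]
    · exact (add_sub_cancel x (-β (r x))).symm

end Replacement

namespace IsSmallProjectiveGenerator

variable {G : t.TwoTerm}

theorem finite_coker (hG : G.IsSmallProjectiveGenerator) :
    Module.Finite R (G.P ⧸ LinearMap.range G.d) :=
  finite_of_isT G.isT hG.kerExtOne hG.exists_finset_of_isT

theorem exists_finite_P (hG : G.IsSmallProjectiveGenerator) :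
    ∃ G' : t.TwoTerm, G'.IsSmallProjectiveGenerator ∧ Module.Finite R G'.P := by
  have := hG.finite_coker
  obtain ⟨n, q, hq⟩ := Module.Finite.exists_fin' R (G.P ⧸ LinearMap.range G.d)
  obtain ⟨r, rfl⟩ := Module.projective_lifting_property (LinearMap.range G.d).mkQ q
    (Submodule.mkQ_surjective _)
  obtain ⟨e⟩ := nonempty_iso_ofMap hq
  exact ⟨_, hG.of_iso e, inferInstanceAs (Module.Finite R (Fin n → R))⟩

theorem exists_torsionClosure_span_eq_top (hG : G.IsSmallProjectiveGenerator)
    [Module.Finite R G.P] :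
    ∃ i : Finset G.A, t.torsionClosure (Submodule.span R (i : Set G.A)) = ⊤ := by
  classical
  let N : Finset G.A → Submodule R G.A := fun i => t.torsionClosure (Submodule.span R i)
  have hN : Monotone N := torsionClosure_mono.comp (monotone_span_finset R)
  have hF : ∀ i, t.IsF (G.A ⧸ N i) := fun i => isF_quotient_torsionClosure _
  have hd₁ := DirectedQuotients.d₁_surjective hN fun x =>
    ⟨{x}, le_torsionClosure _ (Submodule.subset_span (Finset.mem_singleton_self x))⟩
  obtain ⟨f, hf⟩ := hG.isExtProjective.exists_lift (isF_ker_d₁ hN hF)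
    (f := DirectedQuotients.of₀ N ⊥) fun x _ => hd₁ x
  obtain ⟨S, hS⟩ := hG.exists_finset_of_isF (F := DirectedQuotients.Bar₁ N)
    (IsF.directSum fun i => hF i.1) (directSumToFinsupp R _ ∘ₗ f)
  exact DirectedQuotients.exists_eq_top hN f hf S hS

theorem finite_A (hG : G.IsSmallProjectiveGenerator) [Module.Finite R G.P] :
    Module.Finite R G.A := by
  obtain ⟨i, hi⟩ := hG.exists_torsionClosure_span_eq_top
  obtain ⟨g, hg⟩ := hG.isExtProjective.exists_extension (isT_quotient_of_torsionClosure_eq_top hi)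
    (Submodule.mkQ _)
  have hg_surj : Function.Surjective g := fun y => by
    obtain ⟨a, rfl⟩ := Submodule.mkQ_surjective _ y
    exact ⟨_, hg a⟩
  have := Module.Finite.of_surjective g hg_surj
  have := Module.Finite.span_finset R i
  exact Module.Finite.of_submodule_quotient (Submodule.span R (i : Set G.A))

end IsSmallProjectiveGenerator

end TwoTerm

end TorsionPair

/-! ### The tilting complex of a small projective generator -/

namespace ThreeTermComplex

variable {R : Type u} [Ring R] {L A P : Type u} [AddCommGroup L] [Module R L] [AddCommGroup A]
  [Module R A] [AddCommGroup P] [Module R P] (q : L →ₗ[R] A) (d : A →ₗ[R] P)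

/-- The complex `Ker q → L → P`, which for surjective `q` is quasi-isomorphic to `A → P`. -/
abbrev ofCover : ThreeTermComplex R where
  X := ModuleCat.of R (LinearMap.ker q)
  Q := ModuleCat.of R L
  P := ModuleCat.of R P
  j := (LinearMap.ker q).subtype
  d := d ∘ₗ q
  d_comp_j := LinearMap.ext fun x => (congrArg d x.2).trans (map_zero d)

variable {q}

theorem range_ofCover_d (hq : Function.Surjective q) :
    LinearMap.range (ofCover q d).d = LinearMap.range d :=
  LinearMap.range_comp_of_range_eq_top _ (LinearMap.range_eq_top.2 hq)

theorem H0_ofCover (hq : Function.Surjective q) :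
    (ofCover q d).H0 = ModuleCat.of R (P ⧸ LinearMap.range d) := by
  rw [← range_ofCover_d d hq]

variable (hq : Function.Surjective q)

/-- The first isomorphism theorem for the cokernel of `Ker q → L`. -/
noncomputable def ofCoverEquiv :
    ((ofCover q d).Q ⧸ LinearMap.range (ofCover q d).j) ≃ₗ[R] A :=
  Submodule.quotEquivOfEq _ _ (Submodule.range_subtype _) ≪≫ₗ q.quotKerEquivOfSurjective hq

theorem d_ofCoverEquiv (x) : d (ofCoverEquiv d hq x) = (ofCover q d).quotD x := by
  obtain ⟨x, rfl⟩ := Submodule.mkQ_surjective _ x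
  rfl

theorem mem_HNegOne_ofCover {x} :
    x ∈ (ofCover q d).HNegOne ↔ ofCoverEquiv d hq x ∈ LinearMap.ker d := by
  rw [LinearMap.mem_ker, d_ofCoverEquiv, ← LinearMap.mem_ker, ker_quotD]

theorem range_ofCoverEquiv_comp_subtype :
    LinearMap.range ((ofCoverEquiv d hq).toLinearMap ∘ₗ (ofCover q d).HNegOne.subtype) =
      LinearMap.ker d := by
  ext a
  refine ⟨?_, fun ha => ⟨⟨(ofCoverEquiv d hq).symm a, ?_⟩, ?_⟩⟩
  · rintro ⟨x, rfl⟩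
    exact (mem_HNegOne_ofCover d hq).1 x.2
  · rwa [mem_HNegOne_ofCover d hq, LinearEquiv.apply_symm_apply]
  · exact (ofCoverEquiv d hq).apply_symm_apply a

theorem range_mapRange_ofCoverEquiv_comp_HNegOneIncl (I : Type u) :
    LinearMap.range (Finsupp.mapRange.linearMap (ofCoverEquiv d hq).toLinearMap ∘ₗ
      (ofCover q d).HNegOneIncl I) =
      LinearMap.range (Finsupp.mapRange.linearMap (α := I) (LinearMap.ker d).subtype) := by
  rw [HNegOneIncl, ← Finsupp.mapRange.linearMap_comp, Finsupp.range_mapRange_linearMap,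
    Finsupp.range_mapRange_linearMap _ (Submodule.ker_subtype _),
    range_ofCoverEquiv_comp_subtype, Submodule.range_subtype]
  exact LinearMap.ker_eq_bot.2 ((ofCoverEquiv d hq).injective.comp
    (ofCover q d).HNegOne.subtype_injective)

end ThreeTermComplex

namespace TorsionPair

variable {R : Type u} [Ring R] {t : TorsionPair (ModuleCat.{u} R)}

namespace TwoTerm

variable {G : t.TwoTerm}

theorem IsExtProjective.kerExtOne_of_equiv (hG : G.IsExtProjective) {V F : Type u}
    [AddCommGroup V] [Module R V] [AddCommGroup F] [Module R F] (e : V ≃ₗ[R] G.A) (hF : t.IsF F) :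
    KerExtOne (ModuleCat.of R V) (ModuleCat.of R F) := by
  refine kerExtOne_of_forall_split fun E _ _ i p hi hip hp => ?_
  have hpF : t.IsF (LinearMap.ker p) := hF.of_equiv
    (LinearEquiv.ofInjective i hi ≪≫ₗ LinearEquiv.ofEq _ _ (LinearMap.exact_iff.1 hip).symm)
  obtain ⟨g, hg⟩ := hG.exists_lift hpF (f := e.symm.toLinearMap) fun a _ => hp a
  exact ⟨g ∘ₗ e.toLinearMap, fun v => (hg (e v)).trans (e.symm_apply_apply v)⟩

namespace IsSmallProjectiveGenerator

theorem eq_pres (hG : G.IsSmallProjectiveGenerator) :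
    t.T = Pres (ModuleCat.of R (G.P ⧸ LinearMap.range G.d)) := by
  ext T
  refine ⟨fun hT => ?_, fun ⟨I, _, _, p, _, hp⟩ => (G.isT.finsupp I).of_surjective p hp⟩
  obtain ⟨I, p, hp, hker⟩ := hG.exists_presentation (T := T) hT
  obtain ⟨J, f, hf, -⟩ := hG.exists_presentation hker
  refine ⟨I, J, (LinearMap.ker p).subtype ∘ₗ f, p, ?_, hp⟩
  rw [LinearMap.exact_iff, LinearMap.range_comp_of_range_eq_top _ (LinearMap.range_eq_top.2 hf),
    Submodule.range_subtype]

theorem exists_subGen (hG : G.IsSmallProjectiveGenerator) {F : Type u} [AddCommGroup F]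
    [Module R F] (hF : t.IsF F) :
    ∃ (I : Type u) (h : (I →₀ G.A) →ₗ[R] F),
      SubGen (ModuleCat.of R (G.P ⧸ LinearMap.range G.d)) (ModuleCat.of R
        (F ⧸ LinearMap.range (h ∘ₗ Finsupp.mapRange.linearMap (LinearMap.ker G.d).subtype))) := by
  obtain ⟨I, p₁, p₀, hp, hepi⟩ := hG.exists_isConeEpi (ofTorsionFree hF)
  let ν : F →ₗ[R] coneH hp := Submodule.mkQ _ ∘ₗ
    (LinearMap.inl R _ _).codRestrict _ fun _ => Subsingleton.elim _ _
  have hν : LinearMap.ker ν =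
      LinearMap.range (p₁ ∘ₗ Finsupp.mapRange.linearMap (LinearMap.ker G.d).subtype) := by
    ext x
    refine (Submodule.Quotient.mk_eq_zero _).trans ⟨?_, ?_⟩
    · rintro ⟨a, ha⟩
      obtain ⟨h₁, h₀⟩ := Prod.ext_iff.1 (congrArg Subtype.val ha)
      obtain ⟨b, rfl⟩ := (exact_mapRange (LinearMap.exact_subtype_ker_map G.d) I a).1 h₀
      exact ⟨b, h₁⟩
    · rintro ⟨b, rfl⟩
      exact ⟨Finsupp.mapRange.linearMap (LinearMap.ker G.d).subtype b, Subtype.ext (Prod.ext rfl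
        ((exact_mapRange (LinearMap.exact_subtype_ker_map G.d) I).apply_apply_eq_zero b))⟩
  obtain ⟨J, π, hπ, -⟩ := hG.exists_presentation hepi.isT
  refine ⟨I, p₁, ModuleCat.of R (coneH hp), Submodule.liftQ _ ν hν.ge, ⟨J, π, hπ⟩, ?_⟩
  exact LinearMap.ker_eq_bot.1 (Submodule.ker_liftQ_eq_bot' _ _ hν.symm)

theorem isTiltingComplex_ofCover (hG : G.IsSmallProjectiveGenerator) [Module.Finite R G.P]
    {L : Type u} [AddCommGroup L] [Module R L] [Module.Finite R L] {q : L →ₗ[R] G.A}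
    (hq : Function.Surjective q) : t.IsTiltingComplex (ThreeTermComplex.ofCover q G.d) where
  eq_pres := by rw [ThreeTermComplex.H0_ofCover _ hq, hG.eq_pres]
  pres_le := by
    rw [ThreeTermComplex.H0_ofCover _ hq, ← hG.eq_pres]
    exact fun _ hT => hG.kerExtOne hT
  finite_Q := ‹Module.Finite R L›
  finite_P := ‹Module.Finite R G.P›
  projective_P := G.projective
  isF := G.isF.of_injective
    (((ThreeTermComplex.ofCoverEquiv G.d hq).toLinearMap ∘ₗ Submodule.subtype _).codRestrict _
      fun x => (ThreeTermComplex.mem_HNegOne_ofCover G.d hq).1 x.2)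
    fun x y h => by
      have hxy : ThreeTermComplex.ofCoverEquiv G.d hq x = ThreeTermComplex.ofCoverEquiv G.d hq y :=
        congrArg (LinearMap.ker G.d).subtype h
      exact Subtype.ext ((ThreeTermComplex.ofCoverEquiv G.d hq).injective hxy)
  le_reject := by
    refine fun x hx => (Submodule.mem_iInf _).2 fun T => (Submodule.mem_iInf _).2 fun hT =>
      (Submodule.mem_iInf _).2 fun f => ?_
    let e := ThreeTermComplex.ofCoverEquiv G.d hq
    obtain ⟨g, hg⟩ := hG.isExtProjective.exists_extension hT (f ∘ₗ e.symm.toLinearMap)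
    calc f x = f (e.symm (e x)) := by rw [e.symm_apply_apply]
      _ = g (G.d (e x)) := (hg (e x)).symm
      _ = 0 := by rw [(ThreeTermComplex.mem_HNegOne_ofCover G.d hq).1 hx, map_zero]
  le_kerExtOne := fun _ hF =>
    hG.isExtProjective.kerExtOne_of_equiv (ThreeTermComplex.ofCoverEquiv G.d hq) hF
  exists_subGen := by
    obtain ⟨I, h, hsub⟩ := hG.exists_subGen (isF_quotient_torsion (t := t) (M := R))
    refine ⟨I, h ∘ₗ Finsupp.mapRange.linearMap
      (ThreeTermComplex.ofCoverEquiv G.d hq).toLinearMap, ?_⟩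
    rwa [LinearMap.comp_assoc, LinearMap.range_comp,
      ThreeTermComplex.range_mapRange_ofCoverEquiv_comp_HNegOneIncl, ← LinearMap.range_comp,
      ThreeTermComplex.H0_ofCover _ hq]

end IsSmallProjectiveGenerator

end TwoTerm

theorem exists_isTiltingComplex (h : IsModuleCategory.{u} t.TwoTerm) :
    ∃ G : ThreeTermComplex R, t.IsTiltingComplex G ∧ Module.Projective R G.Q ∧
      Function.Injective G.j := by
  obtain ⟨G₀, hG₀⟩ := TwoTerm.exists_isSmallProjectiveGenerator h
  obtain ⟨G, hG, _⟩ := hG₀.exists_finite_P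
  have := hG.finite_A
  obtain ⟨n, q, hq⟩ := Module.Finite.exists_fin' R G.A
  exact ⟨_, hG.isTiltingComplex_ofCover hq, inferInstanceAs (Module.Projective R (Fin n → R)),
    Submodule.subtype_injective _⟩

end TorsionPair

theorem mainTheorem5 (R : Type u) [Ring R] [HasDerivedCategory.{w} (ModuleCat.{u} R)]
    (t : TorsionPair (ModuleCat.{u} R)) :
    IsModuleCategory.{u} t.Heart ↔
      ∃ G : ThreeTermComplex R,
        (t.T = Pres G.H0 ∧ Pres G.H0 ≤ KerExtOne G.H0) ∧
        (Module.Finite R G.Q ∧ Module.Projective R G.Q ∧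
          Module.Finite R G.P ∧ Module.Projective R G.P ∧
          Function.Injective G.j ∧ t.F (ModuleCat.of R G.HNegOne)) ∧
        G.HNegOne ≤ reject t.T (G.Q ⧸ LinearMap.range G.j) ∧
        t.F ≤ KerExtOne G.cokerJ ∧
        ∃ (I : Type u) (h : (I →₀ G.Q ⧸ LinearMap.range G.j) →ₗ[R] R ⧸ t.torsion R),
          SubGen G.H0
            (ModuleCat.of R ((R ⧸ t.torsion R) ⧸ LinearMap.range (h ∘ₗ G.HNegOneIncl I))) := by
  rw [TorsionPair.TwoTerm.isModuleCategory_heart_iff]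
  constructor
  · intro h
    obtain ⟨G, hG, hQ, hj⟩ := TorsionPair.exists_isTiltingComplex h
    exact ⟨G, ⟨hG.eq_pres, hG.pres_le⟩, ⟨hG.finite_Q, hQ, hG.finite_P, hG.projective_P, hj,
      hG.isF⟩, hG.le_reject, hG.le_kerExtOne, hG.exists_subGen⟩
  · rintro ⟨G, ⟨eq_pres, pres_le⟩, ⟨finite_Q, -, finite_P, projective_P, -, isF⟩, le_reject,
      le_kerExtOne, exists_subGen⟩
    exact (TorsionPair.IsTiltingComplex.mk eq_pres pres_le finite_Q finite_P projective_P isF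
      le_reject le_kerExtOne exists_subGen).isTilting.isProgenerator.isModuleCategory
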